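/- Let $X\subseteq\mathbb{C}$ be a Borel set, let $x_0\in\partial X$, and let $t\ge 0$ be an integer; if $t=0$, assume moreover that $X$ is bounded. For $n\ge 1$ put $A_n=\{z\in\mathbb{C}: 2^{-(n+1)}\le|z-x_0|\le 2^{-n}\}$. For a locally integrable $f:\mathbb{C}\to\mathbb{C}$ and a square $Q$ (closed, with sides parallel to the axes) let $f_Q=\frac1{|Q|}\int_Q f\,dA$, $\Omega(f,Q)=\frac1{|Q|}\int_Q|f-f_Q|\,dA$, $\|f\|_*=\sup_Q\Omega(f,Q)$. Let $BMO(\mathbb{C})$ be the set of those $f$ with $\|f\|_*<\infty$, and $VMO(\mathbb{C})$ the set of those $f\in BMO(\mathbb{C})$ for which $\sup\{\Omega(f,Q): Q \text{ of side at most }\delta\}\to0$ as $\delta\to0^+$. Let $\|f\|_{BMO(X)}=\inf\{\|F\|_*: F\in BMO(\mathbb{C}),\ F=f\text{ on }X\}+\left|\int_X f\,dA\right|$ (understood as $\infty$ if $f$ is not integrable on $X$, which cannot happen if $X$ is bounded). One says that $A_0(X)$, the space of VMO functions analytic on $X$, admits a bounded point derivation of order $t$ at $x_0$ if there is a constant $C$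 such that $$|f^{(t)}(x_0)|\le C\,\|f\|_{BMO(X)}$$ for every $f\in VMO(\mathbb{C})$ that is analytic in a neighborhood of $X\cup\{x_0\}$. A measure function is an increasing function $h:[0,\infty)\to[0,\infty)$ with $h(r)\to0$ as $r\to0$; $M^h(E)$ is the infimum of $\sum_j h(r_j)$ over all countable coverings of $E\subseteq\mathbb{C}$ by squares with sides of length $r_j$; and the lower 1-dimensional Hausdorff content $M^1_*(E)$ is the supremum of $M^h(E)$ over all measure functions $h$ with $h(r)\le r$ for all $r$ and $h(r)/r\to0$ as $r\to0^+$. Then $A_0(X)$ admits a bounded point derivation of order $t$ at $x_0$ if and only if $$\sum_{n=1}^\infty 2^{(t+1)n}M^1_*(A_n\setminus X)<\infty .$$ -/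

import Mathlib

open MeasureTheory Filter Topology Set
open scoped NNReal ENNReal

namespace VMODerivation

noncomputable section

/-- The closed axis-parallel square in the plane with lower left corner `a` and side length `l`. -/
def square (a : ℂ) (l : ℝ) : Set ℂ :=
  {z : ℂ | z.re ∈ Icc a.re (a.re + l) ∧ z.im ∈ Icc a.im (a.im + l)}

/-- The mean oscillation of `f` on `Q`, i.e. the average over `Q` (with respect to area) of
`|f - f_Q|`, where `f_Q` is the mean value of `f` on `Q`. -/
def meanOsc (f : ℂ → ℂ) (Q : Set ℂ) : ℝ≥0∞ :=
  (volume Q)⁻¹ * ∫⁻ z in Q, ‖f z - ⨍ w in Q, f w‖ₑ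

/-- `‖f‖_*`: the supremum of the mean oscillations of `f` over all squares. -/
def bmoSeminorm (f : ℂ → ℂ) : ℝ≥0∞ :=
  ⨆ (a : ℂ) (l : ℝ) (_ : 0 < l), meanOsc f (square a l)

/-- `Ω_f(δ)`: the supremum of the mean oscillations of `f` over the squares of side at most `δ`. -/
def oscModulus (f : ℂ → ℂ) (δ : ℝ) : ℝ≥0∞ :=
  ⨆ (a : ℂ) (l : ℝ) (_ : 0 < l) (_ : l ≤ δ), meanOsc f (square a l)

/-- `f ∈ BMO(ℂ)`. -/
def MemBMO (f : ℂ → ℂ) : Prop :=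
  LocallyIntegrable f volume ∧ bmoSeminorm f < ⊤

/-- `f ∈ VMO(ℂ)`. -/
def MemVMO (f : ℂ → ℂ) : Prop :=
  MemBMO f ∧ Tendsto (oscModulus f) (𝓝[>] 0) (𝓝 0)

/-- `‖f‖_X`: the infimum of `‖F‖_*` over all `F ∈ BMO(ℂ)` that agree with `f` on `X`. -/
def bmoSeminormOn (X : Set ℂ) (f : ℂ → ℂ) : ℝ≥0∞ :=
  ⨅ (F : ℂ → ℂ) (_ : MemBMO F) (_ : EqOn F f X), bmoSeminorm F

open Classical in
/-- `‖f‖_{BMO(X)} = ‖f‖_X + |∫_X f dA|`, with the value `∞` if `f` is not integrable on `X`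
(which cannot happen for a bounded set `X` and a locally integrable function `f`). -/
def bmoNormOn (X : Set ℂ) (f : ℂ → ℂ) : ℝ≥0∞ :=
  bmoSeminormOn X f + if IntegrableOn f X volume then ‖∫ z in X, f z‖ₑ else ⊤

/-- `A_0(X)` admits a bounded point derivation of order `t` at `x₀`: the bound
`|f^{(t)}(x₀)| ≤ C ‖f‖_{BMO(X)}` holds for all `f ∈ VMO(ℂ)` that are analytic in a neighborhood of
`X ∪ {x₀}`. -/
def AdmitsBoundedPointDerivation (X : Set ℂ) (x₀ : ℂ) (t : ℕ) : Prop :=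
  ∃ C : ℝ≥0, ∀ f : ℂ → ℂ, MemVMO f → AnalyticOnNhd ℂ f (X ∪ {x₀}) →
    ‖iteratedDeriv t f x₀‖ₑ ≤ C * bmoNormOn X f

/-- A measure function: an increasing function `h(t) ≥ 0`, `t ≥ 0`, with `h(t) → 0` as `t → 0`. -/
structure IsMeasureFunction (h : ℝ≥0 → ℝ≥0) : Prop where
  mono : Monotone h
  tendsto_zero : Tendsto h (𝓝[>] 0) (𝓝 0)

/-- `M^h(E)`: the infimum of `∑ h(r_j)` over all coverings of `E` by a sequence of squares of
side `r_j > 0`. (As `h(t) → 0` when `t → 0`, finite coverings give the same infimum as coverings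
padded to a sequence.) -/
def hContent (h : ℝ≥0 → ℝ≥0) (E : Set ℂ) : ℝ≥0∞ :=
  ⨅ (a : ℕ → ℂ) (r : ℕ → ℝ≥0) (_ : ∀ j, 0 < r j) (_ : E ⊆ ⋃ j, square (a j) (r j)),
    ∑' j, (h (r j) : ℝ≥0∞)

/-- `M^1_*(E)`: the lower 1-dimensional Hausdorff content, the supremum of `M^h(E)` over all measure
functions `h` with `h(t) ≤ t` and `h(t) / t → 0` as `t → 0+`. -/
def lowerContent (E : Set ℂ) : ℝ≥0∞ :=
  ⨆ (h : ℝ≥0 → ℝ≥0) (_ : IsMeasureFunction h) (_ : ∀ t, h t ≤ t)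
    (_ : Tendsto (fun t => h t / t) (𝓝[>] 0) (𝓝 0)), hContent h E

/-- The closed annulus `A_n = {2^{-(n+1)} ≤ |z - x₀| ≤ 2^{-n}}`. -/
def annulus (x₀ : ℂ) (n : ℕ) : Set ℂ :=
  {z : ℂ | ((2 : ℝ) ^ (n + 1))⁻¹ ≤ ‖z - x₀‖ ∧ ‖z - x₀‖ ≤ ((2 : ℝ) ^ n)⁻¹}

end

end VMODerivation

/-!
# Bounded point derivations on spaces of VMO functions and lower Hausdorff content

Write `A_n` for the annuli about `x₀`.

*A bounded point derivation forces the series to converge.* Functions to test the derivation on come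
from Frostman's lemma (`exists_frostman_measure`): up to constants, `M^1_*(A_n \ X)` is the mass of a
measure `μ_n` on a compact subset of `A_n \ X` whose mass on discs of radius `r` is `O(r)` with a
universal constant and is `o(r)` as `r → 0`. By the two growth conditions, the Cauchy
transforms of bounded densities with respect to `μ_n` have bounded BMO seminorm and lie in VMO
(`bmoSeminorm_cauchyTransform_le`, `memVMO_cauchyTransform`). For the density that turns the kernel
`(ζ - x₀)^{-(t+1)}` into its absolute value, the `t`-th derivative at `x₀` of the transform of
`μ_1 + ⋯ + μ_N` is comparable with the partial sum of the series, while the seminorm stays bounded,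
since measures of linear growth on disjoint annuli add up to a measure of linear growth
(`sum_measure_closedBall_le`). To control `∫_X f` for unbounded `X` as well, the transform of a fixed
measure with the same first two moments is subtracted (`exists_density_of_moments`); the difference
decays like `|z|⁻³` and is integrable over the plane.

Frostman's lemma itself is proved for dyadic contents. These are continuous along increasing sequences
of arbitrary sets (`dyContent_iUnion_le`) and, up to a constant, outer regular, so that Borel sets are
capacitable (`exists_isCompact_dyContent_le`). On a compact set, covers can be replaced by fractional
covers (`dyContent_le_of_fractional_cover`), whose least cost is a sublinear functional; the measure is
obtained from it by the Hahn-Banach and Riesz-Markov-Kakutani theorems.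

*Convergence of the series gives a bounded point derivation.* Let `f` be a VMO function that is analytic
near `X ∪ {x₀}`, let `F` agree with `f` on `X`, and let `m` bound its BMO seminorm. Pairing `f` with
`∂̄φ · (z - x₀)^{-(t+1)}` gives a multiple of `f^{(t)}(x₀)`, provided that `φ` equals `1` near `x₀` and
`f` is holomorphic near the support of `φ` (`integral_dbar_mul_cauchyKernel`). The singularities of `f`
are covered by dyadic squares `Q` that are small compared with their distance `d(Q)` from `x₀`, with
`∑ h(side Q) d(Q)^{-(t+1)}` bounded independently of `h` (`exists_dyadic_cover`). The gauge `h` is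
chosen after `f`: it satisfies `h(s) = s` for `s ≥ δ`, and it dominates `s Ω_f(4s) / m` and `s² / δ`
below `δ` (`exists_gauge`). A product `φ` of cutoffs attached to the squares is taken apart one square
at a time, by increasing size; each step changes the pairing by at most a constant times
`d(Q)^{-(t+1)}` times the side of `Q` times the mean oscillation near `Q`
(`enorm_cauchyPairing_insert_sub_le`).

Squares of side below `δ` are therefore paid for by the modulus of oscillation of `f`. For the larger
ones only the seminorm of `F` is available, so `f` is replaced by `F` on them, where `∂̄φ` vanishes.
Elsewhere `f` and `F` are close in the mean at scale `δ`: they coincide on `X`, and squares of side `δ`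
that are less than half filled by `X` are added to the family of large squares, at a cost that the
covering pays for (`exists_large_squares`). The constants that remain disappear in the pairing if
`t ≥ 1`; if `t = 0` they are controlled by `∫_X f`, as `X` is bounded and has positive area
(`exists_constant`).
-/

namespace VMODerivation

/-! ### Dyadic squares -/

/-- The position of the half-open dyadic square of side `2⁻ᵏ` that contains `z`. -/
noncomputable def cell (k : ℕ) (z : ℂ) : ℤ × ℤ := (⌊z.re * 2 ^ k⌋, ⌊z.im * 2 ^ k⌋)

/-- The half-open dyadic square with index `Q = (k, i, j)`: level `k`, hence side `2⁻ᵏ`, and lower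
left corner `2⁻ᵏ (i + j I)`. -/
def cube (Q : ℕ × ℤ × ℤ) : Set ℂ := {z | cell Q.1 z = Q.2}

lemma mem_cube {Q : ℕ × ℤ × ℤ} {z : ℂ} : z ∈ cube Q ↔ cell Q.1 z = Q.2 := Iff.rfl

lemma cell_eq_of_le {k k' : ℕ} (h : k ≤ k') {z w : ℂ} (hzw : cell k' z = cell k' w) :
    cell k z = cell k w := by
  obtain ⟨d, rfl⟩ := Nat.exists_eq_add_of_le h
  have key : ∀ x : ℝ, ⌊x * 2 ^ k⌋ = ⌊x * 2 ^ (k + d)⌋ / ((2 ^ d : ℕ) : ℤ) := by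
    intro x
    rw [← Int.floor_div_natCast]
    congr 1
    push_cast
    rw [pow_add]
    field_simp
  simp only [cell, Prod.mk.injEq] at hzw ⊢
  rw [key, key z.im, hzw.1, hzw.2, ← key, ← key]
  exact ⟨rfl, rfl⟩

lemma mem_cube_iff {Q : ℕ × ℤ × ℤ} {z : ℂ} :
    z ∈ cube Q ↔ ((Q.2.1 : ℝ) ≤ z.re * 2 ^ Q.1 ∧ z.re * 2 ^ Q.1 < Q.2.1 + 1) ∧
      ((Q.2.2 : ℝ) ≤ z.im * 2 ^ Q.1 ∧ z.im * 2 ^ Q.1 < Q.2.2 + 1) := by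
  rw [mem_cube, cell, Prod.ext_iff]
  simp only [Int.floor_eq_iff]

/-- The lower left corner of a dyadic square. -/
noncomputable def corner (Q : ℕ × ℤ × ℤ) : ℂ := ⟨Q.2.1 / 2 ^ Q.1, Q.2.2 / 2 ^ Q.1⟩

/-- The side length of a dyadic square. -/
noncomputable def side (Q : ℕ × ℤ × ℤ) : ℝ := (2 ^ Q.1)⁻¹

lemma side_pos (Q : ℕ × ℤ × ℤ) : 0 < side Q := by unfold side; positivity

lemma side_le_one (Q : ℕ × ℤ × ℤ) : side Q ≤ 1 :=
  inv_le_one_of_one_le₀ (one_le_pow₀ (by norm_num))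

lemma mem_cube_iff' {Q : ℕ × ℤ × ℤ} {z : ℂ} :
    z ∈ cube Q ↔ ((corner Q).re ≤ z.re ∧ z.re < (corner Q).re + side Q) ∧
      ((corner Q).im ≤ z.im ∧ z.im < (corner Q).im + side Q) := by
  have h : (0 : ℝ) < 2 ^ Q.1 := by positivity
  rw [mem_cube_iff]
  simp only [corner, side, ← one_div, ← add_div, div_le_iff₀ h, lt_div_iff₀ h]

lemma cube_subset_square (Q : ℕ × ℤ × ℤ) : cube Q ⊆ square (corner Q) (side Q) := by
  intro z hz
  rw [mem_cube_iff'] at hz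
  exact ⟨⟨hz.1.1, hz.1.2.le⟩, ⟨hz.2.1, hz.2.2.le⟩⟩

lemma corner_mem_cube (Q : ℕ × ℤ × ℤ) : corner Q ∈ cube Q := by
  rw [mem_cube_iff']
  have := side_pos Q
  refine ⟨⟨le_rfl, ?_⟩, ⟨le_rfl, ?_⟩⟩ <;> linarith

lemma mem_cube_cell (k : ℕ) (z : ℂ) : z ∈ cube (k, cell k z) := rfl

lemma eq_of_mem_cube {Q Q' : ℕ × ℤ × ℤ} {z : ℂ} (h : z ∈ cube Q) (h' : z ∈ cube Q')
    (hk : Q.1 = Q'.1) : Q = Q' := by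
  rw [mem_cube] at h h'
  exact Prod.ext hk (by rw [← h, ← h', hk])

lemma cube_subset_of_mem {Q Q' : ℕ × ℤ × ℤ} {z : ℂ} (h : z ∈ cube Q) (h' : z ∈ cube Q')
    (hk : Q'.1 ≤ Q.1) : cube Q ⊆ cube Q' := by
  intro w hw
  rw [mem_cube] at *
  rw [← h', cell_eq_of_le hk (hw.trans h.symm)]

lemma measurableSet_cube (Q : ℕ × ℤ × ℤ) : MeasurableSet (cube Q) := by
  have : cube Q = {z : ℂ | (corner Q).re ≤ z.re} ∩ {z : ℂ | z.re < (corner Q).re + side Q} ∩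
      ({z : ℂ | (corner Q).im ≤ z.im} ∩ {z : ℂ | z.im < (corner Q).im + side Q}) := by
    ext z; rw [mem_cube_iff']; rfl
  rw [this]
  have hr := Complex.measurable_re
  have hi := Complex.measurable_im
  exact ((measurableSet_le measurable_const hr).inter (measurableSet_lt hr measurable_const)).inter
    ((measurableSet_le measurable_const hi).inter (measurableSet_lt hi measurable_const))

lemma disjoint_cube {Q Q' : ℕ × ℤ × ℤ} (hk : Q.1 = Q'.1) (hne : Q ≠ Q') :
    Disjoint (cube Q) (cube Q') :=
  Set.disjoint_left.2 fun _ h h' => hne (eq_of_mem_cube h h' hk)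

/-! ### Dyadic contents and increasing unions -/

/-- The cost of a family of dyadic squares for the weights `H` (depending on the level only). -/
noncomputable def cost (H : ℕ → ℝ≥0∞) (V : Set (ℕ × ℤ × ℤ)) : ℝ≥0∞ := ∑' Q : V, H Q.1.1

/-- The union of a family of dyadic squares. -/
def cover (V : Set (ℕ × ℤ × ℤ)) : Set ℂ := ⋃ Q ∈ V, cube Q

/-- The dyadic content of `E`: the infimum of the costs of the covers of `E` by dyadic squares of
side at most one. -/
noncomputable def dyContent (H : ℕ → ℝ≥0∞) (E : Set ℂ) : ℝ≥0∞ :=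
  ⨅ (V : Set (ℕ × ℤ × ℤ)) (_ : E ⊆ cover V), cost H V

/-- The maximal squares of a family of dyadic squares. -/
def maxFam (V : Set (ℕ × ℤ × ℤ)) : Set (ℕ × ℤ × ℤ) :=
  {Q ∈ V | ∀ z ∈ cube Q, ∀ Q' ∈ V, z ∈ cube Q' → Q.1 ≤ Q'.1}

lemma mem_cover {V : Set (ℕ × ℤ × ℤ)} {z : ℂ} : z ∈ cover V ↔ ∃ Q ∈ V, z ∈ cube Q := by
  simp [cover]

lemma cover_mono {V W : Set (ℕ × ℤ × ℤ)} (h : V ⊆ W) : cover V ⊆ cover W :=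
  biUnion_subset_biUnion_left h

lemma maxFam_subset (V : Set (ℕ × ℤ × ℤ)) : maxFam V ⊆ V := fun _ h => h.1

lemma cover_maxFam (V : Set (ℕ × ℤ × ℤ)) : cover (maxFam V) = cover V := by
  refine Subset.antisymm (cover_mono (maxFam_subset V)) fun z hz => ?_
  classical
  have hex : ∃ k : ℕ, (k, cell k z) ∈ V := by
    obtain ⟨Q, hQ, hz⟩ := mem_cover.1 hz
    refine ⟨Q.1, ?_⟩
    rw [mem_cube] at hz
    rwa [hz]
  refine mem_cover.2 ⟨(Nat.find hex, cell (Nat.find hex) z), ⟨Nat.find_spec hex, ?_⟩, rfl⟩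
  intro w hw Q' hQ' hw'
  by_contra! hlt
  refine Nat.find_min hex hlt ?_
  have := cube_subset_of_mem hw hw' hlt.le (mem_cube_cell _ z)
  rw [mem_cube] at this
  rwa [this]

lemma cost_mono {H : ℕ → ℝ≥0∞} {V W : Set (ℕ × ℤ × ℤ)} (h : V ⊆ W) : cost H V ≤ cost H W :=
  ENNReal.tsum_mono_subtype (fun Q : ℕ × ℤ × ℤ => H Q.1) h

lemma cost_union_le (H : ℕ → ℝ≥0∞) (V W : Set (ℕ × ℤ × ℤ)) :
    cost H (V ∪ W) ≤ cost H V + cost H W :=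
  ENNReal.tsum_union_le (fun Q : ℕ × ℤ × ℤ => H Q.1) V W

lemma cost_union_disjoint (H : ℕ → ℝ≥0∞) {V W : Set (ℕ × ℤ × ℤ)} (h : Disjoint V W) :
    cost H (V ∪ W) = cost H V + cost H W :=
  Summable.tsum_union_disjoint (f := fun Q : ℕ × ℤ × ℤ => H Q.1) h ENNReal.summable
    ENNReal.summable

lemma dyContent_le {H : ℕ → ℝ≥0∞} {E : Set ℂ} {V : Set (ℕ × ℤ × ℤ)} (h : E ⊆ cover V) :
    dyContent H E ≤ cost H V := iInf₂_le V h

lemma dyContent_mono {H : ℕ → ℝ≥0∞} {E F : Set ℂ} (h : E ⊆ F) :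
    dyContent H E ≤ dyContent H F :=
  le_iInf₂ fun _ hV => dyContent_le (h.trans hV)

lemma exists_cover_cost_lt {H : ℕ → ℝ≥0∞} {E : Set ℂ} {a : ℝ≥0∞} (h : dyContent H E < a) :
    ∃ V, E ⊆ cover V ∧ cost H V < a := by
  simpa [dyContent, iInf_lt_iff] using h

/-- Strong subadditivity at the level of families: the squares discarded in passing from `V` and `W`
to the maximal squares of the union still cover every set that is covered by both. -/
lemma cost_maxFam_union_add_le {H : ℕ → ℝ≥0∞} {E : Set ℂ} {V W : Set (ℕ × ℤ × ℤ)}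
    (hV : E ⊆ cover V) (hW : E ⊆ cover W) :
    cost H (maxFam (V ∪ W)) + dyContent H E ≤ cost H V + cost H W := by
  have hcov : E ⊆ cover (((V ∪ W) \ maxFam (V ∪ W)) ∪ (V ∩ W)) := by
    intro z hz
    obtain ⟨Q, hQ, hzQ⟩ := mem_cover.1 (hV hz)
    obtain ⟨R, hR, hzR⟩ := mem_cover.1 (hW hz)
    rcases lt_trichotomy Q.1 R.1 with h | h | h
    · refine mem_cover.2 ⟨R, Or.inl ⟨Or.inr hR, fun hm => ?_⟩, hzR⟩
      exact absurd (hm.2 z hzR Q (Or.inl hQ) hzQ) (not_le.2 h)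
    · have := eq_of_mem_cube hzQ hzR h
      subst this
      exact mem_cover.2 ⟨Q, Or.inr ⟨hQ, hR⟩, hzQ⟩
    · refine mem_cover.2 ⟨Q, Or.inl ⟨Or.inl hQ, fun hm => ?_⟩, hzQ⟩
      exact absurd (hm.2 z hzQ R (Or.inr hR) hzR) (not_le.2 h)
  have h1 : cost H V + cost H W = cost H (V ∪ W) + cost H (V ∩ W) := by
    have e1 : cost H V = cost H (V \ W) + cost H (V ∩ W) := by
      rw [← cost_union_disjoint H disjoint_sdiff_inter, sdiff_union_inter]
    have e2 : cost H (V ∪ W) = cost H (V \ W) + cost H W := by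
      rw [← cost_union_disjoint H disjoint_sdiff_left, sdiff_union_self]
    rw [e1, e2]; ring
  have h2 : cost H (V ∪ W) = cost H (maxFam (V ∪ W)) + cost H ((V ∪ W) \ maxFam (V ∪ W)) := by
    rw [← cost_union_disjoint H disjoint_sdiff_right, union_sdiff_cancel (maxFam_subset _)]
  rw [h1, h2, add_assoc]
  gcongr
  exact (dyContent_le hcov).trans (cost_union_le H _ _)

/-- The families obtained from a sequence `U` by adding its members one at a time and keeping the
maximal squares only. -/
def maxUnion (U : ℕ → Set (ℕ × ℤ × ℤ)) : ℕ → Set (ℕ × ℤ × ℤ)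
  | 0 => U 0
  | n + 1 => maxFam (maxUnion U n ∪ U (n + 1))

lemma maxUnion_subset (U : ℕ → Set (ℕ × ℤ × ℤ)) (n : ℕ) : maxUnion U n ⊆ ⋃ i, U i := by
  induction n with
  | zero => exact subset_iUnion U 0
  | succ n ih => exact (maxFam_subset _).trans (union_subset ih (subset_iUnion U _))

lemma cover_subset_cover_maxUnion (U : ℕ → Set (ℕ × ℤ × ℤ)) (n : ℕ) :
    cover (U n) ⊆ cover (maxUnion U n) := by
  cases n with
  | zero => exact subset_rfl
  | succ n =>
    rw [maxUnion, cover_maxFam]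
    exact cover_mono subset_union_right

lemma mem_maxUnion_of_mem_maxFam {U : ℕ → Set (ℕ × ℤ × ℤ)} {Q : ℕ × ℤ × ℤ}
    (hQ : Q ∈ maxFam (⋃ i, U i)) {i : ℕ} (hi : Q ∈ U i) {n : ℕ} (hn : i ≤ n) :
    Q ∈ maxUnion U n := by
  have key : ∀ n, Q ∈ maxUnion U n ∪ U (n + 1) → Q ∈ maxUnion U (n + 1) := fun n h =>
    ⟨h, fun z hz Q' hQ' => hQ.2 z hz Q'
      ((union_subset (maxUnion_subset U n) (subset_iUnion U _)) hQ')⟩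
  induction n, hn using Nat.le_induction with
  | base =>
    cases i with
    | zero => exact hi
    | succ i => exact key i (Or.inr hi)
  | succ n _ ih => exact key n (Or.inl ih)

/-- Dyadic contents are continuous along increasing sequences of arbitrary sets. -/
theorem dyContent_iUnion_le {H : ℕ → ℝ≥0∞} {E : ℕ → Set ℂ} (hE : Monotone E) {a : ℝ≥0∞}
    (ha : ∀ n, dyContent H (E n) ≤ a) : dyContent H (⋃ n, E n) ≤ a := by
  rcases eq_or_ne a ⊤ with rfl | hatop
  · exact le_top
  refine ENNReal.le_of_forall_pos_le_add fun ε hε _ => ?_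
  obtain ⟨δ, hδ, hδs⟩ := ENNReal.exists_pos_sum_of_countable (ε := (ε : ℝ≥0∞))
    (by simpa using hε.ne') ℕ
  have hfin : ∀ n, dyContent H (E n) ≠ ⊤ := fun n => ne_top_of_le_ne_top hatop (ha n)
  have hex : ∀ n, ∃ V, E n ⊆ cover V ∧ cost H V < dyContent H (E n) + δ n := fun n =>
    exists_cover_cost_lt (ENNReal.lt_add_right (hfin n) (by simpa using (hδ n).ne'))
  choose U hU hUc using hex
  have hcov : ∀ n, E n ⊆ cover (maxUnion U n) := fun n =>
    (hU n).trans (cover_subset_cover_maxUnion U n)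
  have hcost : ∀ n, cost H (maxUnion U n) ≤ dyContent H (E n) +
      ∑ i ∈ Finset.range (n + 1), (δ i : ℝ≥0∞) := by
    intro n
    induction n with
    | zero => simpa [maxUnion] using (hUc 0).le
    | succ n ih =>
      have h1 := cost_maxFam_union_add_le (H := H) (hcov n) ((hE n.le_succ).trans (hU (n + 1)))
      have h2 : cost H (maxUnion U (n + 1)) + dyContent H (E n) ≤
          (dyContent H (E (n + 1)) + ∑ i ∈ Finset.range (n + 2), (δ i : ℝ≥0∞)) +
            dyContent H (E n) := by
        refine h1.trans ((add_le_add ih (hUc (n + 1)).le).trans (le_of_eq ?_))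
        rw [Finset.sum_range_succ _ (n + 1)]
        ring
      exact (ENNReal.add_le_add_iff_right (hfin n)).1 h2
  have hcov' : (⋃ n, E n) ⊆ cover (maxFam (⋃ i, U i)) := by
    rw [cover_maxFam]
    exact iUnion_subset fun n => (hU n).trans (cover_mono (subset_iUnion U n))
  refine (dyContent_le hcov').trans ?_
  rw [cost, ENNReal.tsum_eq_iSup_sum]
  refine iSup_le fun s => ?_
  have hidx : ∀ Q : maxFam (⋃ i, U i), ∃ i, Q.1 ∈ U i := fun Q => mem_iUnion.1 Q.2.1
  choose idx hidx using hidx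
  have hsub : ∀ Q ∈ s, Q.1 ∈ maxUnion U (s.sup idx) := fun Q hQ =>
    mem_maxUnion_of_mem_maxFam Q.2 (hidx Q) (Finset.le_sup hQ)
  calc ∑ Q ∈ s, H Q.1.1
      = ∑ Q ∈ s.map (Function.Embedding.subtype _), H Q.1 := by rw [Finset.sum_map]; rfl
    _ = cost H (↑(s.map (Function.Embedding.subtype _)) : Set (ℕ × ℤ × ℤ)) :=
        (Finset.tsum_subtype _ (fun Q : ℕ × ℤ × ℤ => H Q.1)).symm
    _ ≤ cost H (maxUnion U (s.sup idx)) := cost_mono (by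
        intro Q hQ
        simp only [Finset.coe_map, Function.Embedding.subtype_apply, mem_image,
          Finset.mem_coe] at hQ
        obtain ⟨R, hR, rfl⟩ := hQ
        exact hsub R hR)
    _ ≤ _ := hcost _
    _ ≤ a + ε := add_le_add (ha _) ((ENNReal.sum_le_tsum _).trans hδs.le)

/-! ### Capacitability of Borel sets -/

/-- A dyadic square and its eight neighbours of the same level. -/
noncomputable def nbrs (Q : ℕ × ℤ × ℤ) : Finset (ℕ × ℤ × ℤ) :=
  (Finset.Icc (-1 : ℤ) 1 ×ˢ Finset.Icc (-1 : ℤ) 1).image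
    fun d => (Q.1, Q.2.1 + d.1, Q.2.2 + d.2)

/-- The open square with the same centre as `cube Q` and three times its side. -/
def thick (Q : ℕ × ℤ × ℤ) : Set ℂ :=
  {z | ((Q.2.1 : ℝ) - 1 < z.re * 2 ^ Q.1 ∧ z.re * 2 ^ Q.1 < Q.2.1 + 2) ∧
    ((Q.2.2 : ℝ) - 1 < z.im * 2 ^ Q.1 ∧ z.im * 2 ^ Q.1 < Q.2.2 + 2)}

lemma isOpen_thick (Q : ℕ × ℤ × ℤ) : IsOpen (thick Q) := by
  have hr : Continuous fun z : ℂ => z.re * 2 ^ Q.1 := by fun_prop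
  have hi : Continuous fun z : ℂ => z.im * 2 ^ Q.1 := by fun_prop
  exact ((isOpen_lt continuous_const hr).inter (isOpen_lt hr continuous_const)).inter
    ((isOpen_lt continuous_const hi).inter (isOpen_lt hi continuous_const))

lemma cube_subset_thick (Q : ℕ × ℤ × ℤ) : cube Q ⊆ thick Q := by
  intro z hz
  rw [mem_cube_iff] at hz
  refine ⟨⟨?_, ?_⟩, ⟨?_, ?_⟩⟩ <;> linarith [hz.1.1, hz.1.2, hz.2.1, hz.2.2]

lemma exists_nbrs_of_mem_thick {Q : ℕ × ℤ × ℤ} {z : ℂ} (hz : z ∈ thick Q) :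
    ∃ R ∈ nbrs Q, z ∈ cube R := by
  obtain ⟨⟨h1, h2⟩, h3, h4⟩ := hz
  refine ⟨(Q.1, cell Q.1 z), ?_, rfl⟩
  have key : ∀ (i : ℤ) (x : ℝ), (i : ℝ) - 1 < x → x < i + 2 → -1 ≤ ⌊x⌋ - i ∧ ⌊x⌋ - i ≤ 1 := by
    intro i x h h'
    have a1 : i - 1 ≤ ⌊x⌋ := Int.le_floor.2 (by push_cast; exact h.le)
    have a2 : ⌊x⌋ < i + 2 := Int.floor_lt.2 (by push_cast; exact h')
    constructor <;> omega
  simp only [nbrs, Finset.mem_image, Finset.mem_product, Finset.mem_Icc]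
  refine ⟨(⌊z.re * 2 ^ Q.1⌋ - Q.2.1, ⌊z.im * 2 ^ Q.1⌋ - Q.2.2), ⟨key _ _ h1 h2, key _ _ h3 h4⟩, ?_⟩
  simp [cell]

lemma card_nbrs_le (Q : ℕ × ℤ × ℤ) : (nbrs Q).card ≤ 9 :=
  Finset.card_image_le.trans (by simp)

lemma fst_of_mem_nbrs {Q R : ℕ × ℤ × ℤ} (h : R ∈ nbrs Q) : R.1 = Q.1 := by
  simp only [nbrs, Finset.mem_image] at h
  obtain ⟨d, _, rfl⟩ := h
  rfl

lemma cost_iUnion_nbrs_le (H : ℕ → ℝ≥0∞) (V : Set (ℕ × ℤ × ℤ)) :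
    cost H (⋃ Q : V, (nbrs Q.1 : Set (ℕ × ℤ × ℤ))) ≤ 9 * cost H V := by
  refine (ENNReal.tsum_iUnion_le_tsum (fun Q : ℕ × ℤ × ℤ => H Q.1) _).trans ?_
  rw [cost, ← ENNReal.tsum_mul_left]
  refine ENNReal.tsum_le_tsum fun Q => ?_
  rw [Finset.tsum_subtype' (nbrs Q.1) (fun R : ℕ × ℤ × ℤ => H R.1),
    Finset.sum_congr rfl fun R hR => by rw [fst_of_mem_nbrs hR], Finset.sum_const, nsmul_eq_mul]
  gcongr
  exact_mod_cast card_nbrs_le _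

lemma dyContent_iUnion_thick_le (H : ℕ → ℝ≥0∞) (V : Set (ℕ × ℤ × ℤ)) :
    dyContent H (⋃ Q ∈ V, thick Q) ≤ 9 * cost H V := by
  refine (dyContent_le fun z hz => ?_).trans (cost_iUnion_nbrs_le H V)
  simp only [mem_iUnion] at hz
  obtain ⟨Q, hQ, hz⟩ := hz
  obtain ⟨R, hR, hzR⟩ := exists_nbrs_of_mem_thick hz
  exact mem_cover.2 ⟨R, mem_iUnion.2 ⟨⟨Q, hQ⟩, hR⟩, hzR⟩

lemma isCompact_box (n : ℕ → ℕ) : IsCompact {x : ℕ → ℕ | ∀ i, x i ≤ n i} := by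
  have : {x : ℕ → ℕ | ∀ i, x i ≤ n i} = Set.pi univ fun i => Set.Iic (n i) := by
    ext x; simp [Pi.le_def]
  rw [this]
  exact isCompact_univ_pi fun i => (Set.finite_Iic (n i)).isCompact

/-- An open neighbourhood of a box in the Baire space contains a set that restrains only finitely
many coordinates. -/
lemma exists_restrict_subset {W : Set (ℕ → ℕ)} (hW : IsOpen W) (n : ℕ → ℕ)
    (h : {x : ℕ → ℕ | ∀ i, x i ≤ n i} ⊆ W) : ∃ k, {x : ℕ → ℕ | ∀ i < k, x i ≤ n i} ⊆ W := by
  have hcomp := isCompact_box n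
  have hcyl : ∀ x ∈ W, ∃ k, PiNat.cylinder x k ⊆ W := by
    intro x hx
    obtain ⟨v, hv, hxv, hvW⟩ :=
      (PiNat.isTopologicalBasis_cylinders (fun _ : ℕ => ℕ)).exists_subset_of_mem_open hx hW
    obtain ⟨y, k, rfl⟩ := hv
    exact ⟨k, by rwa [PiNat.mem_cylinder_iff_eq.1 hxv]⟩
  choose! k hk using hcyl
  obtain ⟨s, hs, hcov⟩ := hcomp.elim_nhds_subcover (fun x => PiNat.cylinder x (k x)) fun x _ =>
    (PiNat.isOpen_cylinder (fun _ : ℕ => ℕ) x (k x)).mem_nhds (PiNat.self_mem_cylinder x _)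
  refine ⟨s.sup k, fun x hx => ?_⟩
  obtain ⟨y, hys, hxy⟩ := mem_iUnion₂.1
    (hcov (show (fun i => min (x i) (n i)) ∈ _ from fun i => min_le_right _ _))
  refine hk y (h (hs y hys)) fun i hi => ?_
  rw [← hxy i hi]
  exact (min_eq_left (hx i (hi.trans_le (Finset.le_sup hys)))).symm

/-- Borel sets are capacitable for dyadic contents, up to a constant factor. -/
theorem exists_isCompact_dyContent_le {H : ℕ → ℝ≥0∞} {E : Set ℂ} (hE : MeasurableSet E)
    {a : ℝ≥0∞} (ha : a < dyContent H E) :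
    ∃ K ⊆ E, IsCompact K ∧ a ≤ 9 * dyContent H K := by
  have han := hE.analyticSet
  rw [AnalyticSet] at han
  rcases han with rfl | ⟨f, hf, rfl⟩
  · have : dyContent H ∅ ≤ 0 := (dyContent_le (V := ∅) (empty_subset _)).trans (by simp [cost])
    exact absurd (ha.trans_le this) (by simp)
  have step : ∀ (A : Set (ℕ → ℕ)) (k : ℕ), a < dyContent H (f '' A) →
      ∃ m, a < dyContent H (f '' (A ∩ {x | x k ≤ m})) := by
    intro A k hA
    by_contra! hcon
    refine absurd (dyContent_iUnion_le (E := fun m => f '' (A ∩ {x | x k ≤ m})) ?_ hcon)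
      (not_le.2 ?_)
    · intro m m' hm
      exact image_mono (inter_subset_inter_right _ fun x hx => le_trans hx hm)
    · rw [← image_iUnion, ← inter_iUnion]
      convert hA using 3
      refine inter_eq_left.2 fun x _ => mem_iUnion.2 ⟨x k, le_refl (x k)⟩
  choose! m hm using step
  let A : ℕ → Set (ℕ → ℕ) := fun k => Nat.rec univ (fun k A => A ∩ {x | x k ≤ m A k}) k
  have hA : ∀ k, a < dyContent H (f '' A k) := by
    intro k
    induction k with
    | zero => simpa [A] using ha
    | succ k ih => exact hm _ k ih
  let n : ℕ → ℕ := fun k => m (A k) k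
  have hAn : ∀ k, A k ⊆ {x | ∀ i < k, x i ≤ n i} := by
    intro k
    induction k with
    | zero => intro x _ i hi; omega
    | succ k ih =>
      intro x hx i hi
      rcases Nat.lt_succ_iff_lt_or_eq.1 hi with h | rfl
      · exact ih hx.1 i h
      · exact hx.2
  have hcomp := isCompact_box n
  refine ⟨f '' {x | ∀ i, x i ≤ n i}, image_subset_range _ _, hcomp.image hf, ?_⟩
  rw [dyContent, ENNReal.mul_iInf_of_ne (by simp) (by simp)]
  refine le_iInf fun V => ?_
  rw [ENNReal.mul_iInf_of_ne (by simp) (by simp)]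
  refine le_iInf fun hV => ?_
  obtain ⟨k, hk⟩ := exists_restrict_subset (W := f ⁻¹' ⋃ Q ∈ V, thick Q)
    ((isOpen_biUnion fun Q _ => isOpen_thick Q).preimage hf) n (by
      rw [← image_subset_iff]
      exact hV.trans (biUnion_mono subset_rfl fun Q _ => cube_subset_thick Q))
  exact (hA k).le.trans ((dyContent_mono (image_subset_iff.2 ((hAn k).trans hk))).trans
    (dyContent_iUnion_thick_le H V))

/-! ### Frostman measures -/

/-- Fractional covers by dyadic squares are not cheaper than covers: choosing the squares at which
the total weight, summed along the chain of squares around a point, passes a level `s ∈ (0, 1]` gives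
a cover, and the cost of this cover averages over `s` to at most the cost of the fractional one. -/
lemma dyContent_le_of_fractional_cover {H : ℕ → ℝ≥0∞} {K : Set ℂ} (J : Finset (ℕ × ℤ × ℤ))
    (c : ℕ × ℤ × ℤ → ℝ)
    (hK : ∀ x ∈ K, 1 ≤ ∑ Q ∈ J, (cube Q).indicator (fun _ => c Q) x) :
    dyContent H K ≤ ∑ Q ∈ J, ENNReal.ofReal (c Q) * H Q.1 := by
  classical
  let F : ℂ → ℕ → ℝ := fun x k => ∑ Q ∈ J with Q.1 < k, (cube Q).indicator (fun _ => c Q) x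
  let C : ℕ × ℤ × ℤ → ℝ := fun Q => F (corner Q) Q.1
  have hcov : ∀ s : ℝ, 0 < s → s ≤ 1 →
      K ⊆ cover {Q | Q ∈ J ∧ C Q < s ∧ s ≤ C Q + c Q} := by
    intro s hs0 hs1 x hx
    have hex : ∃ k, s ≤ F x k := by
      refine ⟨J.sup Prod.fst + 1, hs1.trans ((hK x hx).trans (le_of_eq ?_))⟩
      refine (Finset.sum_congr (Finset.filter_true_of_mem fun Q hQ => ?_) fun _ _ => rfl).symm
      exact Nat.lt_succ_of_le (Finset.le_sup (f := Prod.fst) hQ)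
    obtain ⟨k, hk, hk'⟩ : ∃ k, F x k < s ∧ s ≤ F x (k + 1) := by
      have h0 : Nat.find hex ≠ 0 := by
        intro h
        have := Nat.find_spec hex
        rw [h] at this
        simp only [F, not_lt_zero, Finset.filter_false, Finset.sum_empty] at this
        linarith
      obtain ⟨k, hk⟩ := Nat.exists_eq_succ_of_ne_zero h0
      refine ⟨k, not_le.1 (Nat.find_min hex (by omega)), ?_⟩
      have := Nat.find_spec hex
      rwa [hk] at this
    set Q : ℕ × ℤ × ℤ := (k, cell k x) with hQdef
    have hsplit : F x (k + 1) = F x k + ∑ R ∈ J with R.1 = k,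
        (cube R).indicator (fun _ => c R) x := by
      simp only [F]
      rw [← Finset.sum_union]
      · congr 1
        ext R
        simp only [Finset.mem_filter, Finset.mem_union]
        constructor
        · rintro ⟨h1, h2⟩
          rcases Nat.lt_succ_iff_lt_or_eq.1 h2 with h | h
          · exact Or.inl ⟨h1, h⟩
          · exact Or.inr ⟨h1, h⟩
        · rintro (⟨h1, h2⟩ | ⟨h1, h2⟩)
          · exact ⟨h1, by omega⟩
          · exact ⟨h1, by omega⟩
      · rw [Finset.disjoint_left]
        intro R h1 h2
        simp only [Finset.mem_filter] at h1 h2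
        omega
    have honly : ∀ R ∈ J, R.1 = k → R ≠ Q → (cube R).indicator (fun _ => c R) x = 0 := by
      intro R _ hRk hne
      refine indicator_of_notMem (fun hx => hne ?_) _
      exact eq_of_mem_cube hx (mem_cube_cell k x) hRk
    have hCQ : C Q = F x k := by
      refine Finset.sum_congr rfl fun R hR => ?_
      have hlt : R.1 < k := (Finset.mem_filter.1 hR).2
      have hiff : corner Q ∈ cube R ↔ x ∈ cube R := by
        have := cell_eq_of_le hlt.le (corner_mem_cube Q : cell k (corner Q) = cell k x)
        rw [mem_cube, mem_cube, this]
      by_cases hxR : x ∈ cube R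
      · rw [indicator_of_mem hxR, indicator_of_mem (hiff.2 hxR)]
      · rw [indicator_of_notMem hxR, indicator_of_notMem (fun h => hxR (hiff.1 h))]
    have hQJ : Q ∈ J := by
      by_contra hQJ
      have : ∑ R ∈ J with R.1 = k, (cube R).indicator (fun _ => c R) x = 0 := by
        refine Finset.sum_eq_zero fun R hR => ?_
        rw [Finset.mem_filter] at hR
        exact honly R hR.1 hR.2 fun h => hQJ (h ▸ hR.1)
      rw [hsplit, this] at hk'
      linarith
    have hsum : ∑ R ∈ J with R.1 = k, (cube R).indicator (fun _ => c R) x = c Q := by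
      rw [Finset.sum_eq_single Q]
      · exact indicator_of_mem (mem_cube_cell k x) _
      · intro R hR hne
        rw [Finset.mem_filter] at hR
        exact honly R hR.1 hR.2 hne
      · intro h
        exact (h (Finset.mem_filter.2 ⟨hQJ, (rfl : Q.1 = k)⟩)).elim
    refine mem_cover.2 ⟨Q, ⟨hQJ, by rwa [hCQ], ?_⟩, mem_cube_cell k x⟩
    rw [hCQ, ← hsum, ← hsplit]
    exact hk'
  have hle : ∀ s ∈ Ioc (0 : ℝ) 1, dyContent H K ≤
      ∑ Q ∈ J, (Ioc (C Q) (C Q + c Q)).indicator (fun _ => H Q.1) s := by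
    intro s hs
    refine (dyContent_le (hcov s hs.1 hs.2)).trans (le_of_eq ?_)
    have : {Q | Q ∈ J ∧ C Q < s ∧ s ≤ C Q + c Q} =
        ((J.filter fun Q => C Q < s ∧ s ≤ C Q + c Q : Finset _) : Set (ℕ × ℤ × ℤ)) := by
      ext Q; simp
    rw [cost, this, Finset.tsum_subtype' _ (fun Q : ℕ × ℤ × ℤ => H Q.1), Finset.sum_filter]
    exact Finset.sum_congr rfl fun Q _ => by simp only [indicator_apply, mem_Ioc]
  calc dyContent H K = ∫⁻ _ in Ioc (0 : ℝ) 1, dyContent H K := by simp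
    _ ≤ ∫⁻ s in Ioc (0 : ℝ) 1, ∑ Q ∈ J, (Ioc (C Q) (C Q + c Q)).indicator (fun _ => H Q.1) s :=
        setLIntegral_mono' measurableSet_Ioc hle
    _ ≤ ∫⁻ s, ∑ Q ∈ J, (Ioc (C Q) (C Q + c Q)).indicator (fun _ => H Q.1) s :=
        setLIntegral_le_lintegral _ _
    _ = ∑ Q ∈ J, ∫⁻ s, (Ioc (C Q) (C Q + c Q)).indicator (fun _ => H Q.1) s :=
        lintegral_finsetSum _ fun Q _ => measurable_const.indicator measurableSet_Ioc
    _ = ∑ Q ∈ J, ENNReal.ofReal (c Q) * H Q.1 := by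
        refine Finset.sum_congr rfl fun Q _ => ?_
        rw [lintegral_indicator measurableSet_Ioc, setLIntegral_const, Real.volume_Ioc,
          add_sub_cancel_left, mul_comm]

/-- The cost of a finitely supported fractional family of dyadic squares. -/
noncomputable def fracCost (H : ℕ → ℝ≥0) (c : (ℕ × ℤ × ℤ) →₀ ℝ≥0) : ℝ :=
  c.sum fun Q a => (a : ℝ) * H Q.1

/-- The total weight that a fractional family of dyadic squares puts on the point `x`. -/
noncomputable def fracVal (c : (ℕ × ℤ × ℤ) →₀ ℝ≥0) (x : ℂ) : ℝ :=
  c.sum fun Q a => (cube Q).indicator (fun _ => (a : ℝ)) x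

lemma fracCost_add (H : ℕ → ℝ≥0) (c d : (ℕ × ℤ × ℤ) →₀ ℝ≥0) :
    fracCost H (c + d) = fracCost H c + fracCost H d := by
  classical
  exact Finsupp.sum_add_index' (by simp) (by intros; push_cast; ring)

lemma fracVal_add (c d : (ℕ × ℤ × ℤ) →₀ ℝ≥0) (x : ℂ) :
    fracVal (c + d) x = fracVal c x + fracVal d x := by
  classical
  refine Finsupp.sum_add_index' (by simp) fun Q a b => ?_
  by_cases h : x ∈ cube Q <;> simp [h]

lemma fracCost_smul (H : ℕ → ℝ≥0) (s : ℝ≥0) (c : (ℕ × ℤ × ℤ) →₀ ℝ≥0) :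
    fracCost H (s • c) = s * fracCost H c := by
  rw [fracCost, Finsupp.sum_smul_index' (by simp), fracCost, Finsupp.mul_sum]
  exact Finsupp.sum_congr fun Q _ => by simp [mul_assoc]

lemma fracVal_smul (s : ℝ≥0) (c : (ℕ × ℤ × ℤ) →₀ ℝ≥0) (x : ℂ) :
    fracVal (s • c) x = s * fracVal c x := by
  rw [fracVal, Finsupp.sum_smul_index' (by simp), fracVal, Finsupp.mul_sum]
  refine Finsupp.sum_congr fun Q _ => ?_
  by_cases h : x ∈ cube Q <;> simp [h]

lemma fracCost_nonneg (H : ℕ → ℝ≥0) (c : (ℕ × ℤ × ℤ) →₀ ℝ≥0) : 0 ≤ fracCost H c :=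
  Finset.sum_nonneg fun _ _ => by positivity

/-- The fractional family that gives weight one to each square of the finite family `J`. -/
noncomputable def fracOfFinset (J : Finset (ℕ × ℤ × ℤ)) : (ℕ × ℤ × ℤ) →₀ ℝ≥0 :=
  ∑ Q ∈ J, Finsupp.single Q 1

lemma fracCost_fracOfFinset (H : ℕ → ℝ≥0) (J : Finset (ℕ × ℤ × ℤ)) :
    fracCost H (fracOfFinset J) = ∑ Q ∈ J, (H Q.1 : ℝ) := by
  classical
  induction J using Finset.induction_on with
  | empty => simp [fracOfFinset, fracCost]
  | insert Q J hQ ih =>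
    rw [fracOfFinset, Finset.sum_insert hQ, fracCost_add, ← fracOfFinset, ih, Finset.sum_insert hQ]
    simp [fracCost]

lemma fracVal_fracOfFinset (J : Finset (ℕ × ℤ × ℤ)) (x : ℂ) :
    fracVal (fracOfFinset J) x = ∑ Q ∈ J, (cube Q).indicator (fun _ => (1 : ℝ)) x := by
  classical
  induction J using Finset.induction_on with
  | empty => simp [fracOfFinset, fracVal]
  | insert Q J hQ ih =>
    rw [fracOfFinset, Finset.sum_insert hQ, fracVal_add, ← fracOfFinset, ih, Finset.sum_insert hQ]
    simp [fracVal]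

lemma one_le_fracVal_fracOfFinset {J : Finset (ℕ × ℤ × ℤ)} {x : ℂ} {Q : ℕ × ℤ × ℤ} (hQ : Q ∈ J)
    (hx : x ∈ cube Q) : 1 ≤ fracVal (fracOfFinset J) x := by
  rw [fracVal_fracOfFinset]
  refine le_trans (by simp [hx]) (Finset.single_le_sum (f := fun Q : ℕ × ℤ × ℤ =>
    (cube Q).indicator (fun _ => (1 : ℝ)) x) (fun Q _ => indicator_nonneg (by simp) x) hQ)

lemma fracVal_nonneg (c : (ℕ × ℤ × ℤ) →₀ ℝ≥0) (x : ℂ) : 0 ≤ fracVal c x :=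
  Finset.sum_nonneg fun _ _ => indicator_nonneg (by simp) x

/-- The costs of the fractional families that majorize the function `f` on `K`. -/
def fracCosts (H : ℕ → ℝ≥0) {K : Set ℂ} (f : K → ℝ) : Set ℝ :=
  {r | ∃ c, (∀ x : K, f x ≤ fracVal c x) ∧ fracCost H c = r}

lemma bddBelow_fracCosts (H : ℕ → ℝ≥0) {K : Set ℂ} (f : K → ℝ) : BddBelow (fracCosts H f) :=
  ⟨0, by rintro r ⟨c, _, rfl⟩; exact fracCost_nonneg H c⟩

/-- The sublinear functional whose value at `f` is the least cost of a fractional family that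
majorizes `f` on `K`. -/
noncomputable def fracContent (H : ℕ → ℝ≥0) {K : Set ℂ} (f : K → ℝ) : ℝ := sInf (fracCosts H f)

lemma fracContent_le {H : ℕ → ℝ≥0} {K : Set ℂ} {f : K → ℝ} {c : (ℕ × ℤ × ℤ) →₀ ℝ≥0}
    (h : ∀ x : K, f x ≤ fracVal c x) : fracContent H f ≤ fracCost H c :=
  csInf_le (bddBelow_fracCosts H f) ⟨c, h, rfl⟩

lemma fracContent_nonneg (H : ℕ → ℝ≥0) {K : Set ℂ} (f : K → ℝ) : 0 ≤ fracContent H f :=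
  Real.sInf_nonneg (by rintro r ⟨c, _, rfl⟩; exact fracCost_nonneg H c)

lemma exists_finset_cover {K : Set ℂ} (hK : IsCompact K) :
    ∃ J : Finset (ℕ × ℤ × ℤ), ∀ x ∈ K, ∃ Q ∈ J, x ∈ cube Q := by
  obtain ⟨s, _, hcov⟩ := hK.elim_nhds_subcover (fun x => thick (0, cell 0 x)) fun x _ =>
    (isOpen_thick _).mem_nhds (cube_subset_thick _ (mem_cube_cell 0 x))
  classical
  refine ⟨s.biUnion fun x => nbrs (0, cell 0 x), fun x hx => ?_⟩
  obtain ⟨y, hy, hxy⟩ := mem_iUnion₂.1 (hcov hx)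
  obtain ⟨R, hR, hxR⟩ := exists_nbrs_of_mem_thick hxy
  exact ⟨R, Finset.mem_biUnion.2 ⟨y, hy, hR⟩, hxR⟩

lemma fracCosts_nonempty (H : ℕ → ℝ≥0) {K : Set ℂ} (hK : IsCompact K) {f : K → ℝ}
    (hf : ∃ B : ℝ, ∀ x, f x ≤ B) : (fracCosts H f).Nonempty := by
  obtain ⟨J, hJ⟩ := exists_finset_cover hK
  obtain ⟨B, hB⟩ := hf
  refine ⟨_, B.toNNReal • fracOfFinset J, fun x => ?_, rfl⟩
  obtain ⟨Q, hQ, hxQ⟩ := hJ x x.2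
  rw [fracVal_smul]
  calc f x ≤ B.toNNReal := (hB x).trans (Real.le_coe_toNNReal B)
    _ ≤ B.toNNReal * fracVal (fracOfFinset J) x :=
      le_mul_of_one_le_right (by positivity) (one_le_fracVal_fracOfFinset hQ hxQ)

lemma fracContent_add_le (H : ℕ → ℝ≥0) {K : Set ℂ} (hK : IsCompact K) {f g : K → ℝ}
    (hf : ∃ B : ℝ, ∀ x, f x ≤ B) (hg : ∃ B : ℝ, ∀ x, g x ≤ B) :
    fracContent H (fun x => f x + g x) ≤ fracContent H f + fracContent H g := by
  refine le_of_forall_pos_le_add fun ε hε => ?_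
  obtain ⟨_, ⟨c, hc, rfl⟩, hc'⟩ :=
    exists_lt_of_csInf_lt (fracCosts_nonempty H hK hf) (lt_add_of_pos_right _ (half_pos hε))
  obtain ⟨_, ⟨d, hd, rfl⟩, hd'⟩ :=
    exists_lt_of_csInf_lt (fracCosts_nonempty H hK hg) (lt_add_of_pos_right _ (half_pos hε))
  have := fracContent_le (H := H) (f := fun x => f x + g x) (c := c + d) fun x => by
    rw [fracVal_add]; exact add_le_add (hc x) (hd x)
  rw [fracCost_add] at this
  simp only [fracContent] at *
  linarith

lemma fracContent_smul_le (H : ℕ → ℝ≥0) {K : Set ℂ} (hK : IsCompact K) {f : K → ℝ}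
    (hf : ∃ B : ℝ, ∀ x, f x ≤ B) {s : ℝ} (hs : 0 < s) :
    fracContent H (fun x => s * f x) ≤ s * fracContent H f := by
  refine le_of_forall_pos_le_add fun ε hε => ?_
  obtain ⟨_, ⟨c, hc, rfl⟩, hc'⟩ :=
    exists_lt_of_csInf_lt (fracCosts_nonempty H hK hf)
      (lt_add_of_pos_right (sInf (fracCosts H f)) (div_pos hε hs))
  have := fracContent_le (H := H) (f := fun x => s * f x) (c := s.toNNReal • c) fun x => by
    rw [fracVal_smul, Real.coe_toNNReal s hs.le]
    exact mul_le_mul_of_nonneg_left (hc x) hs.le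
  rw [fracCost_smul, Real.coe_toNNReal s hs.le] at this
  refine this.trans ?_
  have h2 := mul_le_mul_of_nonneg_left hc'.le hs.le
  rw [mul_add, mul_div_cancel₀ _ hs.ne'] at h2
  exact h2

lemma fracContent_smul (H : ℕ → ℝ≥0) {K : Set ℂ} (hK : IsCompact K) {f : K → ℝ}
    (hf : ∃ B : ℝ, ∀ x, f x ≤ B) {s : ℝ} (hs : 0 < s) :
    fracContent H (fun x => s * f x) = s * fracContent H f := by
  refine le_antisymm (fracContent_smul_le H hK hf hs) ?_
  obtain ⟨B, hB⟩ := hf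
  have := fracContent_smul_le H hK (f := fun x => s * f x)
    ⟨s * B, fun x => mul_le_mul_of_nonneg_left (hB x) hs.le⟩ (inv_pos.2 hs)
  simp only [inv_mul_cancel_left₀ hs.ne'] at this
  calc s * fracContent H f ≤ s * (s⁻¹ * fracContent H fun x => s * f x) :=
        mul_le_mul_of_nonneg_left this hs.le
    _ = _ := mul_inv_cancel_left₀ hs.ne' _

lemma dyContent_le_fracContent_one (H : ℕ → ℝ≥0) {K : Set ℂ} (hK : IsCompact K) :
    dyContent (fun k => H k) K ≤ ENNReal.ofReal (fracContent H fun _ : K => 1) := by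
  have hle : ∀ r ∈ fracCosts H (fun _ : K => (1 : ℝ)),
      dyContent (fun k => H k) K ≤ ENNReal.ofReal r := by
    rintro r ⟨c, hc, rfl⟩
    refine (dyContent_le_of_fractional_cover c.support (fun Q => c Q)
      fun x hx => hc ⟨x, hx⟩).trans (le_of_eq ?_)
    rw [fracCost, Finsupp.sum, ENNReal.ofReal_sum_of_nonneg fun Q _ => by positivity]
    refine Finset.sum_congr rfl fun Q _ => ?_
    rw [ENNReal.ofReal_mul (by positivity), ENNReal.ofReal_coe_nnreal, ENNReal.ofReal_coe_nnreal]
  have hne := fracCosts_nonempty H hK (f := fun _ => 1) ⟨1, fun _ => le_rfl⟩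
  have htop : dyContent (fun k => (H k : ℝ≥0∞)) K ≠ ⊤ := by
    obtain ⟨r, hr⟩ := hne
    exact ne_top_of_le_ne_top ENNReal.ofReal_ne_top (hle r hr)
  rw [← ENNReal.ofReal_toReal htop]
  refine ENNReal.ofReal_le_ofReal (le_csInf hne fun r hr => ?_)
  refine ENNReal.toReal_le_of_le_ofReal ?_ (hle r hr)
  obtain ⟨c, _, rfl⟩ := hr
  exact fracCost_nonneg H c

lemma fracCost_nbrs_le (H : ℕ → ℝ≥0) (Q : ℕ × ℤ × ℤ) :
    fracCost H (fracOfFinset (nbrs Q)) ≤ 9 * H Q.1 := by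
  rw [fracCost_fracOfFinset, Finset.sum_congr rfl fun R hR => by rw [fst_of_mem_nbrs hR],
    Finset.sum_const, nsmul_eq_mul]
  gcongr
  exact_mod_cast card_nbrs_le Q

lemma mem_thick_cell {k : ℕ} {x z : ℂ} (h : dist x z < (2 ^ k)⁻¹) : x ∈ thick (k, cell k z) := by
  obtain ⟨⟨a1, a2⟩, a3, a4⟩ := mem_cube_iff.1 (mem_cube_cell k z)
  have h2k : (0 : ℝ) < 2 ^ k := by positivity
  have hlt : dist x z * 2 ^ k < 1 := by
    have := mul_lt_mul_of_pos_right h h2k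
    rwa [inv_mul_cancel₀ h2k.ne'] at this
  rw [dist_eq_norm] at hlt
  have e1 : |(x.re - z.re) * 2 ^ k| < 1 := by
    rw [abs_mul, abs_of_pos h2k]
    refine lt_of_le_of_lt ?_ hlt
    gcongr
    simpa using Complex.abs_re_le_norm (x - z)
  have e2 : |(x.im - z.im) * 2 ^ k| < 1 := by
    rw [abs_mul, abs_of_pos h2k]
    refine lt_of_le_of_lt ?_ hlt
    gcongr
    simpa using Complex.abs_im_le_norm (x - z)
  rw [abs_lt, sub_mul] at e1 e2
  refine ⟨⟨?_, ?_⟩, ?_, ?_⟩ <;> simp only at * <;> linarith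

open scoped CompactlySupported in
/-- **Frostman's lemma** for compact sets and dyadic contents. The functional comes from the
Hahn–Banach theorem, applied to the sublinear functional `fracContent`, and is represented by a
measure by the Riesz–Markov–Kakutani theorem. -/
theorem exists_frostman_measure_of_isCompact (H : ℕ → ℝ≥0) {K : Set ℂ} (hK : IsCompact K) :
    ∃ μ : Measure ℂ, IsFiniteMeasure μ ∧ μ Kᶜ = 0 ∧ dyContent (fun k => H k) K ≤ μ univ ∧
      ∀ (z : ℂ) (k : ℕ) (r : ℝ), 0 < r → 2 * r ≤ (2 ^ k)⁻¹ →
        μ (Metric.closedBall z r) ≤ 9 * H k := by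
  have : CompactSpace K := isCompact_iff_compactSpace.1 hK
  have hbdd : ∀ f : C_c(K, ℝ), ∃ B : ℝ, ∀ x, f x ≤ B := by
    intro f
    obtain ⟨B, hB⟩ := (isCompact_range f.continuous).bddAbove
    exact ⟨B, fun x => hB (mem_range_self x)⟩
  let N : C_c(K, ℝ) → ℝ := fun f => fracContent H f
  let one : C_c(K, ℝ) := ⟨⟨fun _ => 1, continuous_const⟩, HasCompactSupport.of_compactSpace _⟩
  have hN1 : N one = fracContent H fun _ : K => 1 := rfl
  -- If `K` is empty, then `one = 0`, and the functional is zero anyway.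
  obtain ⟨Λ, hΛ1, hΛ⟩ : ∃ Λ : C_c(K, ℝ) →ₗ[ℝ] ℝ, N one ≤ Λ one ∧ ∀ f, Λ f ≤ N f := by
    rcases isEmpty_or_nonempty K with hemp | hne
    · refine ⟨0, le_of_eq_of_le ?_ le_rfl, fun f => fracContent_nonneg H _⟩
      refine le_antisymm ?_ (fracContent_nonneg H _)
      refine (fracContent_le (c := 0) fun x => (hemp.false x).elim).trans ?_
      simp [fracCost]
    have hone : one ≠ 0 := by
      intro h
      have := DFunLike.congr_fun h hne.some
      exact one_ne_zero this
    obtain ⟨Λ, h1, h2⟩ := exists_extension_of_le_sublinear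
      (LinearPMap.mkSpanSingleton one (N one) hone) N
      (fun s hs f => by
        exact fracContent_smul H hK (hbdd f) hs)
      (fun f g => by
        exact fracContent_add_le H hK (hbdd f) (hbdd g))
      (by
        rintro ⟨x, hx⟩
        obtain ⟨s, rfl⟩ := Submodule.mem_span_singleton.1 hx
        rw [LinearPMap.mkSpanSingleton'_apply]
        rcases le_or_gt s 0 with hs | hs
        · exact (mul_nonpos_of_nonpos_of_nonneg hs (fracContent_nonneg H _)).trans
            (fracContent_nonneg H _)
        · exact (fracContent_smul H hK (hbdd one) hs).symm.le)
    refine ⟨Λ, ?_, h2⟩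
    have := h1 ⟨one, Submodule.mem_span_singleton_self one⟩
    simp only [LinearPMap.mkSpanSingleton_apply] at this
    exact this.symm.le
  have hpos : ∀ f : C_c(K, ℝ), 0 ≤ f → 0 ≤ Λ f := by
    intro f hf
    have h1 : N (-f) ≤ 0 := by
      refine (fracContent_le (c := 0) fun x => ?_).trans (by simp [fracCost])
      have : 0 ≤ f x := hf x
      simpa [fracVal] using this
    have := (hΛ (-f)).trans h1
    rw [map_neg] at this
    linarith
  let Λ' : C_c(K, ℝ) →ₚ[ℝ] ℝ := PositiveLinearMap.mk₀ Λ hpos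
  let ν := RealRMK.rieszMeasure Λ'
  have hΛ' : ∀ f, Λ' f = Λ f := fun f => rfl
  have hfin : ν univ ≤ ENNReal.ofReal (Λ' one) :=
    RealRMK.rieszMeasure_le_of_eq_one Λ' (fun _ => zero_le_one) isCompact_univ fun _ _ => rfl
  have : IsFiniteMeasure ν := ⟨hfin.trans_lt ENNReal.ofReal_lt_top⟩
  have hval : Measurable (Subtype.val : K → ℂ) := measurable_subtype_coe
  refine ⟨ν.map Subtype.val, inferInstance, ?_, ?_, ?_⟩
  · rw [Measure.map_apply hval hK.measurableSet.compl]
    simp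
  · rw [Measure.map_apply hval MeasurableSet.univ, preimage_univ]
    refine (dyContent_le_fracContent_one H hK).trans
      ((ENNReal.ofReal_le_ofReal hΛ1).trans ?_)
    exact RealRMK.le_rieszMeasure_tsupport_subset Λ' (fun _ => ⟨zero_le_one, le_rfl⟩)
      (subset_univ _)
  · intro z k r hr hrk
    rw [Measure.map_apply hval Metric.isClosed_closedBall.measurableSet]
    let f : C_c(K, ℝ) := ⟨⟨fun x => max 0 (min 1 (2 - dist (x : ℂ) z / r)), by fun_prop⟩,
      HasCompactSupport.of_compactSpace _⟩
    have hfx : ∀ x : K, f x = max 0 (min 1 (2 - dist (x : ℂ) z / r)) := fun _ => rfl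
    have h1 : ν (Subtype.val ⁻¹' Metric.closedBall z r) ≤ ENNReal.ofReal (Λ' f) := by
      refine RealRMK.rieszMeasure_le_of_eq_one Λ' (fun x => ?_) ?_ ?_
      · rw [hfx]; exact le_max_left _ _
      · exact (Metric.isClosed_closedBall.preimage continuous_subtype_val).isCompact
      · intro x hx
        rw [hfx]
        have : dist (x : ℂ) z / r ≤ 1 := (div_le_one hr).2 (Metric.mem_closedBall.1 hx)
        rw [min_eq_left (by linarith), max_eq_right zero_le_one]
    have h2 : Λ' f ≤ fracCost H (fracOfFinset (nbrs (k, cell k z))) := by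
      refine (hΛ f).trans (fracContent_le fun x => ?_)
      rw [hfx]
      by_cases hx : dist (x : ℂ) z < 2 * r
      ·
        have hthick := mem_thick_cell (k := k) (hx.trans_le hrk)
        obtain ⟨R, hR, hxR⟩ := exists_nbrs_of_mem_thick hthick
        refine le_trans ?_ (one_le_fracVal_fracOfFinset hR hxR)
        exact max_le zero_le_one (min_le_left _ _)
      · refine le_trans (le_of_eq ?_) (fracVal_nonneg _ _)
        have : 2 ≤ dist (x : ℂ) z / r := (le_div_iff₀ hr).2 (not_lt.1 hx)
        exact max_eq_left ((min_le_right _ _).trans (by linarith))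
    refine h1.trans ((ENNReal.ofReal_le_ofReal h2).trans ?_)
    rw [← ENNReal.ofReal_coe_nnreal, ← ENNReal.ofReal_ofNat 9, ← ENNReal.ofReal_mul (by norm_num)]
    exact ENNReal.ofReal_le_ofReal (fracCost_nbrs_le H _)

lemma hContent_le_dyContent {h : ℝ≥0 → ℝ≥0} (hh : ∀ t, h t ≤ t) (E : Set ℂ) :
    hContent h E ≤ dyContent (fun k => h (2 ^ k)⁻¹) E := by
  classical
  refine le_iInf₂ fun V hV => ENNReal.le_of_forall_pos_le_add fun ε hε _ => ?_
  obtain ⟨δ, hδ, hδs⟩ := ENNReal.exists_pos_sum_of_countable (ε := (ε : ℝ≥0∞))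
    (by simpa using hε.ne') (ℕ × ℤ × ℤ)
  let e : ℕ ≃ ℕ × ℤ × ℤ := (Denumerable.eqv (ℕ × ℤ × ℤ)).symm
  -- Squares outside the family `V` are replaced by squares of negligible size.
  let s : ℕ × ℤ × ℤ → ℝ≥0 := fun Q => if Q ∈ V then (2 ^ Q.1)⁻¹ else δ Q
  have hs : ∀ Q, 0 < s Q := by
    intro Q
    by_cases hQ : Q ∈ V
    · simp only [s, hQ, if_true]; positivity
    · simpa only [s, hQ, if_false] using hδ Q
  refine (iInf₂_le (fun j => corner (e j)) (fun j => s (e j))).trans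
    ((iInf₂_le (fun j => hs (e j)) fun z hz => ?_).trans ?_)
  · obtain ⟨Q, hQ, hzQ⟩ := mem_cover.1 (hV hz)
    refine mem_iUnion.2 ⟨e.symm Q, ?_⟩
    simp only [Equiv.apply_symm_apply, s, hQ, if_true]
    have := cube_subset_square Q hzQ
    simpa [side] using this
  · rw [e.tsum_eq (fun Q => (h (s Q) : ℝ≥0∞)), cost, tsum_subtype V (fun Q : ℕ × ℤ × ℤ =>
      (h (2 ^ Q.1)⁻¹ : ℝ≥0∞))]
    calc ∑' Q, (h (s Q) : ℝ≥0∞)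
        ≤ ∑' Q, (V.indicator (fun Q : ℕ × ℤ × ℤ => (h (2 ^ Q.1)⁻¹ : ℝ≥0∞)) Q + δ Q) := by
          refine ENNReal.tsum_le_tsum fun Q => ?_
          by_cases hQ : Q ∈ V
          · simp [s, hQ]
          · simpa [s, hQ] using hh (δ Q)
      _ = _ := ENNReal.tsum_add
      _ ≤ _ := by gcongr

/-- **Frostman's lemma** for the lower content of Borel sets: the lower content is carried, up to a
constant, by measures on compact subsets whose mass on discs of radius `r` is `O(r)` with a universal
constant, and `o(r)` uniformly as `r → 0`. -/
theorem exists_frostman_measure {E : Set ℂ} (hE : MeasurableSet E) {x₀ : ℂ}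
    (hEb : E ⊆ Metric.closedBall x₀ (1 / 2)) {a : ℝ≥0∞} (ha : a < lowerContent E) :
    ∃ K ⊆ E, IsCompact K ∧ ∃ μ : Measure ℂ, IsFiniteMeasure μ ∧ μ Kᶜ = 0 ∧ a ≤ 9 * μ univ ∧
      (∀ (z : ℂ) (r : ℝ), 0 < r → μ (Metric.closedBall z r) ≤ ENNReal.ofReal (36 * r)) ∧
      ∀ ε : ℝ, 0 < ε → ∃ ρ : ℝ, 0 < ρ ∧ ∀ (z : ℂ) (r : ℝ), 0 < r → r < ρ →
        μ (Metric.closedBall z r) ≤ ENNReal.ofReal (ε * r) := by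
  simp only [lowerContent, lt_iSup_iff] at ha
  obtain ⟨h, hm, hle, hlim, ha⟩ := ha
  obtain ⟨K, hKE, hK, haK⟩ := exists_isCompact_dyContent_le hE
    (ha.trans_le (hContent_le_dyContent hle E))
  obtain ⟨μ, hfin, hμK, hμ, hgrow⟩ :=
    exists_frostman_measure_of_isCompact (fun k => h (2 ^ k)⁻¹) hK
  have hlevel : ∀ r : ℝ, 0 < r → r ≤ 1 / 2 → ∃ k : ℕ, 2 * r ≤ (2 ^ k)⁻¹ ∧
      ((2 : ℝ) ^ k)⁻¹ < 4 * r := by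
    intro r hr hr2
    obtain ⟨k, hk1, hk2⟩ := exists_nat_pow_near_of_lt_one (x := 2 * r) (y := 1 / 2) (by linarith)
      (by linarith) (by norm_num) (by norm_num)
    refine ⟨k, by simpa using hk2, ?_⟩
    rw [pow_succ] at hk1
    simp only [one_div, inv_pow] at hk1
    linarith
  have hbound : ∀ (z : ℂ) (r η : ℝ), 0 < r → r ≤ 1 / 2 → 0 ≤ η →
      (∀ t : ℝ≥0, 0 < t → (t : ℝ) < 4 * r → (h t : ℝ) ≤ η * t) →
      μ (Metric.closedBall z r) ≤ ENNReal.ofReal (36 * η * r) := by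
    intro z r η hr hr2 hη hηt
    obtain ⟨k, hk1, hk2⟩ := hlevel r hr hr2
    refine (hgrow z k r hr hk1).trans ?_
    have h1 := hηt (2 ^ k)⁻¹ (by positivity) (by push_cast; exact hk2)
    rw [← ENNReal.ofReal_coe_nnreal, ← ENNReal.ofReal_ofNat 9, ← ENNReal.ofReal_mul (by norm_num)]
    refine ENNReal.ofReal_le_ofReal ?_
    push_cast at h1
    nlinarith [mul_le_mul_of_nonneg_left hk2.le hη]
  have hsmall : ∀ (z : ℂ) (r : ℝ), 0 < r → r ≤ 1 / 2 →
      μ (Metric.closedBall z r) ≤ ENNReal.ofReal (36 * r) := by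
    intro z r hr hr2
    have := hbound z r 1 hr hr2 zero_le_one fun t _ _ => by
      rw [one_mul]; exact_mod_cast hle t
    rwa [mul_one] at this
  refine ⟨K, hKE, hK, μ, hfin, hμK, haK.trans (by gcongr), ?_, ?_⟩
  · intro z r hr
    rcases le_or_gt r (1 / 2) with h2 | h2
    · exact hsmall z r hr h2
    · have huniv : μ univ ≤ μ (Metric.closedBall x₀ (1 / 2)) := by
        rw [← measure_add_measure_compl hK.measurableSet, hμK, add_zero]
        exact measure_mono (hKE.trans hEb)
      refine (measure_mono (subset_univ _)).trans (huniv.trans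
        ((hsmall x₀ (1 / 2) (by norm_num) le_rfl).trans (ENNReal.ofReal_le_ofReal ?_)))
      linarith
  · intro ε hε
    have hev : ∀ᶠ t in 𝓝[>] (0 : ℝ≥0), h t / t < (ε / 36).toNNReal :=
      hlim.eventually (gt_mem_nhds (Real.toNNReal_pos.2 (by positivity)))
    obtain ⟨ρ, hρ, hρt⟩ := mem_nhdsGT_iff_exists_Ioo_subset.1 hev
    have hρ0 : (0 : ℝ≥0) < ρ := hρ
    refine ⟨min (1 / 2) (ρ / 4), by positivity, fun z r hr hrρ => ?_⟩
    have h1 := hrρ.le.trans (min_le_left _ _)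
    have h2 := hrρ.trans_le (min_le_right _ _)
    have := hbound z r (ε / 36) hr h1 (by positivity) fun t ht htr => by
      have h3 : h t / t < (ε / 36).toNNReal := hρt ⟨ht, by
        rw [← NNReal.coe_lt_coe]; linarith⟩
      rw [← NNReal.coe_lt_coe, Real.coe_toNNReal _ (by positivity), NNReal.coe_div,
        div_lt_iff₀ (by exact_mod_cast ht)] at h3
      exact h3.le
    rwa [mul_div_cancel₀ ε (by norm_num)] at this

/-! ### Mean oscillations -/

lemma square_eq_reProdIm (a : ℂ) (l : ℝ) :
    square a l = Icc a.re (a.re + l) ×ℂ Icc a.im (a.im + l) := rfl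

lemma measurableSet_square (a : ℂ) (l : ℝ) : MeasurableSet (square a l) := by
  have hr := Complex.measurable_re
  have hi := Complex.measurable_im
  exact (hr measurableSet_Icc).inter (hi measurableSet_Icc)

lemma isCompact_square (a : ℂ) (l : ℝ) : IsCompact (square a l) := by
  rw [square_eq_reProdIm]
  exact isCompact_Icc.reProdIm isCompact_Icc

lemma volume_square (a : ℂ) {l : ℝ} (hl : 0 ≤ l) : volume (square a l) = ENNReal.ofReal (l ^ 2) := by
  have := Complex.volume_preserving_equiv_real_prod.measure_preimage
    (measurableSet_Icc.prod measurableSet_Icc : MeasurableSet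
      (Icc a.re (a.re + l) ×ˢ Icc a.im (a.im + l))).nullMeasurableSet
  rw [show square a l = Complex.measurableEquivRealProd ⁻¹'
    (Icc a.re (a.re + l) ×ˢ Icc a.im (a.im + l)) from rfl, this, Measure.volume_eq_prod,
    Measure.prod_prod, Real.volume_Icc, Real.volume_Icc, add_sub_cancel_left, add_sub_cancel_left,
    ← ENNReal.ofReal_mul hl, sq]

lemma volume_square_ne_zero (a : ℂ) {l : ℝ} (hl : 0 < l) : volume (square a l) ≠ 0 := by
  rw [volume_square a hl.le]
  simpa using by positivity

lemma volume_square_ne_top (a : ℂ) (l : ℝ) : volume (square a l) ≠ ⊤ :=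
  (isCompact_square a l).measure_lt_top.ne

lemma square_subset_closedBall (w : ℂ) {l : ℝ} (hl : 0 ≤ l) :
    square (w - ⟨l / 2, l / 2⟩) l ⊆ Metric.closedBall w l := by
  rintro z ⟨⟨h1, h2⟩, h3, h4⟩
  rw [Metric.mem_closedBall, Complex.dist_eq]
  simp only [Complex.sub_re, Complex.sub_im] at h1 h2 h3 h4
  rw [Complex.norm_def, Real.sqrt_le_left hl, Complex.normSq_apply]
  simp only [Complex.sub_re, Complex.sub_im]
  nlinarith

lemma closedBall_subset_square (w : ℂ) (r : ℝ) :
    Metric.closedBall w r ⊆ square (w - ⟨r, r⟩) (2 * r) := by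
  intro z hz
  rw [Metric.mem_closedBall, Complex.dist_eq] at hz
  have h1 := (Complex.abs_re_le_norm (z - w)).trans hz
  have h2 := (Complex.abs_im_le_norm (z - w)).trans hz
  rw [abs_le] at h1 h2
  simp only [Complex.sub_re, Complex.sub_im] at h1 h2
  refine ⟨⟨?_, ?_⟩, ?_, ?_⟩ <;> simp only [Complex.sub_re, Complex.sub_im] <;> linarith

/-- The mean value is, up to a factor two, the best constant in the definition of the mean
oscillation. -/
lemma meanOsc_le {f : ℂ → ℂ} {Q : Set ℂ} (h0 : volume Q ≠ 0) (htop : volume Q ≠ ⊤)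
    (hf : IntegrableOn f Q) (c : ℂ) :
    meanOsc f Q ≤ 2 * ((volume Q)⁻¹ * ∫⁻ z in Q, ‖f z - c‖ₑ) := by
  have : IsFiniteMeasure (volume.restrict Q) := ⟨by simpa using htop.lt_top⟩
  have h1 : ‖c - ⨍ w in Q, f w‖ₑ ≤ (volume Q)⁻¹ * ∫⁻ z in Q, ‖f z - c‖ₑ := by
    have hne : NeZero (volume.restrict Q) := ⟨by simpa [Measure.restrict_eq_zero] using h0⟩
    have h2 : c - ⨍ w in Q, f w = -⨍ w in Q, (f w - c) := by
      have hd : ⨍ w in Q, (f w - c) = (⨍ w in Q, f w) - ⨍ _ in Q, c := by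
        simp only [setAverage_eq]
        rw [integral_sub hf (integrable_const c), smul_sub]
      rw [hd, setAverage_const h0 htop]
      ring
    rw [h2, enorm_neg, setAverage_eq, enorm_smul]
    gcongr
    · rw [Real.enorm_eq_ofReal (by positivity), measureReal_def,
        ENNReal.ofReal_inv_of_pos (ENNReal.toReal_pos h0 htop), ENNReal.ofReal_toReal htop]
    · exact enorm_integral_le_lintegral_enorm _
  calc meanOsc f Q ≤ (volume Q)⁻¹ * ∫⁻ z in Q, (‖f z - c‖ₑ + ‖c - ⨍ w in Q, f w‖ₑ) := by
        unfold meanOsc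
        gcongr with z
        refine le_trans (le_of_eq ?_) (enorm_add_le _ _)
        congr 1
        ring
    _ = (volume Q)⁻¹ * (∫⁻ z in Q, ‖f z - c‖ₑ) + ‖c - ⨍ w in Q, f w‖ₑ := by
        rw [lintegral_add_right _ measurable_const, mul_add, setLIntegral_const,
          mul_comm _ (volume Q), ENNReal.inv_mul_cancel_left h0 htop]
    _ ≤ _ := by rw [two_mul]; gcongr

lemma meanOsc_le_bmoSeminorm (f : ℂ → ℂ) (a : ℂ) {l : ℝ} (hl : 0 < l) :
    meanOsc f (square a l) ≤ bmoSeminorm f :=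
  le_iSup_of_le a (le_iSup_of_le l (le_iSup_of_le hl le_rfl))

lemma meanOsc_le_oscModulus (f : ℂ → ℂ) (a : ℂ) {l δ : ℝ} (hl : 0 < l) (hδ : l ≤ δ) :
    meanOsc f (square a l) ≤ oscModulus f δ :=
  le_iSup_of_le a (le_iSup_of_le l (le_iSup_of_le hl (le_iSup_of_le hδ le_rfl)))

/-- The mean oscillation in its multiplied form: the integral of `|f - f_Q|`. -/
lemma lintegral_sub_average_eq (f : ℂ → ℂ) (a : ℂ) {l : ℝ} (hl : 0 < l) :
    ∫⁻ z in square a l, ‖f z - ⨍ w in square a l, f w‖ₑ =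
      ENNReal.ofReal (l ^ 2) * meanOsc f (square a l) := by
  rw [meanOsc, ← volume_square a hl.le,
    ENNReal.mul_inv_cancel_left (volume_square_ne_zero a hl) (volume_square_ne_top a l)]

lemma integrableOn_square {f : ℂ → ℂ} (hf : LocallyIntegrable f volume) (a : ℂ) (l : ℝ) :
    IntegrableOn f (square a l) :=
  hf.integrableOn_isCompact (isCompact_square a l)

lemma meanOsc_sub_le {f g : ℂ → ℂ} (hf : LocallyIntegrable f volume)
    (hg : LocallyIntegrable g volume) (a : ℂ) (l : ℝ) :
    meanOsc (fun z => f z - g z) (square a l) ≤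
      meanOsc f (square a l) + meanOsc g (square a l) := by
  have hf' := integrableOn_square hf a l
  have hg' := integrableOn_square hg a l
  unfold meanOsc
  have hm : AEMeasurable (fun z => ‖f z - ⨍ w in square a l, f w‖ₑ)
      (volume.restrict (square a l)) :=
    (hf'.aestronglyMeasurable.sub aestronglyMeasurable_const).enorm
  rw [← mul_add, ← lintegral_add_left' hm]
  gcongr with z
  have : ⨍ w in square a l, (f w - g w) = (⨍ w in square a l, f w) - ⨍ w in square a l, g w := by
    simp only [setAverage_eq]
    rw [integral_sub hf' hg', smul_sub]
  rw [this]
  refine le_trans (le_of_eq ?_) (enorm_sub_le)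
  congr 1
  ring

/-! ### The Cauchy kernel -/

lemma lintegral_closedBall_inv_le (w : ℂ) {r : ℝ} (hr : 0 ≤ r) :
    ∫⁻ z in Metric.closedBall w r, ‖(w - z)⁻¹‖ₑ ≤ ENNReal.ofReal (2 * Real.pi * r) := by
  have h0 : ∫⁻ z in Metric.closedBall w r, ‖(w - z)⁻¹‖ₑ =
      ∫⁻ z, (Metric.closedBall (0 : ℂ) r).indicator (fun z => ‖z⁻¹‖ₑ) z := by
    rw [← lintegral_indicator Metric.isClosed_closedBall.measurableSet, ← lintegral_sub_left_eq_self
      (fun z => (Metric.closedBall w r).indicator (fun z => ‖(w - z)⁻¹‖ₑ) z) w]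
    refine lintegral_congr fun z => ?_
    have hiff : w - z ∈ Metric.closedBall w r ↔ z ∈ Metric.closedBall (0 : ℂ) r := by
      rw [Metric.mem_closedBall, Metric.mem_closedBall, dist_zero_right, dist_eq_norm,
        show w - z - w = -z by ring, norm_neg]
    change (Metric.closedBall w r).indicator (fun z => ‖(w - z)⁻¹‖ₑ) (w - z) = _
    by_cases hz : z ∈ Metric.closedBall (0 : ℂ) r
    · rw [indicator_of_mem hz, indicator_of_mem (hiff.2 hz), sub_sub_cancel]
    · rw [indicator_of_notMem hz, indicator_of_notMem fun h => hz (hiff.1 h)]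
  rw [h0, ← Complex.lintegral_comp_polarCoord_symm]
  have hle : ∀ p ∈ polarCoord.target, ENNReal.ofReal p.1 •
      (Metric.closedBall (0 : ℂ) r).indicator (fun z => ‖z⁻¹‖ₑ) (Complex.polarCoord.symm p) ≤
      (Ioc 0 r ×ˢ Ioo (-Real.pi) Real.pi).indicator 1 p := by
    rintro ⟨ρ, θ⟩ ⟨hρ, hθ⟩
    have hρ' : 0 < ρ := hρ
    have hn : ‖Complex.polarCoord.symm (ρ, θ)‖ = ρ := by
      rw [Complex.norm_polarCoord_symm, abs_of_pos hρ']
    by_cases hr' : ρ ≤ r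
    · have hin : (ρ, θ) ∈ Ioc 0 r ×ˢ Ioo (-Real.pi) Real.pi := ⟨⟨hρ', hr'⟩, hθ⟩
      rw [indicator_of_mem (by rwa [Metric.mem_closedBall, dist_zero_right, hn]),
        indicator_of_mem hin, Pi.one_apply, ← ofReal_norm, norm_inv, hn, smul_eq_mul, ← ENNReal.ofReal_mul hρ'.le,
        mul_inv_cancel₀ hρ'.ne', ENNReal.ofReal_one]
    · rw [indicator_of_notMem (by rwa [Metric.mem_closedBall, dist_zero_right, hn]), smul_zero]
      exact zero_le
  have hm : MeasurableSet (Ioc 0 r ×ˢ Ioo (-Real.pi) Real.pi) :=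
    measurableSet_Ioc.prod measurableSet_Ioo
  refine (setLIntegral_mono' polarCoord.open_target.measurableSet hle).trans
    ((setLIntegral_le_lintegral _ _).trans ?_)
  rw [lintegral_indicator_one hm, Measure.volume_eq_prod, Measure.prod_prod, Real.volume_Ioc,
    Real.volume_Ioo, ← ENNReal.ofReal_mul (by linarith)]
  exact ENNReal.ofReal_le_ofReal (by linarith)

lemma measurable_enorm_cauchyKernel :
    Measurable fun p : ℂ × ℂ => ‖(p.2 - p.1)⁻¹‖ₑ :=
  ((measurable_snd.sub measurable_fst).inv).enorm

/-- The potential `∫ |ζ - z|⁻¹ dμ(ζ)` of the part of `μ` in a disc has a small integral over that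
disc. -/
lemma lintegral_lintegral_inv_le (μ : Measure ℂ) [SFinite μ] (w : ℂ) {r : ℝ} (hr : 0 ≤ r) :
    ∫⁻ z in Metric.closedBall w r, ∫⁻ ζ in Metric.closedBall w r, ‖(ζ - z)⁻¹‖ₑ ∂μ ≤
      ENNReal.ofReal (4 * Real.pi * r) * μ (Metric.closedBall w r) := by
  rw [lintegral_lintegral_swap measurable_enorm_cauchyKernel.aemeasurable, ← setLIntegral_const]
  refine setLIntegral_mono' Metric.isClosed_closedBall.measurableSet fun ζ hζ => ?_
  refine (lintegral_mono_set (t := Metric.closedBall ζ (2 * r)) fun z hz => ?_).trans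
    ((lintegral_closedBall_inv_le ζ (by linarith)).trans (le_of_eq (by ring_nf)))
  rw [Metric.mem_closedBall] at *
  linarith [dist_triangle_right z ζ w]

/-- A measure with linear growth at `w` has a small second negative moment away from `w`. -/
lemma lintegral_compl_closedBall_le (μ : Measure ℂ) (w : ℂ) {ε R ρ : ℝ} (hR : 0 < R) (hε : 0 ≤ ε)
    (hρ : 0 < ρ)
    (hμ : ∀ r, 0 < r → r ≤ ρ → μ (Metric.closedBall w r) ≤ ENNReal.ofReal (ε * r)) :
    ∫⁻ ζ in (Metric.closedBall w R)ᶜ, ENNReal.ofReal ((‖ζ - w‖ ^ 2)⁻¹) ∂μ ≤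
      ENNReal.ofReal (4 * ε / R) + ENNReal.ofReal ((ρ ^ 2)⁻¹) * μ univ := by
  let A : ℕ → Set ℂ := fun k => {ζ | 2 ^ k * R ≤ ‖ζ - w‖ ∧ ‖ζ - w‖ ≤ 2 ^ (k + 1) * R ∧ ‖ζ - w‖ ≤ ρ}
  have hA : ∀ k, MeasurableSet (A k) := by
    intro k
    have hc : Measurable fun ζ : ℂ => ‖ζ - w‖ := (measurable_id.sub_const w).norm
    exact (measurableSet_le measurable_const hc).inter
      ((measurableSet_le hc measurable_const).inter (measurableSet_le hc measurable_const))
  have hcov : (Metric.closedBall w R)ᶜ ⊆ (⋃ k, A k) ∪ (Metric.closedBall w ρ)ᶜ := by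
    intro ζ hζ
    rw [mem_compl_iff, Metric.mem_closedBall, dist_eq_norm, not_le] at hζ
    by_cases h : ‖ζ - w‖ ≤ ρ
    · left
      obtain ⟨k, hk1, hk2⟩ := exists_nat_pow_near (x := ‖ζ - w‖ / R) (y := 2)
        ((one_lt_div hR).2 hζ).le (by norm_num)
      exact mem_iUnion.2 ⟨k, (le_div_iff₀ hR).1 hk1, (div_le_iff₀ hR).1 hk2.le, h⟩
    · right
      simpa [dist_eq_norm] using h
  have hshell : ∀ k, ∫⁻ ζ in A k, ENNReal.ofReal ((‖ζ - w‖ ^ 2)⁻¹) ∂μ ≤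
      ENNReal.ofReal (2 * ε / R * (1 / 2) ^ k) := by
    intro k
    have hpos : 0 < 2 ^ k * R := by positivity
    calc ∫⁻ ζ in A k, ENNReal.ofReal ((‖ζ - w‖ ^ 2)⁻¹) ∂μ
        ≤ ∫⁻ ζ in A k, ENNReal.ofReal (((2 ^ k * R) ^ 2)⁻¹) ∂μ := by
          refine setLIntegral_mono' (hA k) fun ζ hζ => ENNReal.ofReal_le_ofReal ?_
          gcongr
          exact hζ.1
      _ = ENNReal.ofReal (((2 ^ k * R) ^ 2)⁻¹) * μ (A k) := setLIntegral_const _ _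
      _ ≤ ENNReal.ofReal (((2 ^ k * R) ^ 2)⁻¹) * ENNReal.ofReal (ε * (2 ^ (k + 1) * R)) := by
          gcongr
          refine (measure_mono (t := Metric.closedBall w (min (2 ^ (k + 1) * R) ρ)) ?_).trans
            ((hμ _ (by positivity) (min_le_right _ _)).trans (ENNReal.ofReal_le_ofReal ?_))
          · intro ζ hζ
            rw [Metric.mem_closedBall, dist_eq_norm]
            exact le_min hζ.2.1 hζ.2.2
          · gcongr
            exact min_le_left _ _
      _ = _ := by
          rw [← ENNReal.ofReal_mul (by positivity)]
          congr 1
          rw [one_div, inv_pow]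
          field_simp
          ring
  refine (lintegral_mono_set hcov).trans ((lintegral_union_le _ _ _).trans (add_le_add ?_ ?_))
  · refine (lintegral_iUnion_le _ _).trans ((ENNReal.tsum_le_tsum hshell).trans (le_of_eq ?_))
    rw [← ENNReal.ofReal_tsum_of_nonneg (fun k => by positivity)
      ((summable_geometric_two).mul_left _), tsum_mul_left, tsum_geometric_two]
    congr 1
    ring
  · calc ∫⁻ ζ in (Metric.closedBall w ρ)ᶜ, ENNReal.ofReal ((‖ζ - w‖ ^ 2)⁻¹) ∂μ
        ≤ ∫⁻ ζ in (Metric.closedBall w ρ)ᶜ, ENNReal.ofReal ((ρ ^ 2)⁻¹) ∂μ := by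
          refine setLIntegral_mono' Metric.isClosed_closedBall.measurableSet.compl fun ζ hζ =>
            ENNReal.ofReal_le_ofReal ?_
          rw [mem_compl_iff, Metric.mem_closedBall, dist_eq_norm, not_le] at hζ
          gcongr
      _ = _ := setLIntegral_const _ _
      _ ≤ _ := by gcongr; exact subset_univ _

/-! ### Cauchy transforms of measures of linear growth -/

/-- The Cauchy transform `∫ v(ζ) / (ζ - z) dμ(ζ)` of the complex measure with density `v` with
respect to `μ`. -/
noncomputable def cauchyTransform (μ : Measure ℂ) (v : ℂ → ℂ) (z : ℂ) : ℂ :=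
  ∫ ζ, v ζ * (ζ - z)⁻¹ ∂μ

lemma enorm_mul_le_of_norm_le {v : ℂ → ℂ} {V : ℝ} (hV : ∀ ζ, ‖v ζ‖ ≤ V) (ζ k : ℂ) :
    ‖v ζ * k‖ₑ ≤ ENNReal.ofReal V * ‖k‖ₑ := by
  rw [enorm_mul]
  gcongr
  rw [← ofReal_norm]
  exact ENNReal.ofReal_le_ofReal (hV ζ)

lemma enorm_cauchyTransform_le (μ : Measure ℂ) {v : ℂ → ℂ} {V : ℝ} (hV : ∀ ζ, ‖v ζ‖ ≤ V) (z : ℂ) :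
    ‖cauchyTransform μ v z‖ₑ ≤ ENNReal.ofReal V * ∫⁻ ζ, ‖(ζ - z)⁻¹‖ₑ ∂μ := by
  rw [← lintegral_const_mul' _ _ ENNReal.ofReal_ne_top]
  exact (enorm_integral_le_lintegral_enorm _).trans
    (lintegral_mono fun ζ => enorm_mul_le_of_norm_le hV ζ _)

lemma stronglyMeasurable_cauchyTransform (μ : Measure ℂ) [SFinite μ] {v : ℂ → ℂ}
    (hv : Measurable v) : StronglyMeasurable (cauchyTransform μ v) := by
  refine StronglyMeasurable.integral_prod_right (f := fun z ζ : ℂ => v ζ * (ζ - z)⁻¹) ?_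
  exact ((hv.comp measurable_snd).mul (measurable_snd.sub measurable_fst).inv).stronglyMeasurable

lemma setLIntegral_inv_le (ζ : ℂ) (S : Set ℂ) :
    ∫⁻ z in S, ‖(ζ - z)⁻¹‖ₑ ≤ ENNReal.ofReal (2 * Real.pi) + volume S := by
  have hsub : S ⊆ Metric.closedBall ζ 1 ∪ (S \ Metric.closedBall ζ 1) := by
    rw [union_sdiff_self]; exact subset_union_right
  refine (lintegral_mono_set hsub).trans ((lintegral_union_le _ _ _).trans (add_le_add ?_ ?_))
  · simpa using lintegral_closedBall_inv_le ζ zero_le_one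
  · calc ∫⁻ z in S \ Metric.closedBall ζ 1, ‖(ζ - z)⁻¹‖ₑ
        ≤ ∫⁻ _ in S \ Metric.closedBall ζ 1, 1 := by
          refine setLIntegral_mono measurable_const fun z hz => ?_
          have h1 : 1 < ‖ζ - z‖ := by
            have := hz.2
            rwa [Metric.mem_closedBall, dist_comm, dist_eq_norm, not_le] at this
          rw [← ofReal_norm, norm_inv, ← ENNReal.ofReal_one]
          exact ENNReal.ofReal_le_ofReal (inv_le_one_of_one_le₀ h1.le)
      _ = volume (S \ Metric.closedBall ζ 1) := by simp
      _ ≤ volume S := measure_mono sdiff_subset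

lemma setLIntegral_cauchyTransform_le (μ : Measure ℂ) [SFinite μ] {v : ℂ → ℂ} {V : ℝ}
    (hV : ∀ ζ, ‖v ζ‖ ≤ V) (S : Set ℂ) :
    ∫⁻ z in S, ‖cauchyTransform μ v z‖ₑ ≤
      ENNReal.ofReal V * ((ENNReal.ofReal (2 * Real.pi) + volume S) * μ univ) := by
  refine (lintegral_mono fun z => enorm_cauchyTransform_le μ hV z).trans ?_
  rw [lintegral_const_mul' _ _ ENNReal.ofReal_ne_top,
    lintegral_lintegral_swap measurable_enorm_cauchyKernel.aemeasurable]
  gcongr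
  calc ∫⁻ ζ, ∫⁻ z in S, ‖(ζ - z)⁻¹‖ₑ ∂volume ∂μ
      ≤ ∫⁻ _, (ENNReal.ofReal (2 * Real.pi) + volume S) ∂μ :=
        lintegral_mono fun ζ => setLIntegral_inv_le ζ S
    _ = _ := lintegral_const _

lemma locallyIntegrable_cauchyTransform (μ : Measure ℂ) [IsFiniteMeasure μ] {v : ℂ → ℂ} {V : ℝ}
    (hv : Measurable v) (hV : ∀ ζ, ‖v ζ‖ ≤ V) :
    LocallyIntegrable (cauchyTransform μ v) volume := by
  refine fun x => ⟨Metric.closedBall x 1, Metric.closedBall_mem_nhds x one_pos,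
    (stronglyMeasurable_cauchyTransform μ hv).aestronglyMeasurable, ?_⟩
  refine (setLIntegral_cauchyTransform_le μ hV _).trans_lt ?_
  have : volume (Metric.closedBall x 1) < ⊤ := (isCompact_closedBall x 1).measure_lt_top
  finiteness

/-- The deviation of a Cauchy transform at `z` from the value at `w` of the transform of the far part
of the measure. -/
lemma enorm_cauchyTransform_sub_le (μ : Measure ℂ) [IsFiniteMeasure μ] {v : ℂ → ℂ} {V : ℝ}
    (hv : Measurable v) (hV : ∀ ζ, ‖v ζ‖ ≤ V) (hV0 : 0 < V) {w z : ℂ} {l : ℝ} (hl : 0 < l)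
    (hz : ‖z - w‖ ≤ l) :
    ‖cauchyTransform μ v z - ∫ ζ in (Metric.closedBall w (2 * l))ᶜ, v ζ * (ζ - w)⁻¹ ∂μ‖ₑ ≤
      ENNReal.ofReal V * (∫⁻ ζ in Metric.closedBall w (2 * l), ‖(ζ - z)⁻¹‖ₑ ∂μ +
        ENNReal.ofReal (2 * l) * ∫⁻ ζ in (Metric.closedBall w (2 * l))ᶜ,
          ENNReal.ofReal ((‖ζ - w‖ ^ 2)⁻¹) ∂μ) := by
  set B := Metric.closedBall w (2 * l)
  have hB : MeasurableSet B := Metric.isClosed_closedBall.measurableSet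
  rcases eq_or_ne (∫⁻ ζ in B, ‖(ζ - z)⁻¹‖ₑ ∂μ) ⊤ with htop | hfin
  · rw [htop, top_add, ENNReal.mul_top (by simpa using hV0)]
    exact le_top
  have hm : ∀ z : ℂ, AEStronglyMeasurable (fun ζ => v ζ * (ζ - z)⁻¹) μ := fun z =>
    (hv.mul (measurable_id.sub_const z).inv).aestronglyMeasurable
  have hfar : ∀ ζ ∈ Bᶜ, 2 * l < ‖ζ - w‖ ∧ ‖ζ - w‖ / 2 ≤ ‖ζ - z‖ := by
    intro ζ hζ
    rw [mem_compl_iff, Metric.mem_closedBall, dist_eq_norm, not_le] at hζ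
    refine ⟨hζ, ?_⟩
    have := norm_sub_le_norm_sub_add_norm_sub ζ z w
    linarith
  have hbdd : ∀ u : ℂ, (∀ ζ ∈ Bᶜ, l ≤ ‖ζ - u‖) →
      IntegrableOn (fun ζ => v ζ * (ζ - u)⁻¹) Bᶜ μ := by
    intro u hu
    refine Measure.integrableOn_of_bounded (M := V * l⁻¹) (measure_ne_top μ _) (hm u) ?_
    refine (ae_restrict_mem hB.compl).mono fun ζ hζ => ?_
    rw [norm_mul, norm_inv]
    gcongr
    · exact hV ζ
    · exact hu ζ hζ
  have hi1 : IntegrableOn (fun ζ => v ζ * (ζ - z)⁻¹) B μ := by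
    refine ⟨(hm z).restrict, ?_⟩
    refine (lintegral_mono fun ζ => enorm_mul_le_of_norm_le hV ζ _).trans_lt ?_
    rw [lintegral_const_mul' _ _ ENNReal.ofReal_ne_top]
    exact ENNReal.mul_lt_top ENNReal.ofReal_lt_top hfin.lt_top
  have hi2 := hbdd z fun ζ hζ => by linarith [(hfar ζ hζ).1, (hfar ζ hζ).2]
  have hi3 := hbdd w fun ζ hζ => by linarith [(hfar ζ hζ).1]
  have hsplit : cauchyTransform μ v z - ∫ ζ in Bᶜ, v ζ * (ζ - w)⁻¹ ∂μ =
      (∫ ζ in B, v ζ * (ζ - z)⁻¹ ∂μ) +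
        ∫ ζ in Bᶜ, v ζ * ((ζ - z)⁻¹ - (ζ - w)⁻¹) ∂μ := by
    have hi : Integrable (fun ζ => v ζ * (ζ - z)⁻¹) μ := by
      have := hi1.union hi2
      rwa [union_compl_self, integrableOn_univ] at this
    rw [cauchyTransform, ← integral_add_compl hB hi, add_sub_assoc,
      ← integral_sub hi2 hi3]
    simp only [mul_sub]
  rw [hsplit, mul_add, ← mul_assoc, mul_comm (ENNReal.ofReal V) (ENNReal.ofReal (2 * l)), mul_assoc]
  refine (enorm_add_le _ _).trans (add_le_add ?_ ?_)
  · rw [← lintegral_const_mul' _ _ ENNReal.ofReal_ne_top]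
    exact (enorm_integral_le_lintegral_enorm _).trans
      (lintegral_mono fun ζ => enorm_mul_le_of_norm_le hV ζ _)
  · rw [← lintegral_const_mul' _ _ ENNReal.ofReal_ne_top,
      ← lintegral_const_mul' _ _ ENNReal.ofReal_ne_top]
    refine (enorm_integral_le_lintegral_enorm _).trans (setLIntegral_mono' hB.compl fun ζ hζ => ?_)
    refine (enorm_mul_le_of_norm_le hV ζ _).trans ?_
    rw [mul_left_comm, ← ENNReal.ofReal_mul (by linarith), ← ofReal_norm]
    gcongr
    obtain ⟨h1, h2⟩ := hfar ζ hζ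
    have hw : 0 < ‖ζ - w‖ := by linarith
    have hz' : 0 < ‖ζ - z‖ := by linarith
    rw [inv_sub_inv (norm_pos_iff.1 hz') (norm_pos_iff.1 hw), norm_div, norm_mul,
      show ζ - w - (ζ - z) = z - w by ring, div_le_iff₀ (by positivity)]
    calc ‖z - w‖ ≤ l := hz
      _ = 2 * l * (‖ζ - w‖ ^ 2)⁻¹ * (‖ζ - w‖ / 2 * ‖ζ - w‖) := by field_simp
      _ ≤ _ := by gcongr

lemma meanOsc_cauchyTransform_le (μ : Measure ℂ) [IsFiniteMeasure μ] {v : ℂ → ℂ} {V : ℝ}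
    (hv : Measurable v) (hV : ∀ ζ, ‖v ζ‖ ≤ V) (hV0 : 0 < V) {ε ρ : ℝ} (hε : 0 ≤ ε) (hρ : 0 < ρ)
    (hμ : ∀ z r, 0 < r → r ≤ ρ → μ (Metric.closedBall z r) ≤ ENNReal.ofReal (ε * r))
    (a : ℂ) {l : ℝ} (hl : 0 < l) (hlρ : 2 * l ≤ ρ) :
    meanOsc (cauchyTransform μ v) (square a l) ≤
      ENNReal.ofReal (V * (120 * ε + 4 * l * μ.real univ / ρ ^ 2)) := by
  set w : ℂ := a + ⟨l / 2, l / 2⟩ with hw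
  have haw : a = w - ⟨l / 2, l / 2⟩ := by rw [hw]; ring
  have hSw : square a l ⊆ Metric.closedBall w l := by
    rw [haw]; exact square_subset_closedBall w hl.le
  refine (meanOsc_le (volume_square_ne_zero a hl) (volume_square_ne_top a l)
    (integrableOn_square (locallyIntegrable_cauchyTransform μ hv hV) a l)
    (∫ ζ in (Metric.closedBall w (2 * l))ᶜ, v ζ * (ζ - w)⁻¹ ∂μ)).trans ?_
  set Fr := ∫⁻ ζ in (Metric.closedBall w (2 * l))ᶜ, ENNReal.ofReal ((‖ζ - w‖ ^ 2)⁻¹) ∂μ with hFr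
  have hFrle : Fr ≤ ENNReal.ofReal (4 * ε / (2 * l) + (ρ ^ 2)⁻¹ * μ.real univ) := by
    refine (lintegral_compl_closedBall_le μ w (by linarith) hε hρ (hμ w)).trans (le_of_eq ?_)
    rw [ENNReal.ofReal_add (by positivity) (by positivity), ENNReal.ofReal_mul (by positivity),
      measureReal_def, ENNReal.ofReal_toReal (measure_ne_top μ _)]
  have hnear : ∫⁻ z in square a l, ∫⁻ ζ in Metric.closedBall w (2 * l), ‖(ζ - z)⁻¹‖ₑ ∂μ ≤
      ENNReal.ofReal (4 * Real.pi * (2 * l) * (ε * (2 * l))) := by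
    refine (lintegral_mono_set (hSw.trans (Metric.closedBall_subset_closedBall
      (by linarith)))).trans ((lintegral_lintegral_inv_le μ w (by linarith)).trans ?_)
    rw [ENNReal.ofReal_mul (p := 4 * Real.pi * (2 * l)) (by positivity)]
    gcongr
    exact hμ w _ (by linarith) hlρ
  have hint : ∫⁻ z in square a l, ‖cauchyTransform μ v z -
      ∫ ζ in (Metric.closedBall w (2 * l))ᶜ, v ζ * (ζ - w)⁻¹ ∂μ‖ₑ ≤
      ENNReal.ofReal (V * (4 * Real.pi * (2 * l) * (ε * (2 * l)) +
        2 * l * (4 * ε / (2 * l) + (ρ ^ 2)⁻¹ * μ.real univ) * l ^ 2)) := by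
    calc _ ≤ ∫⁻ z in square a l, ENNReal.ofReal V *
          (∫⁻ ζ in Metric.closedBall w (2 * l), ‖(ζ - z)⁻¹‖ₑ ∂μ + ENNReal.ofReal (2 * l) * Fr) := by
          refine setLIntegral_mono' (measurableSet_square a l) fun z hz => ?_
          refine enorm_cauchyTransform_sub_le μ hv hV hV0 hl ?_
          rw [← dist_eq_norm]
          exact hSw hz
      _ = ENNReal.ofReal V * ((∫⁻ z in square a l, ∫⁻ ζ in Metric.closedBall w (2 * l),
            ‖(ζ - z)⁻¹‖ₑ ∂μ) + ENNReal.ofReal (2 * l) * Fr * ENNReal.ofReal (l ^ 2)) := by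
          rw [lintegral_const_mul' _ _ ENNReal.ofReal_ne_top, lintegral_add_right _ measurable_const,
            setLIntegral_const, volume_square a hl.le]
      _ ≤ ENNReal.ofReal V * (ENNReal.ofReal (4 * Real.pi * (2 * l) * (ε * (2 * l))) +
            ENNReal.ofReal (2 * l) * ENNReal.ofReal (4 * ε / (2 * l) + (ρ ^ 2)⁻¹ * μ.real univ) *
              ENNReal.ofReal (l ^ 2)) := by gcongr
      _ = _ := by
          rw [← ENNReal.ofReal_mul (by positivity), ← ENNReal.ofReal_mul (by positivity),
            ← ENNReal.ofReal_add (by positivity) (by positivity), ← ENNReal.ofReal_mul hV0.le]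
  rw [volume_square a hl.le]
  calc _ ≤ 2 * ((ENNReal.ofReal (l ^ 2))⁻¹ * ENNReal.ofReal (V *
        (4 * Real.pi * (2 * l) * (ε * (2 * l)) +
          2 * l * (4 * ε / (2 * l) + (ρ ^ 2)⁻¹ * μ.real univ) * l ^ 2))) := by gcongr
    _ ≤ _ := by
      rw [← ENNReal.ofReal_inv_of_pos (by positivity), ← ENNReal.ofReal_mul (by positivity),
        ← ENNReal.ofReal_ofNat 2, ← ENNReal.ofReal_mul (by norm_num)]
      refine ENNReal.ofReal_le_ofReal ?_
      have hpi := Real.pi_lt_d2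
      have e : 2 * ((l ^ 2)⁻¹ * (V * (4 * Real.pi * (2 * l) * (ε * (2 * l)) +
          2 * l * (4 * ε / (2 * l) + (ρ ^ 2)⁻¹ * μ.real univ) * l ^ 2))) =
          V * ((32 * Real.pi + 8) * ε + 4 * l * μ.real univ / ρ ^ 2) := by
        field_simp
        ring
      rw [e]
      gcongr
      linarith

lemma bmoSeminorm_cauchyTransform_le (μ : Measure ℂ) [IsFiniteMeasure μ] {v : ℂ → ℂ} {V : ℝ}
    (hv : Measurable v) (hV : ∀ ζ, ‖v ζ‖ ≤ V) (hV0 : 0 < V) {A : ℝ} (hA : 0 ≤ A)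
    (hμ : ∀ z r, 0 < r → μ (Metric.closedBall z r) ≤ ENNReal.ofReal (A * r)) :
    bmoSeminorm (cauchyTransform μ v) ≤ ENNReal.ofReal (120 * V * A) := by
  refine iSup_le fun a => iSup_le fun l => iSup_le fun hl => ?_
  have hlim : Tendsto (fun ρ : ℝ => ENNReal.ofReal (V * (120 * A + 4 * l * μ.real univ / ρ ^ 2)))
      atTop (𝓝 (ENNReal.ofReal (V * (120 * A + 0)))) := by
    refine ENNReal.tendsto_ofReal ((tendsto_const_nhds.add ?_).const_mul V)
    exact tendsto_const_nhds.div_atTop (tendsto_pow_atTop two_ne_zero)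
  refine (ge_of_tendsto hlim ?_).trans (ENNReal.ofReal_le_ofReal (by linarith))
  filter_upwards [eventually_gt_atTop 0, eventually_ge_atTop (2 * l)] with ρ h1 h2
  exact meanOsc_cauchyTransform_le μ hv hV hV0 hA h1 (fun z r hr _ => hμ z r hr) a hl h2

theorem memVMO_cauchyTransform (μ : Measure ℂ) [IsFiniteMeasure μ] {v : ℂ → ℂ} {V : ℝ}
    (hv : Measurable v) (hV : ∀ ζ, ‖v ζ‖ ≤ V) {A : ℝ} (hA : 0 ≤ A)
    (hμ : ∀ z r, 0 < r → μ (Metric.closedBall z r) ≤ ENNReal.ofReal (A * r))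
    (hμ0 : ∀ ε : ℝ, 0 < ε → ∃ ρ : ℝ, 0 < ρ ∧ ∀ (z : ℂ) (r : ℝ), 0 < r → r < ρ →
      μ (Metric.closedBall z r) ≤ ENNReal.ofReal (ε * r)) :
    MemVMO (cauchyTransform μ v) := by
  obtain ⟨V, hV0, hV⟩ : ∃ V, 0 < V ∧ ∀ ζ, ‖v ζ‖ ≤ V :=
    ⟨max V 1, by positivity, fun ζ => (hV ζ).trans (le_max_left _ _)⟩
  refine ⟨⟨locallyIntegrable_cauchyTransform μ hv hV,
    (bmoSeminorm_cauchyTransform_le μ hv hV hV0 hA hμ).trans_lt ENNReal.ofReal_lt_top⟩, ?_⟩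
  rw [ENNReal.tendsto_nhds_zero]
  intro η hη
  rcases eq_or_ne η ⊤ with rfl | hηtop
  · exact Eventually.of_forall fun _ => le_top
  have hη' : 0 < η.toReal := ENNReal.toReal_pos hη.ne' hηtop
  set ε := η.toReal / (240 * V) with hεdef
  have hε : 0 < ε := by positivity
  obtain ⟨ρ, hρ, hρμ⟩ := hμ0 ε hε
  have hsmall : ∀ᶠ δ : ℝ in 𝓝[>] 0, 2 * δ ≤ ρ / 2 ∧
      V * (4 * δ * μ.real univ / (ρ / 2) ^ 2) ≤ η.toReal / 2 := by
    refine Filter.Eventually.filter_mono nhdsWithin_le_nhds ?_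
    have h1 : Tendsto (fun δ : ℝ => 2 * δ) (𝓝 0) (𝓝 (2 * 0)) := tendsto_id.const_mul 2
    have h2 : Tendsto (fun δ : ℝ => V * (4 * δ * μ.real univ / (ρ / 2) ^ 2)) (𝓝 0)
        (𝓝 (V * (4 * 0 * μ.real univ / (ρ / 2) ^ 2))) :=
      (((tendsto_id.const_mul 4).mul_const _).div_const _).const_mul V
    exact (h1.eventually (ge_mem_nhds (by simp only [mul_zero]; positivity))).and
      (h2.eventually (ge_mem_nhds (by
        simp only [mul_zero, zero_mul, zero_div]; positivity)))
  filter_upwards [hsmall, self_mem_nhdsWithin] with δ hδ hδ0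
  refine iSup_le fun a => iSup_le fun l => iSup_le fun hl => iSup_le fun hlδ => ?_
  refine (meanOsc_cauchyTransform_le μ hv hV hV0 hε.le (half_pos hρ)
    (fun z r hr hr' => hρμ z r hr (by linarith)) a hl (by linarith [hδ.1])).trans ?_
  rw [← ENNReal.ofReal_toReal hηtop]
  refine ENNReal.ofReal_le_ofReal ?_
  have h3 : V * (120 * ε) = η.toReal / 2 := by rw [hεdef]; field_simp; norm_num
  have h4 : V * (4 * l * μ.real univ / (ρ / 2) ^ 2) ≤ V * (4 * δ * μ.real univ / (ρ / 2) ^ 2) := by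
    gcongr
  rw [mul_add, h3]
  linarith [hδ.2]

lemma hasDerivAt_integral_cauchyKernel_pow {μ : Measure ℂ} [IsFiniteMeasure μ] {K : Set ℂ}
    (hK : IsClosed K) (hμK : μ Kᶜ = 0) {v : ℂ → ℂ} {V : ℝ} (hv : Measurable v)
    (hV : ∀ ζ, ‖v ζ‖ ≤ V) (k : ℕ) {w : ℂ} (hw : w ∉ K) :
    HasDerivAt (fun z => ∫ ζ, v ζ * (ζ - z)⁻¹ ^ (k + 1) ∂μ)
      ((k + 1) * ∫ ζ, v ζ * (ζ - w)⁻¹ ^ (k + 2) ∂μ) w := by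
  obtain ⟨δ, hδ, hball⟩ := Metric.isOpen_iff.1 hK.isOpen_compl w hw
  have hfar : ∀ ζ ∈ K, ∀ z ∈ Metric.ball w (δ / 2), δ / 2 ≤ ‖ζ - z‖ := by
    intro ζ hζ z hz
    by_contra! hlt
    have hin : ζ ∈ Metric.ball w δ := by
      rw [Metric.mem_ball, dist_eq_norm] at *
      linarith [norm_sub_le_norm_sub_add_norm_sub ζ z w]
    exact hball hin hζ
  have hae : ∀ᵐ ζ ∂μ, ζ ∈ K := by rwa [ae_iff]
  have hm : ∀ (j : ℕ) (z : ℂ), AEStronglyMeasurable (fun ζ => v ζ * (ζ - z)⁻¹ ^ j) μ := fun j z =>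
    (hv.mul ((measurable_id.sub_const z).inv.pow_const j)).aestronglyMeasurable
  have hV0 : 0 ≤ V := (norm_nonneg _).trans (hV 0)
  have hbound : ∀ (j : ℕ), ∀ ζ ∈ K, ∀ z ∈ Metric.ball w (δ / 2),
      ‖v ζ * (ζ - z)⁻¹ ^ j‖ ≤ V * (δ / 2)⁻¹ ^ j := by
    intro j ζ hζ z hz
    rw [norm_mul, norm_pow, norm_inv]
    gcongr
    · exact hV ζ
    · exact hfar ζ hζ z hz
  have hw' : w ∈ Metric.ball w (δ / 2) := Metric.mem_ball_self (by positivity)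
  have := (hasDerivAt_integral_of_dominated_loc_of_deriv_le (μ := μ)
    (F := fun z ζ => v ζ * (ζ - z)⁻¹ ^ (k + 1))
    (F' := fun z ζ => (k + 1) * (v ζ * (ζ - z)⁻¹ ^ (k + 2)))
    (bound := fun _ => (k + 1) * (V * (δ / 2)⁻¹ ^ (k + 2)))
    (Metric.ball_mem_nhds w (half_pos hδ)) (Eventually.of_forall (hm (k + 1)))
    (Integrable.of_bound (hm (k + 1) w) (V * (δ / 2)⁻¹ ^ (k + 1))
      (hae.mono fun ζ hζ => hbound (k + 1) ζ hζ w hw'))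
    ((hm (k + 2) w).const_mul _) (hae.mono fun ζ hζ z hz => ?_) (integrable_const _)
    (hae.mono fun ζ hζ z hz => ?_)).2
  · rwa [integral_const_mul] at this
  · rw [norm_mul]
    have : ‖(k + 1 : ℂ)‖ = k + 1 := by
      have := Complex.norm_natCast (k + 1)
      push_cast at this
      exact this
    rw [this]
    gcongr
    exact hbound (k + 2) ζ hζ z hz
  · have hne : ζ - z ≠ 0 := by
      have := hfar ζ hζ z hz
      exact norm_pos_iff.1 (by linarith)
    have h1 : HasDerivAt (fun z => (ζ - z)⁻¹) ((ζ - z)⁻¹ ^ 2) z := by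
      refine (((hasDerivAt_id z).const_sub ζ).fun_inv hne).congr_deriv ?_
      simp [div_eq_mul_inv]
    refine ((h1.fun_pow (k + 1)).const_mul (v ζ)).congr_deriv ?_
    simp only [Nat.add_sub_cancel]
    push_cast
    ring

lemma iteratedDeriv_cauchyTransform {μ : Measure ℂ} [IsFiniteMeasure μ] {K : Set ℂ}
    (hK : IsClosed K) (hμK : μ Kᶜ = 0) {v : ℂ → ℂ} {V : ℝ} (hv : Measurable v)
    (hV : ∀ ζ, ‖v ζ‖ ≤ V) (t : ℕ) {w : ℂ} (hw : w ∉ K) :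
    iteratedDeriv t (cauchyTransform μ v) w =
      (t.factorial : ℂ) * ∫ ζ, v ζ * (ζ - w)⁻¹ ^ (t + 1) ∂μ := by
  induction t generalizing w with
  | zero => simp [cauchyTransform]
  | succ t ih =>
    have hev : iteratedDeriv t (cauchyTransform μ v) =ᶠ[𝓝 w]
        fun z => (t.factorial : ℂ) * ∫ ζ, v ζ * (ζ - z)⁻¹ ^ (t + 1) ∂μ :=
      (hK.isOpen_compl.eventually_mem hw).mono fun z hz => ih hz
    rw [iteratedDeriv_succ, hev.deriv_eq, ((hasDerivAt_integral_cauchyKernel_pow hK hμK hv hV t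
      hw).const_mul _).deriv, Nat.factorial_succ]
    push_cast
    ring

lemma analyticOnNhd_cauchyTransform {μ : Measure ℂ} [IsFiniteMeasure μ] {K : Set ℂ}
    (hK : IsClosed K) (hμK : μ Kᶜ = 0) {v : ℂ → ℂ} {V : ℝ} (hv : Measurable v)
    (hV : ∀ ζ, ‖v ζ‖ ≤ V) : AnalyticOnNhd ℂ (cauchyTransform μ v) Kᶜ := by
  refine DifferentiableOn.analyticOnNhd (fun w hw => ?_) hK.isOpen_compl
  have := hasDerivAt_integral_cauchyKernel_pow hK hμK hv hV 0 hw
  simp only [zero_add, pow_one] at this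
  exact this.differentiableAt.differentiableWithinAt

/-- The expansion of a Cauchy transform at infinity, up to the second term. -/
lemma norm_cauchyTransform_add_le {μ : Measure ℂ} [IsFiniteMeasure μ] {x₀ : ℂ}
    (hμ : μ (Metric.closedBall x₀ (1 / 2))ᶜ = 0) {v : ℂ → ℂ} {V : ℝ} (hv : Measurable v)
    (hV : ∀ ζ, ‖v ζ‖ ≤ V) {z : ℂ} (hz : 1 ≤ ‖z - x₀‖) :
    ‖cauchyTransform μ v z + (∫ ζ, v ζ ∂μ) * (z - x₀)⁻¹ +
      (∫ ζ, v ζ * (ζ - x₀) ∂μ) * (z - x₀)⁻¹ ^ 2‖ ≤ V * μ.real univ * ‖z - x₀‖⁻¹ ^ 3 := by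
  have hae : ∀ᵐ ζ ∂μ, ‖ζ - x₀‖ ≤ 1 / 2 := by
    have : ∀ᵐ ζ ∂μ, ζ ∈ Metric.closedBall x₀ (1 / 2) := by rwa [ae_iff]
    simpa [dist_eq_norm] using this
  have hV0 : 0 ≤ V := (norm_nonneg _).trans (hV 0)
  have hz0 : z - x₀ ≠ 0 := norm_pos_iff.1 (by linarith)
  have hfar : ∀ ζ, ‖ζ - x₀‖ ≤ 1 / 2 → ‖z - x₀‖ / 2 ≤ ‖ζ - z‖ := by
    intro ζ hζ
    have := norm_sub_le_norm_sub_add_norm_sub z ζ x₀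
    rw [norm_sub_rev z ζ] at this
    linarith
  have hi0 : Integrable v μ := Integrable.of_bound hv.aestronglyMeasurable V (ae_of_all _ hV)
  have hi1 : Integrable (fun ζ => v ζ * (ζ - x₀)) μ := by
    refine Integrable.of_bound (hv.mul (measurable_id.sub_const x₀)).aestronglyMeasurable
      (V * (1 / 2)) (hae.mono fun ζ hζ => ?_)
    rw [norm_mul]
    gcongr
    exact hV ζ
  have hi2 : Integrable (fun ζ => v ζ * (ζ - z)⁻¹) μ := by
    refine Integrable.of_bound (hv.mul (measurable_id.sub_const z).inv).aestronglyMeasurable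
      (V * (1 / 2)⁻¹) (hae.mono fun ζ hζ => ?_)
    rw [norm_mul, norm_inv]
    gcongr
    · exact hV ζ
    · linarith [hfar ζ hζ]
  have hi3 : Integrable (fun ζ => v ζ * (ζ - z)⁻¹ + v ζ * (z - x₀)⁻¹) μ :=
    hi2.add (hi0.mul_const _)
  rw [cauchyTransform, ← integral_mul_const, ← integral_mul_const,
    ← integral_add hi2 (hi0.mul_const _), ← integral_add hi3 (hi1.mul_const _)]
  refine (norm_integral_le_of_norm_le_const (C := V * ‖z - x₀‖⁻¹ ^ 3)
    (hae.mono fun ζ hζ => ?_)).trans (le_of_eq (by ring))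
  have hζz : 0 < ‖ζ - z‖ := by linarith [hfar ζ hζ]
  have hne : ζ - z ≠ 0 := norm_pos_iff.1 hζz
  have e : v ζ * (ζ - z)⁻¹ + v ζ * (z - x₀)⁻¹ + v ζ * (ζ - x₀) * (z - x₀)⁻¹ ^ 2 =
      v ζ * ((ζ - x₀) ^ 2 * (ζ - z)⁻¹ * (z - x₀)⁻¹ ^ 2) := by
    field_simp
    ring
  rw [e, norm_mul]
  gcongr
  · exact hV ζ
  · rw [norm_mul, norm_mul, norm_pow, norm_pow, norm_inv, norm_inv]
    have hz1 : 0 < ‖z - x₀‖ := by linarith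
    have h1 : ‖ζ - x₀‖ ^ 2 * ‖ζ - z‖⁻¹ ≤ (1 / 2) ^ 2 * (‖z - x₀‖ / 2)⁻¹ := by
      gcongr
      exact hfar ζ hζ
    calc ‖ζ - x₀‖ ^ 2 * ‖ζ - z‖⁻¹ * ‖z - x₀‖⁻¹ ^ 2
        ≤ (1 / 2) ^ 2 * (‖z - x₀‖ / 2)⁻¹ * ‖z - x₀‖⁻¹ ^ 2 := by gcongr
      _ = (1 / 2) * ‖z - x₀‖⁻¹ ^ 3 := by field_simp
      _ ≤ ‖z - x₀‖⁻¹ ^ 3 := by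
        have : 0 ≤ ‖z - x₀‖⁻¹ ^ 3 := by positivity
        linarith

lemma bmoSeminorm_sub_le {f g : ℂ → ℂ} (hf : LocallyIntegrable f volume)
    (hg : LocallyIntegrable g volume) :
    bmoSeminorm (fun z => f z - g z) ≤ bmoSeminorm f + bmoSeminorm g :=
  iSup_le fun a => iSup_le fun l => iSup_le fun hl => (meanOsc_sub_le hf hg a l).trans
    (add_le_add (meanOsc_le_bmoSeminorm f a hl) (meanOsc_le_bmoSeminorm g a hl))

lemma MemVMO.sub {f g : ℂ → ℂ} (hf : MemVMO f) (hg : MemVMO g) : MemVMO fun z => f z - g z := by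
  refine ⟨⟨hf.1.1.sub hg.1.1, (bmoSeminorm_sub_le hf.1.1 hg.1.1).trans_lt
    (ENNReal.add_lt_top.2 ⟨hf.1.2, hg.1.2⟩)⟩, ?_⟩
  have h := hf.2.add hg.2
  rw [add_zero] at h
  refine tendsto_of_tendsto_of_tendsto_of_le_of_le tendsto_const_nhds h (fun _ => zero_le) fun δ => ?_
  exact iSup_le fun a => iSup_le fun l => iSup_le fun hl => iSup_le fun hlδ =>
    (meanOsc_sub_le hf.1.1 hg.1.1 a l).trans (add_le_add (meanOsc_le_oscModulus f a hl hlδ)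
      (meanOsc_le_oscModulus g a hl hlδ))

/-- The first two moments of a measure without atoms can be prescribed by bounded densities. -/
lemma exists_density_of_moments {ν : Measure ℂ} [IsFiniteMeasure ν] {x₀ : ℂ}
    (hν : ν (Metric.closedBall x₀ (1 / 2))ᶜ = 0) (hν0 : ν univ ≠ 0)
    (hatom : ∀ z, ν {z} = 0) :
    ∃ C : ℝ, 0 ≤ C ∧ ∀ m₀ m₁ : ℂ, ∃ g : ℂ → ℂ, Measurable g ∧
      (∀ ζ, ‖g ζ‖ ≤ C * (‖m₀‖ + ‖m₁‖)) ∧ ∫ ζ, g ζ ∂ν = m₀ ∧ ∫ ζ, g ζ * (ζ - x₀) ∂ν = m₁ := by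
  have hae : ∀ᵐ ζ ∂ν, ζ ∈ Metric.closedBall x₀ (1 / 2) := by rwa [ae_iff]
  have hB : MeasurableSet (Metric.closedBall x₀ (1 / 2)) :=
    Metric.isClosed_closedBall.measurableSet
  set T : ℝ := ν.real univ with hT
  have hT0 : 0 < T := ENNReal.toReal_pos hν0 (measure_ne_top ν _)
  have hTc : (T : ℂ) ≠ 0 := by exact_mod_cast hT0.ne'
  -- `b` is the barycentre of `ν`, and `p` is `ζ - b`, truncated to be bounded.
  set b : ℂ := x₀ + (∫ ζ, (ζ - x₀) ∂ν) / T with hb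
  set p : ℂ → ℂ := (Metric.closedBall x₀ (1 / 2)).indicator fun ζ => ζ - b with hp
  have hpm : Measurable p := (measurable_id.sub_const b).indicator hB
  set P : ℝ := 1 / 2 + ‖x₀ - b‖ with hP
  have hP0 : 0 < P := by positivity
  have hpP : ∀ ζ, ‖p ζ‖ ≤ P := by
    intro ζ
    by_cases hζ : ζ ∈ Metric.closedBall x₀ (1 / 2)
    · rw [hp, indicator_of_mem hζ]
      rw [Metric.mem_closedBall, dist_eq_norm] at hζ
      linarith [norm_sub_le_norm_sub_add_norm_sub ζ x₀ b]
    · rw [hp, indicator_of_notMem hζ, norm_zero]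
      exact hP0.le
  have hpae : ∀ᵐ ζ ∂ν, p ζ = ζ - b := hae.mono fun ζ hζ => indicator_of_mem hζ _
  have hbdd : ∀ {h : ℂ → ℂ} {B : ℝ}, Measurable h → (∀ ζ, ‖h ζ‖ ≤ B) → Integrable h ν :=
    fun hm hB => Integrable.of_bound hm.aestronglyMeasurable _ (ae_of_all _ hB)
  have hpi : Integrable p ν := hbdd hpm hpP
  have hp0 : ∫ ζ, p ζ ∂ν = 0 := by
    have hxi : Integrable (fun ζ => ζ - x₀) ν := by
      refine (hpi.add (integrable_const (b - x₀))).congr (hpae.mono fun ζ hζ => ?_)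
      simp [hζ]
    have e : ∫ ζ, p ζ ∂ν = ∫ ζ, ((ζ - x₀) - (b - x₀)) ∂ν :=
      integral_congr_ae (hpae.mono fun ζ hζ => by simp [hζ])
    rw [e, integral_sub hxi (integrable_const _), integral_const, ← hT, hb, Complex.real_smul]
    field_simp
    ring
  set s : ℝ := ∫ ζ, ‖p ζ‖ ^ 2 ∂ν with hs
  have hs0 : 0 < s := by
    refine (integral_nonneg fun ζ => by positivity).lt_of_ne fun h0 => ?_
    have hint : Integrable (fun ζ => ‖p ζ‖ ^ 2) ν := by
      refine Integrable.of_bound (hpm.norm.pow_const 2).aestronglyMeasurable (P ^ 2)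
        (ae_of_all _ fun ζ => ?_)
      rw [norm_pow, norm_norm]
      gcongr
      exact hpP ζ
    have hz := (integral_eq_zero_iff_of_nonneg (fun ζ => by positivity) hint).1 h0.symm
    have hb' : ∀ᵐ ζ ∂ν, ζ = b := by
      filter_upwards [hz, hpae] with ζ h1 h2
      have : p ζ = 0 := by simpa using h1
      exact sub_eq_zero.1 (h2 ▸ this)
    have h1 : ν {b}ᶜ = 0 := by rw [ae_iff] at hb'; exact hb'
    exact hν0 (by rw [← measure_add_measure_compl (measurableSet_singleton b), h1, hatom b, add_zero])
  have hsc : (s : ℂ) ≠ 0 := by exact_mod_cast hs0.ne'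
  have hconj0 : ∫ ζ, (starRingEnd ℂ) (p ζ) ∂ν = 0 := by rw [integral_conj, hp0, map_zero]
  have hcm : Measurable fun ζ => (starRingEnd ℂ) (p ζ) := Complex.continuous_conj.measurable.comp hpm
  have hci : Integrable (fun ζ => (starRingEnd ℂ) (p ζ)) ν :=
    hbdd hcm (B := P) fun ζ => by rw [RCLike.norm_conj]; exact hpP ζ
  refine ⟨T⁻¹ + P * s⁻¹ * (1 + ‖x₀ - b‖), by positivity, fun m₀ m₁ => ?_⟩
  set α : ℂ := m₀ / T
  set β : ℂ := (m₁ + (x₀ - b) * m₀) / s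
  have hgm : Measurable fun ζ => α + β * (starRingEnd ℂ) (p ζ) :=
    measurable_const.add (measurable_const.mul hcm)
  have hg0 : ∫ ζ, (α + β * (starRingEnd ℂ) (p ζ)) ∂ν = m₀ := by
    rw [integral_add (integrable_const _) (hci.const_mul _), integral_const, integral_const_mul,
      hconj0, mul_zero, add_zero, ← hT, Complex.real_smul]
    exact mul_div_cancel₀ _ hTc
  have hgp : ∫ ζ, (α + β * (starRingEnd ℂ) (p ζ)) * p ζ ∂ν = β * s := by
    have e : ∀ ζ, (α + β * (starRingEnd ℂ) (p ζ)) * p ζ =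
        α * p ζ + β * ((‖p ζ‖ ^ 2 : ℝ) : ℂ) := by
      intro ζ
      have : (starRingEnd ℂ) (p ζ) * p ζ = ((‖p ζ‖ ^ 2 : ℝ) : ℂ) := by
        rw [mul_comm, Complex.mul_conj, Complex.normSq_eq_norm_sq]
      rw [add_mul, mul_assoc, this]
    simp_rw [e]
    have hi : Integrable (fun ζ => ((‖p ζ‖ ^ 2 : ℝ) : ℂ)) ν := by
      refine hbdd (B := P ^ 2) (Complex.measurable_ofReal.comp (hpm.norm.pow_const 2)) fun ζ => ?_
      rw [Complex.norm_real, norm_pow, norm_norm]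
      gcongr
      exact hpP ζ
    rw [integral_add (hpi.const_mul _) (hi.const_mul _), integral_const_mul, integral_const_mul, hp0,
      mul_zero, zero_add, integral_complex_ofReal]
  have hgb : ∀ ζ, ‖α + β * (starRingEnd ℂ) (p ζ)‖ ≤ ‖α‖ + ‖β‖ * P := by
    intro ζ
    refine (norm_add_le _ _).trans ?_
    rw [norm_mul, RCLike.norm_conj]
    gcongr
    exact hpP ζ
  refine ⟨fun ζ => α + β * (starRingEnd ℂ) (p ζ), hgm, fun ζ => (hgb ζ).trans ?_, hg0, ?_⟩
  · have h1 : ‖α‖ = T⁻¹ * ‖m₀‖ := by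
      rw [norm_div, Complex.norm_real, Real.norm_of_nonneg hT0.le]; field_simp
    have h2 : ‖β‖ ≤ s⁻¹ * (‖m₁‖ + ‖x₀ - b‖ * ‖m₀‖) := by
      rw [norm_div, Complex.norm_real, Real.norm_of_nonneg hs0.le, div_eq_inv_mul]
      gcongr
      exact (norm_add_le _ _).trans (by rw [norm_mul])
    calc ‖α‖ + ‖β‖ * P ≤ T⁻¹ * ‖m₀‖ + s⁻¹ * (‖m₁‖ + ‖x₀ - b‖ * ‖m₀‖) * P := by
          rw [h1]; gcongr
      _ ≤ _ := by
          have a1 : 0 ≤ T⁻¹ * ‖m₁‖ := by positivity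
          have a2 : 0 ≤ P * s⁻¹ * ‖m₀‖ := by positivity
          have a3 : 0 ≤ P * s⁻¹ * ‖x₀ - b‖ * ‖m₁‖ := by positivity
          nlinarith
  · have e : ∫ ζ, (α + β * (starRingEnd ℂ) (p ζ)) * (ζ - x₀) ∂ν =
        ∫ ζ, ((α + β * (starRingEnd ℂ) (p ζ)) * p ζ -
          (α + β * (starRingEnd ℂ) (p ζ)) * (x₀ - b)) ∂ν := by
      refine integral_congr_ae (hpae.mono fun ζ hζ => ?_)
      simp only [hζ]
      ring
    have hi : Integrable (fun ζ => (α + β * (starRingEnd ℂ) (p ζ)) * p ζ) ν := by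
      refine hbdd (B := (‖α‖ + ‖β‖ * P) * P) (hgm.mul hpm) fun ζ => ?_
      rw [norm_mul]
      gcongr
      · exact hgb ζ
      · exact hpP ζ
    rw [e, integral_sub hi ((hbdd hgm hgb).mul_const _), hgp, integral_mul_const, hg0]
    simp only [β]
    field_simp
    ring

/-! ### A bounded point derivation forces the series to converge -/

/-- A measure has uniformly small linear growth if the discs of radius `r` have mass `o(r)`,
uniformly in the centre. -/
def SmallGrowth (μ : Measure ℂ) : Prop :=
  ∀ ε : ℝ, 0 < ε → ∃ ρ : ℝ, 0 < ρ ∧ ∀ (z : ℂ) (r : ℝ), 0 < r → r < ρ →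
    μ (Metric.closedBall z r) ≤ ENNReal.ofReal (ε * r)

lemma SmallGrowth.sum {μ : ℕ → Measure ℂ} (h : ∀ n, SmallGrowth (μ n)) (s : Finset ℕ) :
    SmallGrowth (∑ n ∈ s, μ n) := by
  classical
  induction s using Finset.induction_on with
  | empty => exact fun ε hε => ⟨1, one_pos, fun z r _ _ => by simp⟩
  | insert n s hn ih =>
    intro ε hε
    obtain ⟨ρ₁, hρ₁, h₁⟩ := h n (ε / 2) (half_pos hε)
    obtain ⟨ρ₂, hρ₂, h₂⟩ := ih (ε / 2) (half_pos hε)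
    refine ⟨min ρ₁ ρ₂, lt_min hρ₁ hρ₂, fun z r hr hrρ => ?_⟩
    rw [Finset.sum_insert hn, Measure.add_apply]
    refine (add_le_add (h₁ z r hr (hrρ.trans_le (min_le_left _ _)))
      (h₂ z r hr (hrρ.trans_le (min_le_right _ _)))).trans ?_
    rw [← ENNReal.ofReal_add (by positivity) (by positivity)]
    exact ENNReal.ofReal_le_ofReal (by linarith)

lemma annulus_subset_closedBall (x₀ : ℂ) (n : ℕ) :
    annulus x₀ n ⊆ Metric.closedBall x₀ (2 ^ n)⁻¹ := by
  intro z hz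
  rw [Metric.mem_closedBall, dist_eq_norm]
  exact hz.2

lemma annulus_succ_subset_closedBall_half (x₀ : ℂ) (n : ℕ) :
    annulus x₀ (n + 1) ⊆ Metric.closedBall x₀ (1 / 2) := by
  refine (annulus_subset_closedBall x₀ (n + 1)).trans (Metric.closedBall_subset_closedBall ?_)
  rw [one_div, pow_succ]
  gcongr
  exact le_mul_of_one_le_left (by norm_num) (one_le_pow₀ (by norm_num))

lemma measurableSet_annulus (x₀ : ℂ) (n : ℕ) : MeasurableSet (annulus x₀ n) := by
  have hc : Measurable fun z : ℂ => ‖z - x₀‖ := (measurable_id.sub_const x₀).norm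
  exact (measurableSet_le measurable_const hc).inter (measurableSet_le hc measurable_const)

lemma exists_frostman_measure_lowerContent_le {E : Set ℂ} (hE : MeasurableSet E) {x₀ : ℂ}
    (hEb : E ⊆ Metric.closedBall x₀ (1 / 2)) :
    ∃ K ⊆ E, IsCompact K ∧ ∃ μ : Measure ℂ, IsFiniteMeasure μ ∧ μ Kᶜ = 0 ∧
      lowerContent E ≤ 18 * μ univ ∧
      (∀ (z : ℂ) (r : ℝ), 0 < r → μ (Metric.closedBall z r) ≤ ENNReal.ofReal (36 * r)) ∧
      SmallGrowth μ := by
  rcases eq_or_ne (lowerContent E) 0 with h0 | h0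
  · exact ⟨∅, empty_subset _, isCompact_empty, 0, inferInstance, by simp, by simp [h0], by simp,
      fun ε hε => ⟨1, one_pos, fun z r _ _ => by simp⟩⟩
  have htop : lowerContent E ≠ ⊤ := by
    intro htop
    obtain ⟨K, hKE, hK, μ, _, hμK, hle, hgrow, _⟩ := exists_frostman_measure hE hEb (a := 1000)
      (by rw [htop]; exact ENNReal.ofNat_lt_top)
    have h1 : μ univ ≤ ENNReal.ofReal (36 * (1 / 2)) := by
      rw [← measure_add_measure_compl hK.measurableSet, hμK, add_zero]
      exact (measure_mono (hKE.trans hEb)).trans (hgrow x₀ (1 / 2) (by norm_num))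
    have h2 : (1000 : ℝ≥0∞) ≤ 9 * ENNReal.ofReal (36 * (1 / 2)) := hle.trans (by gcongr)
    rw [← ENNReal.ofReal_ofNat 9, ← ENNReal.ofReal_mul (by norm_num), ← ENNReal.ofReal_ofNat 1000,
      ENNReal.ofReal_le_ofReal_iff (by norm_num)] at h2
    norm_num at h2
  obtain ⟨K, hKE, hK, μ, hfin, hμK, hle, hgrow, hsmall⟩ := exists_frostman_measure hE hEb
    (ENNReal.half_lt_self h0 htop)
  refine ⟨K, hKE, hK, μ, hfin, hμK, ?_, hgrow, hsmall⟩
  calc lowerContent E = 2 * (lowerContent E / 2) := (ENNReal.mul_div_cancel (by simp) (by simp)).symm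
    _ ≤ 2 * (9 * μ univ) := by gcongr
    _ = 18 * μ univ := by rw [← mul_assoc]; norm_num

lemma sum_geometric_le {a : ℝ} (ha : 0 ≤ a) (N : ℕ) :
    ∑ n ∈ Finset.range N, (if ((2 : ℝ) ^ (n + 1))⁻¹ ≤ a then ((2 : ℝ) ^ (n + 1))⁻¹ else 0) ≤
      2 * a := by
  have key : ∑ n ∈ Finset.range N, (if ((2 : ℝ) ^ (n + 1))⁻¹ ≤ a then ((2 : ℝ) ^ (n + 1))⁻¹ else 0) ≤
      2 * a - 2 * min a ((2 : ℝ) ^ (N + 1))⁻¹ := by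
    induction N with
    | zero =>
      have := min_le_left a ((2 : ℝ) ^ (0 + 1))⁻¹
      simp only [Finset.range_zero, Finset.sum_empty]
      linarith
    | succ N ih =>
      have h2 : ((2 : ℝ) ^ (N + 1 + 1))⁻¹ = ((2 : ℝ) ^ (N + 1))⁻¹ / 2 := by
        rw [pow_succ _ (N + 1)]; field_simp
      have hpos : (0 : ℝ) < ((2 : ℝ) ^ (N + 1))⁻¹ := by positivity
      rw [Finset.sum_range_succ, h2]
      split_ifs with h
      · rw [min_eq_right h] at ih
        rw [min_eq_right (by linarith)]
        linarith
      · rw [min_eq_left (not_le.1 h).le] at ih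
        have := min_le_left a (((2 : ℝ) ^ (N + 1))⁻¹ / 2)
        linarith
  have : 0 ≤ min a ((2 : ℝ) ^ (N + 1))⁻¹ := le_min ha (by positivity)
  linarith

/-- Measures of linear growth on the annuli around `x₀` add up to a measure of linear growth: a disc
either has a radius comparable to its distance from `x₀`, and the masses of the annuli it meets form
a geometric series, or it meets a bounded number of annuli. -/
lemma sum_measure_closedBall_le {μ : ℕ → Measure ℂ} {x₀ : ℂ}
    (hsupp : ∀ n, μ n (annulus x₀ (n + 1))ᶜ = 0)
    (hgrow : ∀ n z r, 0 < r → μ n (Metric.closedBall z r) ≤ ENNReal.ofReal (36 * r))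
    (N : ℕ) (z : ℂ) {r : ℝ} (hr : 0 < r) :
    (∑ n ∈ Finset.range N, μ n) (Metric.closedBall z r) ≤ ENNReal.ofReal (720 * r) := by
  have hred : ∀ (κ a : ℝ), 0 ≤ κ → 0 ≤ a → 2 * (κ * a) ≤ 720 * r →
      (∀ n, (∃ ζ ∈ annulus x₀ (n + 1), ζ ∈ Metric.closedBall z r) → ((2 : ℝ) ^ (n + 1))⁻¹ ≤ a ∧
        μ n (Metric.closedBall z r) ≤ ENNReal.ofReal (κ * ((2 : ℝ) ^ (n + 1))⁻¹)) →
      (∑ n ∈ Finset.range N, μ n) (Metric.closedBall z r) ≤ ENNReal.ofReal (720 * r) := by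
    intro κ a hκ ha hκa h
    have hterm : ∀ n ∈ Finset.range N, μ n (Metric.closedBall z r) ≤ ENNReal.ofReal (κ *
        (if ((2 : ℝ) ^ (n + 1))⁻¹ ≤ a then ((2 : ℝ) ^ (n + 1))⁻¹ else 0)) := by
      intro n _
      by_cases hex : ∃ ζ ∈ annulus x₀ (n + 1), ζ ∈ Metric.closedBall z r
      · obtain ⟨h1, h2⟩ := h n hex
        rwa [if_pos h1]
      · have : μ n (Metric.closedBall z r) = 0 := by
          refine measure_mono_null (t := (annulus x₀ (n + 1))ᶜ) (fun ζ hζ hζ' => ?_) (hsupp n)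
          exact hex ⟨ζ, hζ', hζ⟩
        rw [this]
        exact zero_le
    rw [Measure.finsetSum_apply]
    refine (Finset.sum_le_sum hterm).trans ?_
    rw [← ENNReal.ofReal_sum_of_nonneg (fun n _ => by split_ifs <;> positivity), ← Finset.mul_sum]
    refine ENNReal.ofReal_le_ofReal (le_trans ?_ hκa)
    nlinarith [mul_le_mul_of_nonneg_left (sum_geometric_le ha N) hκ]
  have hhalf : ∀ n : ℕ, ((2 : ℝ) ^ (n + 1 + 1))⁻¹ = ((2 : ℝ) ^ (n + 1))⁻¹ / 2 := fun n => by
    rw [pow_succ _ (n + 1)]; field_simp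
  rcases le_or_gt (‖z - x₀‖ / 4) r with hd | hd
  · refine hred 36 (10 * r) (by norm_num) (by linarith) (by linarith) ?_
    rintro n ⟨ζ, hζ, hζz⟩
    rw [Metric.mem_closedBall, dist_eq_norm] at hζz
    have h1 := hζ.1
    rw [hhalf] at h1
    refine ⟨by linarith [norm_sub_le_norm_sub_add_norm_sub ζ z x₀], ?_⟩
    have hle : μ n (Metric.closedBall z r) ≤ μ n (Metric.closedBall x₀ ((2 : ℝ) ^ (n + 1))⁻¹) := by
      refine (measure_mono (subset_univ _)).trans ?_
      rw [← measure_add_measure_compl (measurableSet_annulus x₀ (n + 1)), hsupp, add_zero]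
      exact measure_mono (annulus_subset_closedBall x₀ (n + 1))
    exact hle.trans (hgrow n x₀ _ (by positivity))
  · have hd0 : 0 < ‖z - x₀‖ := by linarith
    refine hred (48 * r / ‖z - x₀‖) (5 / 2 * ‖z - x₀‖) (by positivity) (by positivity) ?_ ?_
    · rw [div_mul_eq_mul_div, ← mul_div_assoc, div_le_iff₀ hd0]
      nlinarith
    · rintro n ⟨ζ, hζ, hζz⟩
      rw [Metric.mem_closedBall, dist_eq_norm] at hζz
      have h1 := hζ.1
      have h2 := hζ.2
      rw [hhalf] at h1
      have h3 := norm_sub_le_norm_sub_add_norm_sub ζ z x₀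
      have h4 := norm_sub_le_norm_sub_add_norm_sub z ζ x₀
      rw [norm_sub_rev z ζ] at h4
      refine ⟨by linarith, (hgrow n z r hr).trans (ENNReal.ofReal_le_ofReal ?_)⟩
      rw [div_mul_eq_mul_div, le_div_iff₀ hd0]
      nlinarith

lemma lintegral_inv_pow_three_lt_top (x₀ : ℂ) :
    ∫⁻ z in (Metric.closedBall x₀ 1)ᶜ, ENNReal.ofReal (‖z - x₀‖⁻¹ ^ 3) < ⊤ := by
  have h1 : Integrable (fun z : ℂ => (1 + ‖z‖) ^ (-(3 : ℝ))) volume :=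
    integrable_one_add_norm (by rw [Complex.finrank_real_complex]; norm_num)
  have h2 := (h1.comp_sub_right x₀).const_mul 8
  refine lt_of_le_of_lt ((setLIntegral_mono' Metric.isClosed_closedBall.measurableSet.compl
    fun z hz => ?_).trans (setLIntegral_le_lintegral _ _)) h2.2
  rw [mem_compl_iff, Metric.mem_closedBall, dist_eq_norm, not_le] at hz
  rw [← ofReal_norm]
  refine ENNReal.ofReal_le_ofReal (le_trans ?_ (le_abs_self _))
  have hp : (0 : ℝ) < 1 + ‖z - x₀‖ := by linarith
  change _ ≤ 8 * (1 + ‖z - x₀‖) ^ (-(3 : ℝ))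
  rw [Real.rpow_neg hp.le, show (3 : ℝ) = ((3 : ℕ) : ℝ) by norm_num, Real.rpow_natCast, inv_pow,
    ← div_eq_mul_inv, le_div_iff₀ (by positivity), inv_mul_le_iff₀ (by positivity)]
  have : 1 + ‖z - x₀‖ ≤ 2 * ‖z - x₀‖ := by linarith
  calc (1 + ‖z - x₀‖) ^ 3 ≤ (2 * ‖z - x₀‖) ^ 3 := by gcongr
    _ = _ := by ring

/-- The difference of two Cauchy transforms whose measures have the same first two moments is
integrable over the plane. -/
lemma lintegral_cauchyTransform_sub_le {μ ν : Measure ℂ} [IsFiniteMeasure μ] [IsFiniteMeasure ν]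
    {x₀ : ℂ} (hμ : μ (Metric.closedBall x₀ (1 / 2))ᶜ = 0)
    (hν : ν (Metric.closedBall x₀ (1 / 2))ᶜ = 0) {u v : ℂ → ℂ} {U V : ℝ} (hu : Measurable u)
    (hU : ∀ ζ, ‖u ζ‖ ≤ U) (hv : Measurable v) (hV : ∀ ζ, ‖v ζ‖ ≤ V)
    (h0 : ∫ ζ, u ζ ∂μ = ∫ ζ, v ζ ∂ν)
    (h1 : ∫ ζ, u ζ * (ζ - x₀) ∂μ = ∫ ζ, v ζ * (ζ - x₀) ∂ν) :
    ∫⁻ z, ‖cauchyTransform μ u z - cauchyTransform ν v z‖ₑ ≤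
      (ENNReal.ofReal (2 * Real.pi) + volume (Metric.closedBall x₀ 1) +
        ∫⁻ z in (Metric.closedBall x₀ 1)ᶜ, ENNReal.ofReal (‖z - x₀‖⁻¹ ^ 3)) *
      ENNReal.ofReal (U * μ.real univ + V * ν.real univ) := by
  have hU0 : 0 ≤ U := (norm_nonneg _).trans (hU 0)
  have hV0 : 0 ≤ V := (norm_nonneg _).trans (hV 0)
  have hsum : ENNReal.ofReal (U * μ.real univ + V * ν.real univ) =
      ENNReal.ofReal U * μ univ + ENNReal.ofReal V * ν univ := by
    rw [ENNReal.ofReal_add (by positivity) (by positivity), ENNReal.ofReal_mul hU0,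
      ENNReal.ofReal_mul hV0, measureReal_def, measureReal_def,
      ENNReal.ofReal_toReal (measure_ne_top _ _), ENNReal.ofReal_toReal (measure_ne_top _ _)]
  have hB : MeasurableSet (Metric.closedBall x₀ 1) := Metric.isClosed_closedBall.measurableSet
  rw [← lintegral_add_compl _ hB, add_mul]
  refine add_le_add ?_ ?_
  · calc ∫⁻ z in Metric.closedBall x₀ 1, ‖cauchyTransform μ u z - cauchyTransform ν v z‖ₑ
        ≤ ∫⁻ z in Metric.closedBall x₀ 1,
            (‖cauchyTransform μ u z‖ₑ + ‖cauchyTransform ν v z‖ₑ) :=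
          lintegral_mono fun z => enorm_sub_le
      _ = (∫⁻ z in Metric.closedBall x₀ 1, ‖cauchyTransform μ u z‖ₑ) +
            ∫⁻ z in Metric.closedBall x₀ 1, ‖cauchyTransform ν v z‖ₑ :=
          lintegral_add_left (stronglyMeasurable_cauchyTransform μ hu).measurable.enorm _
      _ ≤ _ := add_le_add (setLIntegral_cauchyTransform_le μ hU _)
          (setLIntegral_cauchyTransform_le ν hV _)
      _ = _ := by rw [hsum]; ring
  · rw [← lintegral_mul_const' _ _ ENNReal.ofReal_ne_top]
    refine setLIntegral_mono' hB.compl fun z hz => ?_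
    rw [mem_compl_iff, Metric.mem_closedBall, dist_eq_norm, not_le] at hz
    rw [← ENNReal.ofReal_mul (by positivity), ← ofReal_norm]
    refine ENNReal.ofReal_le_ofReal ?_
    have e1 := norm_cauchyTransform_add_le hμ hu hU hz.le
    have e2 := norm_cauchyTransform_add_le hν hv hV hz.le
    rw [← h0, ← h1] at e2
    refine le_trans (le_of_eq ?_) ((norm_sub_le _ _).trans ((add_le_add e1 e2).trans
      (le_of_eq ?_)))
    · congr 1
      ring
    · ring

lemma measure_univ_le_of_closedBall {μ : Measure ℂ} {x₀ : ℂ} {r : ℝ}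
    (h : μ (Metric.closedBall x₀ r)ᶜ = 0) : μ univ ≤ μ (Metric.closedBall x₀ r) := by
  rw [← measure_add_measure_compl Metric.isClosed_closedBall.measurableSet, h, add_zero]

lemma bmoNormOn_le {X : Set ℂ} {f : ℂ → ℂ} (hf : MemBMO f) (hi : ∫⁻ z, ‖f z‖ₑ < ⊤) :
    bmoNormOn X f ≤ bmoSeminorm f + ∫⁻ z, ‖f z‖ₑ := by
  have hint : IntegrableOn f X volume :=
    Integrable.integrableOn ⟨hf.1.aestronglyMeasurable, hi⟩
  rw [bmoNormOn, if_pos hint]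
  refine add_le_add (iInf_le_of_le f (iInf₂_le hf fun _ _ => rfl)) ?_
  exact (enorm_integral_le_lintegral_enorm _).trans (setLIntegral_le_lintegral _ _)

/-- The unimodular function that turns the kernel `(ζ - x₀)⁻ᵏ` into its absolute value. -/
noncomputable def phase (x₀ : ℂ) (k : ℕ) (ζ : ℂ) : ℂ := ((ζ - x₀) / ‖ζ - x₀‖) ^ k

lemma measurable_phase (x₀ : ℂ) (k : ℕ) : Measurable (phase x₀ k) :=
  ((measurable_id.sub_const x₀).div
    (Complex.measurable_ofReal.comp (measurable_id.sub_const x₀).norm)).pow_const k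

lemma norm_phase_le (x₀ : ℂ) (k : ℕ) (ζ : ℂ) : ‖phase x₀ k ζ‖ ≤ 1 := by
  rw [phase, norm_pow, norm_div, Complex.norm_real, norm_norm]
  exact pow_le_one₀ (by positivity) (div_self_le_one _)

lemma phase_mul_inv_pow (x₀ : ℂ) (k : ℕ) (ζ : ℂ) :
    phase x₀ k ζ * (ζ - x₀)⁻¹ ^ k = ((‖ζ - x₀‖⁻¹ ^ k : ℝ) : ℂ) := by
  rcases eq_or_ne (ζ - x₀) 0 with h | h
  · rcases k with _ | k <;> simp [phase, h]
  · rw [phase, ← mul_pow, div_mul_eq_mul_div, mul_inv_cancel₀ h]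
    push_cast
    rw [one_div]

/-- The total masses of measures on the annuli, with the weights of the series, are bounded by the
derivative at `x₀` of a Cauchy transform. -/
lemma sum_le_enorm_integral {μ : ℕ → Measure ℂ} (hfin : ∀ n, IsFiniteMeasure (μ n)) {x₀ : ℂ}
    (hsupp : ∀ n, μ n (annulus x₀ (n + 1))ᶜ = 0) (t N : ℕ) :
    ∑ n ∈ Finset.range N, (2 : ℝ≥0∞) ^ ((t + 1) * (n + 1)) * μ n univ ≤
      ‖∫ ζ, phase x₀ (t + 1) ζ * (ζ - x₀)⁻¹ ^ (t + 1) ∂(∑ n ∈ Finset.range N, μ n)‖ₑ := by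
  have hae : ∀ n, ∀ᵐ ζ ∂(μ n), ζ ∈ annulus x₀ (n + 1) := fun n => by
    rw [ae_iff]; exact hsupp n
  have hm : Measurable fun ζ : ℂ => ‖ζ - x₀‖⁻¹ ^ (t + 1) :=
    (measurable_id.sub_const x₀).norm.inv.pow_const _
  have hint : Integrable (fun ζ : ℂ => ‖ζ - x₀‖⁻¹ ^ (t + 1)) (∑ n ∈ Finset.range N, μ n) := by
    refine integrable_finsetSum_measure.2 fun n _ => ?_
    refine Integrable.of_bound hm.aestronglyMeasurable (((2 : ℝ) ^ (n + 2)) ^ (t + 1))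
      ((hae n).mono fun ζ hζ => ?_)
    rw [norm_pow, norm_inv, norm_norm]
    gcongr
    exact inv_le_of_inv_le₀ (by positivity) hζ.1
  simp_rw [phase_mul_inv_pow]
  rw [integral_complex_ofReal, ← ofReal_norm, Complex.norm_real, Real.norm_of_nonneg
    (integral_nonneg fun ζ => by positivity), ofReal_integral_eq_lintegral_ofReal hint
    (ae_of_all _ fun ζ => by positivity), lintegral_finsetSum_measure]
  refine Finset.sum_le_sum fun n _ => ?_
  rw [← lintegral_const]
  refine lintegral_mono_ae ((hae n).mono fun ζ hζ => ?_)
  have hpos : 0 < ‖ζ - x₀‖ := lt_of_lt_of_le (by positivity) hζ.1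
  rw [← ENNReal.ofReal_ofNat 2, ← ENNReal.ofReal_pow (by norm_num)]
  refine ENNReal.ofReal_le_ofReal ?_
  rw [mul_comm, pow_mul]
  gcongr
  exact le_inv_of_le_inv₀ hpos hζ.2

/-- If `A₀(X)` admits a bounded point derivation, then the series of lower contents converges: the
derivation is tested on Cauchy transforms of Frostman measures on the sets `A_n \ X`, corrected in
such a way that they are integrable over the plane. -/
theorem tsum_lt_top_of_admitsBoundedPointDerivation {X : Set ℂ} (hX : MeasurableSet X) {x₀ : ℂ}
    {t : ℕ} (h : AdmitsBoundedPointDerivation X x₀ t) :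
    ∑' n : ℕ, (2 : ℝ≥0∞) ^ ((t + 1) * (n + 1)) * lowerContent (annulus x₀ (n + 1) \ X) < ⊤ := by
  obtain ⟨C, hC⟩ := h
  have hex := fun n => exists_frostman_measure_lowerContent_le (E := annulus x₀ (n + 1) \ X)
    ((measurableSet_annulus x₀ (n + 1)).diff hX)
    (sdiff_subset.trans (annulus_succ_subset_closedBall_half x₀ n))
  choose K hKE hK μ hfin hμK hM hgrow hsmall using hex
  by_cases hzero : ∀ n, μ n univ = 0
  · have : ∀ n, lowerContent (annulus x₀ (n + 1) \ X) = 0 := fun n => by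
      have := hM n
      rw [hzero n, mul_zero] at this
      exact le_antisymm this zero_le
    simp [this]
  push Not at hzero
  obtain ⟨n₁, hn₁⟩ := hzero
  have hsupp : ∀ n, μ n (annulus x₀ (n + 1))ᶜ = 0 := fun n =>
    measure_mono_null (compl_subset_compl.2 ((hKE n).trans sdiff_subset)) (hμK n)
  have hsupp' : ∀ n, μ n (Metric.closedBall x₀ (1 / 2))ᶜ = 0 := fun n =>
    measure_mono_null (compl_subset_compl.2 (annulus_succ_subset_closedBall_half x₀ n)) (hsupp n)
  have hx₀ : ∀ n, x₀ ∉ K n := by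
    intro n hn
    have h1 := (hKE n hn).1.1
    rw [sub_self, norm_zero] at h1
    exact absurd h1 (not_le.2 (by positivity))
  have hXK : ∀ n, X ∪ {x₀} ⊆ (K n)ᶜ := by
    rintro n z (hz | rfl)
    · exact fun hzK => (hKE n hzK).2 hz
    · exact hx₀ n
  have hatom : ∀ z, μ n₁ {z} = 0 := by
    intro z
    have hlim : Tendsto (fun r : ℝ => ENNReal.ofReal (36 * r)) (𝓝[>] 0) (𝓝 0) := by
      have : Tendsto (fun r : ℝ => ENNReal.ofReal (36 * r)) (𝓝 0) (𝓝 (ENNReal.ofReal (36 * 0))) :=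
        ENNReal.tendsto_ofReal (tendsto_id.const_mul 36)
      rw [mul_zero, ENNReal.ofReal_zero] at this
      exact this.mono_left nhdsWithin_le_nhds
    refine le_antisymm (ge_of_tendsto hlim ?_) zero_le
    filter_upwards [self_mem_nhdsWithin] with r hr
    exact (measure_mono (singleton_subset_iff.2 (Metric.mem_closedBall_self (le_of_lt hr)))).trans
      (hgrow n₁ z r hr)
  obtain ⟨D, hD, hmom⟩ := exists_density_of_moments (hsupp' n₁) hn₁ hatom
  set V : ℝ := D * 720 + 1 with hVdef
  have hV0 : 0 < V := by positivity
  set I₃ : ℝ≥0∞ := ENNReal.ofReal (2 * Real.pi) + volume (Metric.closedBall x₀ 1) +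
    ∫⁻ z in (Metric.closedBall x₀ 1)ᶜ, ENNReal.ofReal (‖z - x₀‖⁻¹ ^ 3) with hI₃
  have hI₃top : I₃ ≠ ⊤ := by
    have h1 : volume (Metric.closedBall x₀ 1) < ⊤ := (isCompact_closedBall x₀ 1).measure_lt_top
    have h2 := lintegral_inv_pow_three_lt_top x₀
    finiteness
  set W : ℝ := (t.factorial : ℝ) * (V * (2 ^ (n₁ + 2)) ^ (t + 1) * (μ n₁).real univ) with hW
  set B : ℝ≥0∞ := C * (ENNReal.ofReal (120 * 1 * 720) + ENNReal.ofReal (120 * V * 36) +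
    I₃ * ENNReal.ofReal (1 * 360 + V * (μ n₁).real univ)) + ENNReal.ofReal W with hB
  have hBtop : 18 * B < ⊤ := by finiteness
  refine lt_of_le_of_lt (ENNReal.tsum_le_of_sum_range_le fun N => ?_) hBtop
  set lam : Measure ℂ := ∑ n ∈ Finset.range N, μ n with hlam
  have hlamgrow : ∀ z r, 0 < r → lam (Metric.closedBall z r) ≤ ENNReal.ofReal (720 * r) :=
    fun z r hr => sum_measure_closedBall_le hsupp hgrow N z hr
  have hlamsupp : lam (Metric.closedBall x₀ (1 / 2))ᶜ = 0 := by
    rw [hlam, Measure.finsetSum_apply]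
    exact Finset.sum_eq_zero fun n _ => hsupp' n
  have hlamuniv : lam univ ≤ ENNReal.ofReal 360 := by
    refine (measure_univ_le_of_closedBall hlamsupp).trans
      ((hlamgrow x₀ (1 / 2) (by norm_num)).trans (le_of_eq (by norm_num)))
  have hlamfin : IsFiniteMeasure lam := ⟨hlamuniv.trans_lt ENNReal.ofReal_lt_top⟩
  have hlamreal : lam.real univ ≤ 360 := ENNReal.toReal_le_of_le_ofReal (by norm_num) hlamuniv
  set L : Set ℂ := ⋃ n ∈ Finset.range N, K n with hL
  have hLc : IsClosed L := (Finset.isCompact_biUnion _ fun n _ => hK n).isClosed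
  have hlamL : lam Lᶜ = 0 := by
    rw [hlam, Measure.finsetSum_apply]
    refine Finset.sum_eq_zero fun n hn => measure_mono_null (compl_subset_compl.2 ?_) (hμK n)
    exact subset_biUnion_of_mem (u := K) hn
  have hXL : X ∪ {x₀} ⊆ Lᶜ := by
    intro z hz hzL
    obtain ⟨n, _, hzn⟩ := mem_iUnion₂.1 hzL
    exact hXK n hz hzn
  set u := phase x₀ (t + 1)
  have hu : Measurable u := measurable_phase x₀ (t + 1)
  have hu1 : ∀ ζ, ‖u ζ‖ ≤ 1 := norm_phase_le x₀ (t + 1)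
  have hm0 : ‖∫ ζ, u ζ ∂lam‖ ≤ 360 := by
    refine (norm_integral_le_of_norm_le_const (ae_of_all _ hu1)).trans ?_
    rwa [one_mul]
  have hm1 : ‖∫ ζ, u ζ * (ζ - x₀) ∂lam‖ ≤ 360 := by
    have hae : ∀ᵐ ζ ∂lam, ζ ∈ Metric.closedBall x₀ (1 / 2) := by rw [ae_iff]; exact hlamsupp
    refine (norm_integral_le_of_norm_le_const (C := 1 * 1) (hae.mono fun ζ hζ => ?_)).trans
      (by rwa [one_mul, one_mul])
    rw [Metric.mem_closedBall, dist_eq_norm] at hζ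
    rw [norm_mul]
    gcongr
    · exact hu1 ζ
    · linarith
  obtain ⟨g, hg, hgb, hg0, hg1⟩ := hmom (∫ ζ, u ζ ∂lam) (∫ ζ, u ζ * (ζ - x₀) ∂lam)
  have hgV : ∀ ζ, ‖g ζ‖ ≤ V := by
    intro ζ
    refine (hgb ζ).trans ?_
    have : D * (‖∫ ζ, u ζ ∂lam‖ + ‖∫ ζ, u ζ * (ζ - x₀) ∂lam‖) ≤ D * 720 := by
      gcongr
      linarith
    linarith
  set f₁ := cauchyTransform lam u
  set f₂ := cauchyTransform (μ n₁) g
  have hf₁ : MemVMO f₁ := memVMO_cauchyTransform lam hu hu1 (by norm_num) hlamgrow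
    (SmallGrowth.sum hsmall _)
  have hf₂ : MemVMO f₂ := memVMO_cauchyTransform (μ n₁) hg hgV (by norm_num) (hgrow n₁) (hsmall n₁)
  have ha₁ : AnalyticOnNhd ℂ f₁ Lᶜ := analyticOnNhd_cauchyTransform hLc hlamL hu hu1
  have ha₂ : AnalyticOnNhd ℂ f₂ (K n₁)ᶜ :=
    analyticOnNhd_cauchyTransform (hK n₁).isClosed (hμK n₁) hg hgV
  have hx₀' : x₀ ∈ X ∪ {x₀} := Or.inr rfl
  have hderiv : iteratedDeriv t (fun z => f₁ z - f₂ z) x₀ =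
      (t.factorial : ℂ) * (∫ ζ, u ζ * (ζ - x₀)⁻¹ ^ (t + 1) ∂lam) -
        (t.factorial : ℂ) * ∫ ζ, g ζ * (ζ - x₀)⁻¹ ^ (t + 1) ∂(μ n₁) := by
    rw [iteratedDeriv_fun_sub (ha₁ x₀ (hXL hx₀')).contDiffAt (ha₂ x₀ (hXK n₁ hx₀')).contDiffAt,
      iteratedDeriv_cauchyTransform hLc hlamL hu hu1 t (hXL hx₀'),
      iteratedDeriv_cauchyTransform (hK n₁).isClosed (hμK n₁) hg hgV t (hXK n₁ hx₀')]
  have hL1 : ∫⁻ z, ‖f₁ z - f₂ z‖ₑ ≤ I₃ * ENNReal.ofReal (1 * 360 + V * (μ n₁).real univ) := by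
    refine (lintegral_cauchyTransform_sub_le hlamsupp (hsupp' n₁) hu hu1 hg hgV hg0.symm
      hg1.symm).trans ?_
    gcongr
  have hbmo : bmoSeminorm (fun z => f₁ z - f₂ z) ≤
      ENNReal.ofReal (120 * 1 * 720) + ENNReal.ofReal (120 * V * 36) :=
    (bmoSeminorm_sub_le hf₁.1.1 hf₂.1.1).trans (add_le_add
      (bmoSeminorm_cauchyTransform_le lam hu hu1 one_pos (by norm_num) hlamgrow)
      (bmoSeminorm_cauchyTransform_le (μ n₁) hg hgV hV0 (by norm_num) (hgrow n₁)))
  have hmain : ‖iteratedDeriv t (fun z => f₁ z - f₂ z) x₀‖ₑ ≤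
      C * (ENNReal.ofReal (120 * 1 * 720) + ENNReal.ofReal (120 * V * 36) +
        I₃ * ENNReal.ofReal (1 * 360 + V * (μ n₁).real univ)) := by
    refine (hC _ (hf₁.sub hf₂) fun z hz => (ha₁ z (hXL hz)).sub (ha₂ z (hXK n₁ hz))).trans ?_
    gcongr
    refine (bmoNormOn_le (hf₁.sub hf₂).1 (hL1.trans_lt ?_)).trans (add_le_add hbmo hL1)
    finiteness
  have hI₂ : ‖(t.factorial : ℂ) * ∫ ζ, g ζ * (ζ - x₀)⁻¹ ^ (t + 1) ∂(μ n₁)‖ₑ ≤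
      ENNReal.ofReal W := by
    rw [← ofReal_norm, norm_mul, Complex.norm_natCast, hW]
    refine ENNReal.ofReal_le_ofReal ?_
    gcongr
    have hae : ∀ᵐ ζ ∂(μ n₁), ζ ∈ annulus x₀ (n₁ + 1) := by rw [ae_iff]; exact hsupp n₁
    refine norm_integral_le_of_norm_le_const (hae.mono fun ζ hζ => ?_)
    rw [norm_mul, norm_pow, norm_inv]
    gcongr
    · exact hgV ζ
    · exact inv_le_of_inv_le₀ (by positivity) hζ.1
  calc ∑ n ∈ Finset.range N, (2 : ℝ≥0∞) ^ ((t + 1) * (n + 1)) *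
        lowerContent (annulus x₀ (n + 1) \ X)
      ≤ ∑ n ∈ Finset.range N, 18 * ((2 : ℝ≥0∞) ^ ((t + 1) * (n + 1)) * μ n univ) := by
        refine Finset.sum_le_sum fun n _ => ?_
        rw [mul_left_comm]
        gcongr
        exact hM n
    _ = 18 * ∑ n ∈ Finset.range N, (2 : ℝ≥0∞) ^ ((t + 1) * (n + 1)) * μ n univ := by
        rw [Finset.mul_sum]
    _ ≤ 18 * B := by
        gcongr
        refine (sum_le_enorm_integral hfin hsupp t N).trans ?_
        have hfac : ‖∫ ζ, u ζ * (ζ - x₀)⁻¹ ^ (t + 1) ∂lam‖ₑ ≤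
            ‖(t.factorial : ℂ) * ∫ ζ, u ζ * (ζ - x₀)⁻¹ ^ (t + 1) ∂lam‖ₑ := by
          rw [← ofReal_norm, ← ofReal_norm, norm_mul, Complex.norm_natCast]
          refine ENNReal.ofReal_le_ofReal (le_mul_of_one_le_left (norm_nonneg _) ?_)
          exact_mod_cast Nat.factorial_pos t
        refine hfac.trans ?_
        have e : (t.factorial : ℂ) * ∫ ζ, u ζ * (ζ - x₀)⁻¹ ^ (t + 1) ∂lam =
            iteratedDeriv t (fun z => f₁ z - f₂ z) x₀ +
              (t.factorial : ℂ) * ∫ ζ, g ζ * (ζ - x₀)⁻¹ ^ (t + 1) ∂(μ n₁) := by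
          rw [hderiv]; ring
        rw [e]
        exact (enorm_add_le _ _).trans (add_le_add hmain hI₂)

/-! ### The operator `∂/∂x + i ∂/∂y` on test functions -/

/-- Twice the Cauchy-Riemann operator: `∂φ/∂x + i ∂φ/∂y`. -/
noncomputable def dbar (φ : ℂ → ℂ) (z : ℂ) : ℂ := fderiv ℝ φ z 1 + Complex.I * fderiv ℝ φ z Complex.I

lemma dbar_mul {φ ψ : ℂ → ℂ} {z : ℂ} (hφ : DifferentiableAt ℝ φ z) (hψ : DifferentiableAt ℝ ψ z) :
    dbar (fun w => φ w * ψ w) z = φ z * dbar ψ z + ψ z * dbar φ z := by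
  simp only [dbar]
  rw [fderiv_fun_mul hφ hψ]
  simp only [add_apply, smul_apply, smul_eq_mul]
  ring

lemma dbar_sub {φ ψ : ℂ → ℂ} {z : ℂ} (hφ : DifferentiableAt ℝ φ z) (hψ : DifferentiableAt ℝ ψ z) :
    dbar (fun w => φ w - ψ w) z = dbar φ z - dbar ψ z := by
  simp only [dbar]
  rw [fderiv_fun_sub hφ hψ]
  simp only [sub_apply]
  ring

lemma dbar_const_sub (c : ℂ) (φ : ℂ → ℂ) (z : ℂ) : dbar (fun w => c - φ w) z = -dbar φ z := by
  simp only [dbar]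
  rw [fderiv_const_sub]
  simp only [neg_apply]
  ring

lemma dbar_eq_zero_of_differentiableAt {G : ℂ → ℂ} {z : ℂ} (hG : DifferentiableAt ℂ G z) :
    dbar G z = 0 := by
  have h := (hG.hasDerivAt.hasFDerivAt.restrictScalars ℝ).fderiv
  simp only [dbar, h, ContinuousLinearMap.coe_restrictScalars',
    ContinuousLinearMap.toSpanSingleton_apply, smul_eq_mul, one_mul]
  rw [← mul_assoc, Complex.I_mul_I]
  ring

lemma dbar_congr {φ ψ : ℂ → ℂ} {z : ℂ} (h : φ =ᶠ[𝓝 z] ψ) : dbar φ z = dbar ψ z := by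
  simp only [dbar, h.fderiv_eq]

lemma dbar_eq_zero_of_eventuallyEq_const {φ : ℂ → ℂ} {z c : ℂ} (h : φ =ᶠ[𝓝 z] fun _ => c) :
    dbar φ z = 0 := by
  rw [dbar_congr h, dbar_eq_zero_of_differentiableAt (differentiableAt_const c)]

lemma dbar_eq_zero_of_notMem_tsupport {φ : ℂ → ℂ} {z : ℂ} (h : z ∉ tsupport φ) : dbar φ z = 0 :=
  dbar_eq_zero_of_eventuallyEq_const (c := 0) (notMem_tsupport_iff_eventuallyEq.1 h)

lemma tsupport_dbar_subset (φ : ℂ → ℂ) : tsupport (dbar φ) ⊆ tsupport φ :=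
  closure_minimal (fun _ hz => by_contra fun h => hz (dbar_eq_zero_of_notMem_tsupport h))
    (isClosed_tsupport φ)

lemma continuous_dbar {φ : ℂ → ℂ} (hφ : ContDiff ℝ 1 φ) : Continuous (dbar φ) := by
  have h := hφ.continuous_fderiv (by norm_num)
  exact (h.clm_apply continuous_const).add (continuous_const.mul (h.clm_apply continuous_const))

lemma integral_dbar_eq_zero {φ : ℂ → ℂ} (hφ : ContDiff ℝ 1 φ) (hc : HasCompactSupport φ) :
    ∫ z, dbar φ z = 0 := by
  have hcont := hφ.continuous_fderiv (by norm_num)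
  have hint : ∀ v, Integrable (fun z => fderiv ℝ φ z v) := fun v =>
    (hcont.clm_apply continuous_const).integrable_of_hasCompactSupport (hc.fderiv_apply (𝕜 := ℝ) v)
  have h0 : ∀ v, ∫ z, fderiv ℝ φ z v = 0 := by
    intro v
    have h := integral_mul_fderiv_eq_neg_fderiv_mul_of_integrable (𝕜 := ℂ) (μ := (volume : Measure ℂ))
      (f := fun _ => (1 : ℂ)) (g := φ) (v := v) (by simp) (by simpa using hint v)
      (by simpa using hφ.continuous.integrable_of_hasCompactSupport hc)
      (fun z _ => differentiableAt_const _) (fun z _ => hφ.differentiable (by norm_num) z)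
    simpa using h
  simp only [dbar]
  rw [integral_add (hint 1) ((hint _).const_mul _), integral_const_mul, h0, h0]
  simp

lemma continuous_mul_of_tsupport_subset {φ G : ℂ → ℂ} {V : Set ℂ} (hφ : Continuous φ) (hV : IsOpen V)
    (hφV : tsupport φ ⊆ V) (hG : ContinuousOn G V) : Continuous fun z => φ z * G z := by
  refine continuous_of_tsupport fun z hz => ?_
  exact hφ.continuousAt.mul (hG.continuousAt (hV.mem_nhds
    (hφV (closure_mono (Function.support_mul_subset_left φ G) hz))))

lemma integrable_mul_of_tsupport_subset {φ G : ℂ → ℂ} {V : Set ℂ} (hφ : Continuous φ)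
    (hc : HasCompactSupport φ) (hV : IsOpen V) (hφV : tsupport φ ⊆ V) (hG : ContinuousOn G V) :
    Integrable fun z => φ z * G z :=
  (continuous_mul_of_tsupport_subset hφ hV hφV hG).integrable_of_hasCompactSupport hc.mul_right

/-- Holomorphic functions are annihilated by `dbar` in the weak sense. -/
lemma integral_dbar_mul_eq_zero {φ G : ℂ → ℂ} {V : Set ℂ} (hφ : ContDiff ℝ 1 φ)
    (hc : HasCompactSupport φ) (hV : IsOpen V) (hφV : tsupport φ ⊆ V) (hG : DifferentiableOn ℂ G V) :
    ∫ z, dbar φ z * G z = 0 := by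
  have hsmooth : ContDiff ℝ 1 fun z => φ z * G z := by
    refine contDiff_iff_contDiffAt.2 fun z => ?_
    by_cases hz : z ∈ tsupport φ
    · exact hφ.contDiffAt.mul
        (((hG.analyticAt (hV.mem_nhds (hφV hz))).contDiffAt).restrict_scalars ℝ)
    · refine (contDiffAt_const (c := (0 : ℂ))).congr_of_eventuallyEq ?_
      filter_upwards [notMem_tsupport_iff_eventuallyEq.1 hz] with w hw
      rw [hw, Pi.zero_apply, zero_mul]
  rw [← integral_dbar_eq_zero hsmooth hc.mul_right]
  refine integral_congr_ae (Eventually.of_forall fun z => ?_)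
  by_cases hz : z ∈ tsupport φ
  · have hGz := hG.differentiableAt (hV.mem_nhds (hφV hz))
    simp only
    rw [dbar_mul (hφ.differentiable (by norm_num) z) (hGz.restrictScalars ℝ),
      dbar_eq_zero_of_differentiableAt hGz]
    ring
  · have h1 : z ∉ tsupport fun z => φ z * G z := fun h =>
      hz (closure_mono (Function.support_mul_subset_left φ G) h)
    simp only
    rw [dbar_eq_zero_of_notMem_tsupport hz, dbar_eq_zero_of_notMem_tsupport h1, zero_mul]

/-! ### Cauchy's formula for derivatives, with a smooth cutoff -/

lemma dbar_radial {ρ : ℝ → ℝ} {ρ' : ℝ} {x₀ w : ℂ} (h : HasDerivAt ρ ρ' (‖w‖ ^ 2)) :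
    dbar (fun z => (ρ (‖z - x₀‖ ^ 2) : ℂ)) (x₀ + w) = 2 * ρ' * w := by
  have h1 : HasFDerivAt (fun z : ℂ => ‖z - x₀‖ ^ 2) (2 • innerSL ℝ w) (x₀ + w) := by
    have := ((hasStrictFDerivAt_norm_sq w).hasFDerivAt)
    have h2 : HasFDerivAt (fun z : ℂ => z - x₀) (ContinuousLinearMap.id ℝ ℂ) (x₀ + w) :=
      (hasFDerivAt_id _).sub_const x₀
    have h3 : HasFDerivAt (fun z : ℂ => ‖z‖ ^ 2) (2 • innerSL ℝ w) ((x₀ + w) - x₀) := by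
      rwa [add_sub_cancel_left]
    exact h3.comp (x₀ + w) h2
  have h4 : HasDerivAt ρ ρ' (‖(x₀ + w) - x₀‖ ^ 2) := by rwa [add_sub_cancel_left]
  have h5 := Complex.ofRealCLM.hasFDerivAt.comp (x₀ + w)
    (HasDerivAt.comp_hasFDerivAt (f := fun z : ℂ => ‖z - x₀‖ ^ 2) (x₀ + w) h4 h1)
  have h6 : fderiv ℝ (fun z => (ρ (‖z - x₀‖ ^ 2) : ℂ)) (x₀ + w) = _ := h5.fderiv
  rw [dbar, h6]
  apply Complex.ext <;>
    simp [Complex.inner, two_mul] <;> ring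

lemma integral_circle_mul_inv_pow {f : ℂ → ℂ} {x₀ : ℂ} {r : ℝ} (hr : 0 < r) (t : ℕ)
    (hf : DifferentiableOn ℂ f (Metric.closedBall x₀ r)) :
    ∫ θ in Ioo (-Real.pi) Real.pi, (r * (Real.cos θ + Real.sin θ * Complex.I)) *
      (f (x₀ + r * (Real.cos θ + Real.sin θ * Complex.I)) *
        (r * (Real.cos θ + Real.sin θ * Complex.I) : ℂ)⁻¹ ^ (t + 1)) =
      2 * Real.pi / t.factorial * iteratedDeriv t f x₀ := by
  have hexp : ∀ θ : ℝ, (r * (Real.cos θ + Real.sin θ * Complex.I) : ℂ) =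
      r * Complex.exp (θ * Complex.I) := by
    intro θ
    rw [Complex.exp_mul_I, Complex.ofReal_cos, Complex.ofReal_sin]
  simp only [hexp]
  have h1 := DifferentiableOn.circleIntegral_one_div_sub_center_pow_smul hr t hf
  rw [circleIntegral] at h1
  set u : ℝ → ℂ := fun θ => (r * Complex.exp (θ * Complex.I)) *
      (f (x₀ + r * Complex.exp (θ * Complex.I)) * (r * Complex.exp (θ * Complex.I) : ℂ)⁻¹ ^ (t + 1))
    with hu
  have hper : Function.Periodic u (2 * Real.pi) := by
    intro θ
    have : Complex.exp (((θ + 2 * Real.pi : ℝ) : ℂ) * Complex.I) = Complex.exp (θ * Complex.I) := by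
      push_cast
      rw [add_mul, Complex.exp_add, Complex.exp_two_pi_mul_I, mul_one]
    simp only [hu, this]
  have h2 : ∫ θ in Ioo (-Real.pi) Real.pi, u θ = ∫ θ in (0 : ℝ)..2 * Real.pi, u θ := by
    rw [← integral_Ioc_eq_integral_Ioo, ← intervalIntegral.integral_of_le (by linarith [Real.pi_pos])]
    have := hper.intervalIntegral_add_eq (-Real.pi) 0
    rw [zero_add] at this
    rw [← this]
    congr 1
    ring
  rw [h2]
  have h3 : ∀ θ : ℝ, deriv (circleMap x₀ r) θ • (1 / (circleMap x₀ r θ - x₀) ^ (t + 1)) •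
      f (circleMap x₀ r θ) = Complex.I * u θ := by
    intro θ
    simp only [deriv_circleMap, hu, circleMap, smul_eq_mul, zero_add, add_sub_cancel_left, one_div,
      inv_pow]
    ring
  simp only [h3] at h1
  rw [intervalIntegral.integral_const_mul] at h1
  have h4 : (∫ θ in (0 : ℝ)..2 * Real.pi, u θ) =
      -Complex.I * (Complex.I * ∫ θ in (0 : ℝ)..2 * Real.pi, u θ) := by
    rw [← mul_assoc, neg_mul, Complex.I_mul_I]; ring
  rw [h4, h1, smul_eq_mul]
  linear_combination (-(2 * Real.pi / t.factorial * iteratedDeriv t f x₀)) * Complex.I_sq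

/-- A smooth radial cutoff: it equals `1` on the disc of radius `R / √2` about `c`, and is supported
in the disc of radius `R`. -/
noncomputable def bump (c : ℂ) (R : ℝ) (z : ℂ) : ℂ :=
  (Real.smoothTransition (2 - 2 * (R ^ 2)⁻¹ * ‖z - c‖ ^ 2) : ℝ)

lemma contDiff_bump (c : ℂ) (R : ℝ) : ContDiff ℝ 1 (bump c R) := by
  have h1 : ContDiff ℝ 1 fun z : ℂ => ‖z - c‖ ^ 2 := (contDiff_id.sub contDiff_const).norm_sq ℝ
  have h2 : ContDiff ℝ 1 Real.smoothTransition := Real.smoothTransition.contDiff (n := 1)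
  exact Complex.ofRealCLM.contDiff.comp (h2.comp (contDiff_const.sub (contDiff_const.mul h1)))

lemma bump_eq_one {c : ℂ} {R : ℝ} (hR : 0 < R) {z : ℂ} (hz : 2 * ‖z - c‖ ^ 2 ≤ R ^ 2) :
    bump c R z = 1 := by
  rw [bump, Real.smoothTransition.one_of_one_le, Complex.ofReal_one]
  have : 2 * (R ^ 2)⁻¹ * ‖z - c‖ ^ 2 ≤ 1 := by
    rw [mul_right_comm, ← div_eq_mul_inv]
    exact div_le_one_of_le₀ hz (by positivity)
  linarith

lemma bump_eq_zero {c : ℂ} {R : ℝ} (hR : 0 < R) {z : ℂ} (hz : R ≤ ‖z - c‖) : bump c R z = 0 := by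
  rw [bump, Real.smoothTransition.zero_of_nonpos, Complex.ofReal_zero]
  have : 1 ≤ (R ^ 2)⁻¹ * ‖z - c‖ ^ 2 := by
    rw [inv_mul_eq_div, one_le_div (by positivity)]
    gcongr
  linarith

lemma tsupport_bump_subset {c : ℂ} {R : ℝ} (hR : 0 < R) :
    tsupport (bump c R) ⊆ Metric.closedBall c R := by
  refine closure_minimal (fun z hz => ?_) Metric.isClosed_closedBall
  by_contra h
  rw [Metric.mem_closedBall, dist_eq_norm, not_le] at h
  exact hz (bump_eq_zero hR h.le)

lemma hasCompactSupport_bump {c : ℂ} {R : ℝ} (hR : 0 < R) : HasCompactSupport (bump c R) :=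
  (isCompact_closedBall c R).of_isClosed_subset (isClosed_tsupport _) (tsupport_bump_subset hR)

lemma norm_bump_le_one (c : ℂ) (R : ℝ) (z : ℂ) : ‖bump c R z‖ ≤ 1 := by
  rw [bump, Complex.norm_real, Real.norm_of_nonneg (Real.smoothTransition.nonneg _)]
  exact Real.smoothTransition.le_one _

lemma norm_one_sub_bump_le_one (c : ℂ) (R : ℝ) (z : ℂ) : ‖1 - bump c R z‖ ≤ 1 := by
  rw [bump, ← Complex.ofReal_one, ← Complex.ofReal_sub, Complex.norm_real,
    Real.norm_of_nonneg (sub_nonneg.2 (Real.smoothTransition.le_one _))]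
  linarith [Real.smoothTransition.nonneg (2 - 2 * (R ^ 2)⁻¹ * ‖z - c‖ ^ 2)]

lemma hasDerivAt_bump_profile (R s : ℝ) :
    HasDerivAt (fun s => Real.smoothTransition (2 - 2 * (R ^ 2)⁻¹ * s))
      (-(2 * (R ^ 2)⁻¹) * deriv Real.smoothTransition (2 - 2 * (R ^ 2)⁻¹ * s)) s := by
  have h1 : HasDerivAt (fun s => 2 - 2 * (R ^ 2)⁻¹ * s) (-(2 * (R ^ 2)⁻¹)) s := by
    have := ((hasDerivAt_id s).const_mul (2 * (R ^ 2)⁻¹)).const_sub 2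
    rwa [mul_one] at this
  have h2 : HasDerivAt Real.smoothTransition
      (deriv Real.smoothTransition (2 - 2 * (R ^ 2)⁻¹ * s)) (2 - 2 * (R ^ 2)⁻¹ * s) :=
    ((Real.smoothTransition.contDiff (n := 1)).differentiable (by norm_num) _).hasDerivAt
  exact (h2.comp s h1).congr_deriv (mul_comm _ _)

lemma dbar_bump (c : ℂ) (R : ℝ) (w : ℂ) : dbar (bump c R) (c + w) =
    2 * ((-(2 * (R ^ 2)⁻¹) * deriv Real.smoothTransition (2 - 2 * (R ^ 2)⁻¹ * ‖w‖ ^ 2) : ℝ) : ℂ) * w :=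
  dbar_radial (hasDerivAt_bump_profile R (‖w‖ ^ 2))

lemma exists_norm_dbar_bump_le :
    ∃ B : ℝ, 1 ≤ B ∧ ∀ (c : ℂ) (R : ℝ) (z : ℂ), 0 < R → ‖dbar (bump c R) z‖ ≤ B / R := by
  have hd : ContDiff ℝ 1 Real.smoothTransition := Real.smoothTransition.contDiff (n := 1)
  obtain ⟨B, hB⟩ := (isCompact_Icc (a := (0 : ℝ)) (b := 2)).exists_bound_of_continuousOn
    (hd.continuous_deriv (by norm_num)).continuousOn
  refine ⟨max 1 (4 * B), le_max_left _ _, fun c R z hR => ?_⟩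
  by_cases hz : z ∈ tsupport (bump c R)
  · have hzR := tsupport_bump_subset hR hz
    rw [Metric.mem_closedBall, dist_eq_norm] at hzR
    have h1 : (R ^ 2)⁻¹ * ‖z - c‖ ^ 2 ≤ 1 := by
      rw [inv_mul_eq_div, div_le_one (by positivity)]
      gcongr
    have h2 : 0 ≤ (R ^ 2)⁻¹ * ‖z - c‖ ^ 2 := by positivity
    have h3 := hB (2 - 2 * (R ^ 2)⁻¹ * ‖z - c‖ ^ 2) ⟨by linarith, by linarith⟩
    have h4 : 0 ≤ B := (norm_nonneg _).trans h3
    have h5 := dbar_bump c R (z - c)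
    rw [add_sub_cancel] at h5
    rw [h5, norm_mul, norm_mul, Complex.norm_real, norm_mul, norm_neg, norm_mul, norm_inv,
      norm_pow, Real.norm_of_nonneg hR.le]
    simp only [Complex.norm_ofNat, Real.norm_ofNat]
    calc 2 * (2 * (R ^ 2)⁻¹ * ‖deriv Real.smoothTransition (2 - 2 * (R ^ 2)⁻¹ * ‖z - c‖ ^ 2)‖) *
          ‖z - c‖ ≤ 2 * (2 * (R ^ 2)⁻¹ * B) * R := by gcongr
      _ = 4 * B / R := by field_simp; ring
      _ ≤ _ := by gcongr; exact le_max_right _ _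
  · rw [dbar_eq_zero_of_notMem_tsupport hz, norm_zero]
    positivity

lemma bump_eventuallyEq_one {c : ℂ} {R : ℝ} (hR : 0 < R) : bump c R =ᶠ[𝓝 c] fun _ => 1 := by
  filter_upwards [Metric.ball_mem_nhds c (half_pos hR)] with z hz
  rw [Metric.mem_ball, dist_eq_norm] at hz
  exact bump_eq_one hR (by nlinarith [norm_nonneg (z - c)])

lemma integral_profile {R : ℝ} (hR : 0 < R) :
    ∫ r in Ioi (0 : ℝ), 2 * r *
      (-(2 * (R ^ 2)⁻¹) * deriv Real.smoothTransition (2 - 2 * (R ^ 2)⁻¹ * r ^ 2)) = -1 := by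
  set u : ℝ → ℝ := fun r => 2 * r *
      (-(2 * (R ^ 2)⁻¹) * deriv Real.smoothTransition (2 - 2 * (R ^ 2)⁻¹ * r ^ 2)) with hu
  have hder : ∀ r, HasDerivAt (fun r => Real.smoothTransition (2 - 2 * (R ^ 2)⁻¹ * r ^ 2)) (u r) r := by
    intro r
    have h1 := (hasDerivAt_bump_profile R (r ^ 2)).comp r (hasDerivAt_pow 2 r)
    refine h1.congr_deriv ?_
    simp only [hu]
    push_cast
    ring
  have hcont : Continuous u := by
    have h1 : Continuous (deriv Real.smoothTransition) :=
      (Real.smoothTransition.contDiff (n := 1)).continuous_deriv (by norm_num)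
    have h2 : Continuous fun r : ℝ => 2 - 2 * (R ^ 2)⁻¹ * r ^ 2 := by fun_prop
    have := h1.comp h2
    exact (continuous_const.mul continuous_id).mul (continuous_const.mul this)
  have hzero : ∀ r, R < r → u r = 0 := by
    intro r hr
    refine (hder r).unique ((hasDerivAt_const r (0 : ℝ)).congr_of_eventuallyEq ?_)
    filter_upwards [lt_mem_nhds hr] with s hs
    rw [Real.smoothTransition.zero_of_nonpos]
    have : 1 ≤ (R ^ 2)⁻¹ * s ^ 2 := by
      rw [inv_mul_eq_div, one_le_div (by positivity)]
      gcongr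
    linarith
  have h1 : ∫ r in Ioi (0 : ℝ), u r = ∫ r in Ioc 0 R, u r := by
    refine setIntegral_eq_of_subset_of_forall_sdiff_eq_zero measurableSet_Ioi Ioc_subset_Ioi_self ?_
    intro r hr
    exact hzero r (not_le.1 fun h => hr.2 ⟨hr.1, h⟩)
  rw [h1, ← intervalIntegral.integral_of_le hR.le,
    intervalIntegral.integral_eq_sub_of_hasDerivAt (fun r _ => hder r) (hcont.intervalIntegrable _ _),
    Real.smoothTransition.zero_of_nonpos, Real.smoothTransition.one_of_one_le]
  · norm_num
  · norm_num
  · rw [mul_assoc, inv_mul_cancel₀ (by positivity)]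
    norm_num

lemma integral_dbar_bump_mul_cauchyKernel {f : ℂ → ℂ} {x₀ : ℂ} {R : ℝ} (hR : 0 < R) (t : ℕ)
    (hf : DifferentiableOn ℂ f (Metric.closedBall x₀ R)) :
    ∫ z, dbar (bump x₀ R) z * (f z * (z - x₀)⁻¹ ^ (t + 1)) =
      -(2 * Real.pi / t.factorial * iteratedDeriv t f x₀) := by
  rw [← integral_add_left_eq_self (μ := (volume : Measure ℂ))
    (fun z => dbar (bump x₀ R) z * (f z * (z - x₀)⁻¹ ^ (t + 1))) x₀]
  rw [← Complex.integral_comp_polarCoord_symm]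
  set e : ℝ → ℂ := fun θ => Real.cos θ + Real.sin θ * Complex.I with he
  set p : ℝ → ℝ := fun r =>
    2 * r * (-(2 * (R ^ 2)⁻¹) * deriv Real.smoothTransition (2 - 2 * (R ^ 2)⁻¹ * r ^ 2)) with hp
  have hnorm : ∀ r θ : ℝ, ‖(r * e θ : ℂ)‖ ^ 2 = r ^ 2 := by
    intro r θ
    have := Complex.norm_polarCoord_symm (r, θ)
    rw [Complex.polarCoord_symm_apply] at this
    simp only [he]
    rw [this, sq_abs]
  set F : ℝ × ℝ → ℂ := fun q => (p q.1 : ℂ) * ((q.1 * e q.2) * (f (x₀ + q.1 * e q.2) *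
    (q.1 * e q.2 : ℂ)⁻¹ ^ (t + 1))) with hF
  have hFeq : ∀ q : ℝ × ℝ, q.1 • (dbar (bump x₀ R) (x₀ + Complex.polarCoord.symm q) *
      (f (x₀ + Complex.polarCoord.symm q) * (x₀ + Complex.polarCoord.symm q - x₀)⁻¹ ^ (t + 1))) =
      F q := by
    intro q
    rw [dbar_bump, Complex.polarCoord_symm_apply, add_sub_cancel_left]
    have := hnorm q.1 q.2
    simp only [he] at this
    rw [this]
    simp only [hF, hp, he, Complex.real_smul]
    push_cast
    ring
  simp only [hFeq]
  have hzero : ∀ r : ℝ, 0 ≤ r → (r < R / 2 ∨ R < r) → p r = 0 := by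
    intro r hr0 hr
    have h1 : deriv Real.smoothTransition (2 - 2 * (R ^ 2)⁻¹ * r ^ 2) = 0 := by
      rcases hr with hr | hr
      · have h2 : Real.smoothTransition =ᶠ[𝓝 (2 - 2 * (R ^ 2)⁻¹ * r ^ 2)] fun _ => 1 := by
          have : (R ^ 2)⁻¹ * r ^ 2 ≤ 1 / 4 := by
            rw [inv_mul_eq_div, div_le_iff₀ (by positivity)]
            nlinarith
          filter_upwards [lt_mem_nhds (show 1 < 2 - 2 * (R ^ 2)⁻¹ * r ^ 2 by linarith)] with s hs
          exact Real.smoothTransition.one_of_one_le hs.le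
        rw [h2.deriv_eq, deriv_const]
      · have h2 : Real.smoothTransition =ᶠ[𝓝 (2 - 2 * (R ^ 2)⁻¹ * r ^ 2)] fun _ => 0 := by
          have : 1 < (R ^ 2)⁻¹ * r ^ 2 := by
            rw [inv_mul_eq_div, one_lt_div (by positivity)]
            gcongr
          filter_upwards [gt_mem_nhds (show 2 - 2 * (R ^ 2)⁻¹ * r ^ 2 < 0 by linarith)] with s hs
          exact Real.smoothTransition.zero_of_nonpos hs.le
        rw [h2.deriv_eq, deriv_const]
    simp only [hp, h1]
    ring
  have hpc : Continuous p := by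
    have h1 : Continuous (deriv Real.smoothTransition) :=
      (Real.smoothTransition.contDiff (n := 1)).continuous_deriv (by norm_num)
    have h2 : Continuous fun r : ℝ => 2 - 2 * (R ^ 2)⁻¹ * r ^ 2 := by fun_prop
    have := h1.comp h2
    exact (continuous_const.mul continuous_id).mul (continuous_const.mul this)
  have hec : Continuous e := by simp only [he]; fun_prop
  have hene : ∀ θ, e θ ≠ 0 := by
    intro θ h
    have := hnorm 1 θ
    rw [h] at this
    norm_num at this
  have hFc : ContinuousOn F (Icc (R / 2) R ×ˢ Icc (-Real.pi) Real.pi) := by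
    have hq : Continuous fun q : ℝ × ℝ => (q.1 : ℂ) * e q.2 :=
      (Complex.continuous_ofReal.comp continuous_fst).mul (hec.comp continuous_snd)
    have h1 : ContinuousOn (fun q : ℝ × ℝ => f (x₀ + q.1 * e q.2))
        (Icc (R / 2) R ×ˢ Icc (-Real.pi) Real.pi) := by
      refine hf.continuousOn.comp (continuous_const.add hq).continuousOn fun q hq => ?_
      rw [Metric.mem_closedBall, dist_eq_norm, add_sub_cancel_left]
      have h2 := hnorm q.1 q.2
      have h3 : 0 ≤ q.1 := (half_pos hR).le.trans hq.1.1
      rw [pow_left_inj₀ (norm_nonneg _) h3 (by norm_num)] at h2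
      rw [h2]
      exact hq.1.2
    refine ((Complex.continuous_ofReal.comp (hpc.comp continuous_fst)).continuousOn).mul
      (hq.continuousOn.mul (h1.mul ((hq.continuousOn.inv₀ fun q hq => ?_).pow _)))
    exact mul_ne_zero (by exact_mod_cast ((half_pos hR).trans_le hq.1.1).ne') (hene _)
  have hFint : IntegrableOn F (Ioi 0 ×ˢ Ioo (-Real.pi) Real.pi) := by
    refine ((hFc.integrableOn_compact (isCompact_Icc.prod isCompact_Icc))).of_forall_sdiff_eq_zero
      (measurableSet_Ioi.prod measurableSet_Ioo) fun q hq => ?_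
    have hq1 : q.1 < R / 2 ∨ R < q.1 := by
      by_contra! h
      exact hq.2 ⟨h, Ioo_subset_Icc_self hq.1.2⟩
    simp only [hF, hzero q.1 (le_of_lt hq.1.1) hq1, Complex.ofReal_zero, zero_mul]
  rw [polarCoord_target, Measure.volume_eq_prod, setIntegral_prod F hFint]
  have hinner : ∀ r ∈ Ioi (0 : ℝ), ∫ θ in Ioo (-Real.pi) Real.pi, F (r, θ) =
      (p r : ℂ) * (2 * Real.pi / t.factorial * iteratedDeriv t f x₀) := by
    intro r hr
    simp only [hF]
    rw [integral_const_mul]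
    rcases le_or_gt r R with hrR | hrR
    · rw [← integral_circle_mul_inv_pow hr t (hf.mono (Metric.closedBall_subset_closedBall hrR))]
    · rw [hzero r (le_of_lt hr) (Or.inr hrR)]
      simp
  rw [setIntegral_congr_fun measurableSet_Ioi hinner, integral_mul_const, integral_complex_ofReal,
    integral_profile hR]
  simp

/-- Cauchy's formula for the derivatives of a holomorphic function, with a smooth cutoff in place of
a contour. -/
theorem integral_dbar_mul_cauchyKernel {χ f : ℂ → ℂ} {x₀ : ℂ} {V : Set ℂ} (t : ℕ)
    (hχ : ContDiff ℝ 1 χ) (hc : HasCompactSupport χ) (h1 : χ =ᶠ[𝓝 x₀] fun _ => 1) (hV : IsOpen V)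
    (hχV : tsupport χ ⊆ V) (hf : DifferentiableOn ℂ f V) :
    ∫ z, dbar χ z * (f z * (z - x₀)⁻¹ ^ (t + 1)) =
      -(2 * Real.pi / t.factorial * iteratedDeriv t f x₀) := by
  have hx₀ : x₀ ∈ V := by
    refine hχV (subset_tsupport χ ?_)
    rw [Function.mem_support, h1.eq_of_nhds]
    exact one_ne_zero
  obtain ⟨R, hR, hRV⟩ := Metric.nhds_basis_closedBall.mem_iff.1 (hV.mem_nhds hx₀)
  set G : ℂ → ℂ := fun z => f z * (z - x₀)⁻¹ ^ (t + 1) with hG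
  have hW : IsOpen (V \ {x₀}) := hV.sdiff isClosed_singleton
  have hGd : DifferentiableOn ℂ G (V \ {x₀}) := by
    refine (hf.mono sdiff_subset).mul (DifferentiableOn.pow (DifferentiableOn.inv
      (differentiableOn_id.sub_const x₀) fun z hz => sub_ne_zero.2 hz.2) _)
  have hsupp : ∀ φ : ℂ → ℂ, tsupport φ ⊆ V → φ =ᶠ[𝓝 x₀] (fun _ => 1) →
      tsupport (dbar φ) ⊆ V \ {x₀} := by
    intro φ hφV hφ z hz
    refine ⟨hφV (tsupport_dbar_subset φ hz), fun h => ?_⟩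
    rw [mem_singleton_iff] at h
    subst h
    refine notMem_tsupport_iff_eventuallyEq.2 ?_ hz
    filter_upwards [hφ.eventually_nhds] with w hw
    exact dbar_eq_zero_of_eventuallyEq_const hw
  have hbV : tsupport (bump x₀ R) ⊆ V := (tsupport_bump_subset hR).trans hRV
  have hb := contDiff_bump x₀ R
  have hbc := hasCompactSupport_bump (c := x₀) hR
  have e1 : ∫ z, dbar (fun w => χ w - bump x₀ R w) z * G z = 0 := by
    refine integral_dbar_mul_eq_zero (hχ.sub hb) (hc.sub hbc) hW ?_ hGd
    intro z hz
    refine ⟨?_, fun h => ?_⟩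
    · rcases tsupport_sub χ (bump x₀ R) hz with h | h
      exacts [hχV h, hbV h]
    · rw [mem_singleton_iff] at h
      subst h
      refine notMem_tsupport_iff_eventuallyEq.2 ?_ hz
      filter_upwards [h1, bump_eventuallyEq_one hR] with w hw hw'
      rw [hw, hw', sub_self, Pi.zero_apply]
  have e2 : ∫ z, dbar (bump x₀ R) z * G z = -(2 * Real.pi / t.factorial * iteratedDeriv t f x₀) :=
    integral_dbar_bump_mul_cauchyKernel hR t (hf.mono hRV)
  have i1 := integrable_mul_of_tsupport_subset (continuous_dbar hχ)
    (hc.mono' ((subset_tsupport _).trans (tsupport_dbar_subset χ))) hW (hsupp χ hχV h1)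
    hGd.continuousOn
  have i2 := integrable_mul_of_tsupport_subset (continuous_dbar hb)
    (hbc.mono' ((subset_tsupport _).trans (tsupport_dbar_subset _))) hW
    (hsupp _ hbV (bump_eventuallyEq_one hR)) hGd.continuousOn
  rw [← e2, ← sub_eq_zero, ← integral_sub i1 i2, ← e1]
  refine integral_congr_ae (Eventually.of_forall fun z => ?_)
  simp only
  rw [dbar_sub (hχ.differentiable (by norm_num) z) (hb.differentiable (by norm_num) z), sub_mul]

/-! ### Lower content and area -/

lemma hContent_le_lowerContent {h : ℝ≥0 → ℝ≥0} (hh : IsMeasureFunction h) (hle : ∀ t, h t ≤ t)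
    (hlim : Tendsto (fun t => h t / t) (𝓝[>] 0) (𝓝 0)) (E : Set ℂ) : hContent h E ≤ lowerContent E :=
  le_iSup₂_of_le h hh (le_iSup₂_of_le hle hlim le_rfl)

/-- A function `t ↦ t φ(t)` is admissible for the lower content as soon as `φ ≤ 1` is increasing and
tends to zero. -/
lemma hContent_mul_le_lowerContent {φ : ℝ≥0 → ℝ≥0} (hφ : Monotone φ) (h1 : ∀ t, φ t ≤ 1)
    (hlim : Tendsto φ (𝓝[>] 0) (𝓝 0)) (E : Set ℂ) : hContent (fun t => t * φ t) E ≤ lowerContent E := by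
  have hle : ∀ t, t * φ t ≤ t := fun t => mul_le_of_le_one_right zero_le (h1 t)
  refine hContent_le_lowerContent ⟨fun s t hst => mul_le_mul' hst (hφ hst), ?_⟩ hle ?_ E
  · exact tendsto_of_tendsto_of_tendsto_of_le_of_le tendsto_const_nhds
      ((tendsto_id (α := ℝ≥0)).mono_left nhdsWithin_le_nhds) (fun _ => zero_le) hle
  · refine hlim.congr' ?_
    filter_upwards [self_mem_nhdsWithin] with t ht
    rw [mul_div_cancel_left₀ _ (ne_of_gt ht)]

lemma volume_square_coe (a : ℂ) (r : ℝ≥0) : volume (square a r) = (r : ℝ≥0∞) ^ 2 := by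
  rw [volume_square a r.coe_nonneg, ENNReal.ofReal_pow r.coe_nonneg, ENNReal.ofReal_coe_nnreal]

/-- The admissible function `h(s) = min(s, s² / δ)` compares the lower content with the area. -/
lemma volume_le_mul_lowerContent {E : Set ℂ} {δ : ℝ≥0} (hδ : 0 < δ) (h : lowerContent E < δ) :
    volume E ≤ δ * lowerContent E := by
  have hlim : Tendsto (fun t : ℝ≥0 => min 1 (t / δ)) (𝓝[>] 0) (𝓝 0) := by
    have : Tendsto (fun t : ℝ≥0 => min 1 (t / δ)) (𝓝 0) (𝓝 (min 1 (0 / δ))) :=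
      tendsto_const_nhds.min (tendsto_id.div_const δ)
    rw [zero_div, min_eq_right zero_le] at this
    exact this.mono_left nhdsWithin_le_nhds
  have hc := hContent_mul_le_lowerContent (φ := fun t => min 1 (t / δ))
    (fun s t hst => min_le_min le_rfl (by gcongr)) (fun t => min_le_left _ _) hlim E
  refine le_trans ?_ (mul_le_mul_right hc _)
  by_contra! hlt
  have hδ0 : (δ : ℝ≥0∞) ≠ 0 := by exact_mod_cast hδ.ne'
  have hlt' := lt_of_le_of_lt hc h
  have hex : hContent (fun t => t * min 1 (t / δ)) E < min (δ : ℝ≥0∞) (volume E / δ) := by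
    refine lt_min hlt' ?_
    rwa [ENNReal.lt_div_iff_mul_lt (Or.inl hδ0) (Or.inl ENNReal.coe_ne_top), mul_comm]
  simp only [hContent, iInf_lt_iff] at hex
  obtain ⟨a, r, -, hcov, hsum⟩ := hex
  have hr : ∀ j, r j < δ := by
    intro j
    by_contra! hj
    have h1 : (r j * min 1 (r j / δ) : ℝ≥0) = r j := by
      rw [min_eq_left ((one_le_div hδ).2 hj), mul_one]
    have h2 := (ENNReal.le_tsum (f := fun j => ((r j * min 1 (r j / δ) : ℝ≥0) : ℝ≥0∞)) j).trans_lt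
      (hsum.trans_le (min_le_left _ _))
    simp only [h1] at h2
    exact absurd (ENNReal.coe_lt_coe.1 h2) (not_lt.2 hj)
  have hvol : volume E ≤ δ * ∑' j, ((r j * min 1 (r j / δ) : ℝ≥0) : ℝ≥0∞) := by
    calc volume E ≤ ∑' j, volume (square (a j) (r j)) :=
          (measure_mono hcov).trans (measure_iUnion_le _)
      _ = ∑' j, δ * ((r j * min 1 (r j / δ) : ℝ≥0) : ℝ≥0∞) := by
          refine tsum_congr fun j => ?_
          rw [volume_square_coe, min_eq_right ((div_le_one hδ).2 (hr j).le), ← ENNReal.coe_mul,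
            ← ENNReal.coe_pow]
          congr 1
          field_simp
      _ = _ := ENNReal.tsum_mul_left
  have h3 := hsum.trans_le (min_le_right _ _)
  rw [ENNReal.lt_div_iff_mul_lt (Or.inl hδ0) (Or.inl ENNReal.coe_ne_top), mul_comm] at h3
  exact absurd h3 (not_lt.2 hvol)

/-- The isoperimetric inequality for the lower content. -/
lemma volume_le_lowerContent_sq (E : Set ℂ) : volume E ≤ lowerContent E ^ 2 := by
  rcases eq_or_ne (lowerContent E) ⊤ with h | h
  · rw [h]; simp
  lift lowerContent E to ℝ≥0 using h with M hM
  have key : ∀ δ : ℝ≥0, M < δ → volume E ≤ δ * M := fun δ hδ => by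
    rw [hM]
    exact volume_le_mul_lowerContent (bot_le.trans_lt hδ) (by rw [← hM]; exact_mod_cast hδ)
  have hlim : Tendsto (fun δ : ℝ≥0 => ((δ * M : ℝ≥0) : ℝ≥0∞)) (𝓝[>] M) (𝓝 ((M * M : ℝ≥0) : ℝ≥0∞)) :=
    ENNReal.tendsto_coe.2 ((tendsto_id.mul_const M).mono_left nhdsWithin_le_nhds)
  rw [sq, ← ENNReal.coe_mul]
  refine ge_of_tendsto hlim ?_
  filter_upwards [self_mem_nhdsWithin] with δ hδ
  rw [ENNReal.coe_mul]
  exact key δ hδ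

lemma mem_annulus_of_le_half {x₀ z : ℂ} (h0 : z ≠ x₀) {N : ℕ} (h1 : ‖z - x₀‖ ≤ ((2 : ℝ) ^ N)⁻¹) :
    ∃ n, N ≤ n ∧ z ∈ annulus x₀ n := by
  have hpos : 0 < ‖z - x₀‖ := norm_pos_iff.2 (sub_ne_zero.2 h0)
  obtain ⟨k, hk1, hk2⟩ := exists_nat_pow_near_of_lt_one (x := ‖z - x₀‖) (y := 1 / 2) hpos
    (h1.trans (inv_le_one_of_one_le₀ (one_le_pow₀ (by norm_num)))) (by norm_num) (by norm_num)
  simp only [one_div, inv_pow] at hk1 hk2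
  rcases le_or_gt N k with hNk | hNk
  · exact ⟨k, hNk, hk1.le, hk2⟩
  · refine ⟨N, le_rfl, ?_, h1⟩
    refine (inv_anti₀ (by positivity) (pow_le_pow_right₀ (by norm_num) ?_)).trans hk1.le
    omega

/-- Convergence of the series forces `X` to have full density at `x₀`. -/
lemma eventually_volume_closedBall_diff_le {X : Set ℂ} {x₀ : ℂ} {t : ℕ}
    (h : ∑' n : ℕ, (2 : ℝ≥0∞) ^ ((t + 1) * (n + 1)) * lowerContent (annulus x₀ (n + 1) \ X) < ⊤)
    {ε : ℝ≥0} (hε : 0 < ε) :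
    ∀ᶠ N : ℕ in atTop, volume (Metric.closedBall x₀ (2 ^ N)⁻¹ \ X) ≤ ε * (4 ^ N)⁻¹ := by
  have hlim := ENNReal.tendsto_atTop_zero_of_tsum_ne_top h.ne
  set η : ℝ≥0 := min 1 (ε / 2) with hη
  have hη0 : 0 < η := by positivity
  have hev := (tendsto_order.1 hlim).2 η (by exact_mod_cast hη0)
  obtain ⟨N₀, hN₀⟩ := eventually_atTop.1 hev
  refine eventually_atTop.2 ⟨N₀ + 1, fun N hN => ?_⟩
  have hterm : ∀ n, N ≤ n → volume (annulus x₀ n \ X) ≤ η * (4 ^ n)⁻¹ := by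
    intro n hn
    obtain ⟨k, rfl⟩ : ∃ k, n = k + 1 := ⟨n - 1, by omega⟩
    have h1 := (hN₀ k (by omega)).le
    have h2 : lowerContent (annulus x₀ (k + 1) \ X) ≤ η * (2 ^ (k + 1))⁻¹ := by
      rw [← div_eq_mul_inv, ENNReal.le_div_iff_mul_le (Or.inl (by positivity))
        (Or.inl (ENNReal.pow_ne_top (by simp))), mul_comm]
      refine le_trans ?_ h1
      gcongr
      · norm_num
      · exact Nat.le_mul_of_pos_left _ (Nat.succ_pos t)
    refine (volume_le_lowerContent_sq _).trans ((pow_le_pow_left' h2 2).trans ?_)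
    rw [mul_pow, ← ENNReal.inv_pow, ← pow_mul, mul_comm (k + 1) 2, pow_mul]
    norm_num
    gcongr
    rw [sq]
    exact mul_le_of_le_one_right zero_le (by exact_mod_cast min_le_left _ _)
  have hsub : Metric.closedBall x₀ (2 ^ N)⁻¹ \ X ⊆ {x₀} ∪ ⋃ k : ℕ, annulus x₀ (k + N) \ X := by
    intro z hz
    by_cases hz0 : z = x₀
    · exact Or.inl hz0
    · rw [Set.mem_sdiff, Metric.mem_closedBall, dist_eq_norm] at hz
      obtain ⟨n, hn, hzn⟩ := mem_annulus_of_le_half hz0 hz.1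
      refine Or.inr (mem_iUnion.2 ⟨n - N, ?_⟩)
      rw [Nat.sub_add_cancel hn]
      exact ⟨hzn, hz.2⟩
  calc volume (Metric.closedBall x₀ (2 ^ N)⁻¹ \ X)
      ≤ volume {x₀} + ∑' k : ℕ, volume (annulus x₀ (k + N) \ X) :=
        (measure_mono hsub).trans ((measure_union_le _ _).trans
          (add_le_add le_rfl (measure_iUnion_le _)))
    _ ≤ ∑' k : ℕ, (η : ℝ≥0∞) * (4 ^ N)⁻¹ * (2⁻¹) ^ k := by
        rw [measure_singleton, zero_add]
        refine ENNReal.tsum_le_tsum fun k => (hterm (k + N) (by omega)).trans ?_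
        rw [mul_assoc, pow_add, mul_comm (4 ^ k), ENNReal.mul_inv (Or.inl (by positivity))
          (Or.inl (ENNReal.pow_ne_top (by simp))), ← ENNReal.inv_pow (a := 2)]
        gcongr
        norm_num
    _ = η * (4 ^ N)⁻¹ * 2 := by
        rw [ENNReal.tsum_mul_left, ENNReal.tsum_geometric, ENNReal.one_sub_inv_two, inv_inv]
    _ ≤ ε * (4 ^ N)⁻¹ := by
        rw [mul_right_comm]
        gcongr
        have : η * 2 ≤ ε := by
          calc η * 2 ≤ ε / 2 * 2 := by gcongr; exact min_le_right _ _
            _ = ε := by simp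
        exact_mod_cast this

/-! ### Coverings by dyadic squares of small angular size -/

/-- The centre of a dyadic square. -/
noncomputable def center (Q : ℕ × ℤ × ℤ) : ℂ := corner Q + ⟨side Q / 2, side Q / 2⟩

lemma norm_sub_center_le {Q : ℕ × ℤ × ℤ} {z : ℂ} (hz : z ∈ cube Q) : ‖z - center Q‖ ≤ side Q := by
  rw [mem_cube_iff'] at hz
  refine (Complex.norm_le_abs_re_add_abs_im _).trans ?_
  have h1 : |(z - center Q).re| ≤ side Q / 2 := by
    rw [abs_le, Complex.sub_re, center, Complex.add_re]
    constructor <;> linarith [hz.1.1, hz.1.2]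
  have h2 : |(z - center Q).im| ≤ side Q / 2 := by
    rw [abs_le, Complex.sub_im, center, Complex.add_im]
    constructor <;> linarith [hz.2.1, hz.2.2]
  linarith

/-- The side length of a dyadic square, as a nonnegative real. -/
noncomputable def nnside (Q : ℕ × ℤ × ℤ) : ℝ≥0 := (2 ^ Q.1)⁻¹

lemma coe_nnside (Q : ℕ × ℤ × ℤ) : (nnside Q : ℝ) = side Q := by
  simp [nnside, side]

/-- A set that fits into a square of side `64 · 2⁻ᵏ` meets at most `65²` dyadic squares of level `k`. -/
lemma exists_finset_cells {T : Set ℂ} {b : ℂ} {k : ℕ} (hT : T ⊆ square b (64 * (2 ^ k)⁻¹)) :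
    ∃ s : Finset (ℕ × ℤ × ℤ), s.card ≤ 4225 ∧ (∀ Q ∈ s, Q.1 = k ∧ ∃ z ∈ T, z ∈ cube Q) ∧
      T ⊆ cover s := by
  classical
  set D : Set (ℕ × ℤ × ℤ) := (fun z => (k, cell k z)) '' T with hD
  set F : Finset (ℕ × ℤ × ℤ) := {k} ×ˢ (Finset.Icc ⌊b.re * 2 ^ k⌋ (⌊b.re * 2 ^ k⌋ + 64) ×ˢ
    Finset.Icc ⌊b.im * 2 ^ k⌋ (⌊b.im * 2 ^ k⌋ + 64)) with hF
  have key : ∀ x y : ℝ, x ∈ Icc y (y + 64 * (2 ^ k)⁻¹) →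
      ⌊x * 2 ^ k⌋ ∈ Finset.Icc ⌊y * 2 ^ k⌋ (⌊y * 2 ^ k⌋ + 64) := by
    intro x y hx
    have hk : (0 : ℝ) < 2 ^ k := by positivity
    rw [Finset.mem_Icc]
    refine ⟨Int.floor_le_floor (by gcongr; exact hx.1), ?_⟩
    rw [← Int.floor_add_ofNat]
    refine Int.floor_le_floor ?_
    calc x * 2 ^ k ≤ (y + 64 * (2 ^ k)⁻¹) * 2 ^ k := by gcongr; exact hx.2
      _ = _ := by field_simp
  have hDF : D ⊆ F := by
    rintro _ ⟨z, hz, rfl⟩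
    have h := hT hz
    simp only [hF, Finset.coe_product, Finset.coe_singleton, mem_prod, mem_singleton_iff, true_and,
      Finset.mem_coe, cell]
    exact ⟨key _ _ h.1, key _ _ h.2⟩
  have hfin : D.Finite := F.finite_toSet.subset hDF
  refine ⟨hfin.toFinset, ?_, ?_, ?_⟩
  · refine (Finset.card_le_card (t := F) fun Q hQ => hDF (hfin.mem_toFinset.1 hQ)).trans ?_
    have h1 : ∀ x : ℤ, (x + 64 + 1 - x).toNat = 65 := fun x => by rw [add_assoc, add_sub_cancel_left]; rfl
    simp only [hF, Finset.card_product, Finset.card_singleton, Int.card_Icc, h1]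
    norm_num
  · intro Q hQ
    obtain ⟨z, hz, rfl⟩ := hfin.mem_toFinset.1 hQ
    exact ⟨rfl, z, hz, rfl⟩
  · intro z hz
    exact mem_cover.2 ⟨(k, cell k z), by simpa [hD] using ⟨z, hz, rfl⟩, rfl⟩

/-- The part of a square in an annulus about `x₀` is covered by a bounded number of dyadic squares that
are no larger than the given one and small compared with their distance from `x₀`. -/
lemma exists_finset_cover_annulus {T : Set ℂ} {a x₀ : ℂ} {r : ℝ} {n : ℕ} (hr : 0 < r)
    (hT : T ⊆ square a r) (hTn : T ⊆ annulus x₀ (n + 1)) :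
    ∃ s : Finset (ℕ × ℤ × ℤ), s.card ≤ 4225 ∧ T ⊆ cover s ∧ ∀ Q ∈ s, side Q ≤ r ∧
      8 * side Q ≤ ‖center Q - x₀‖ ∧ ‖center Q - x₀‖ ≤ 1 ∧ ((2 : ℝ) ^ (n + 3))⁻¹ ≤ ‖center Q - x₀‖ := by
  -- If the given square is large, the whole annulus is covered by squares of side `2^{-(n+6)}`;
  -- otherwise squares of about the given side are used.
  obtain ⟨k, b, hTk, hkr, hkn⟩ : ∃ (k : ℕ) (b : ℂ), T ⊆ square b (64 * (2 ^ k)⁻¹) ∧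
      ((2 : ℝ) ^ k)⁻¹ ≤ r ∧ n + 6 ≤ k := by
    rcases le_or_gt ((2 : ℝ) ^ (n + 6))⁻¹ r with h | h
    · refine ⟨n + 6, x₀ - ⟨(2 ^ (n + 1))⁻¹, (2 ^ (n + 1))⁻¹⟩, (hTn.trans (annulus_subset_closedBall x₀ (n + 1))).trans
        ((closedBall_subset_square x₀ _).trans_eq ?_), h, le_rfl⟩
      congr 1
      rw [pow_add, pow_add]
      field_simp
      norm_num
    · obtain ⟨k, hk1, hk2⟩ := exists_nat_pow_near_of_lt_one (x := r) (y := 1 / 2) hr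
        (h.le.trans (inv_le_one_of_one_le₀ (one_le_pow₀ (by norm_num)))) (by norm_num) (by norm_num)
      simp only [one_div, inv_pow] at hk1 hk2
      refine ⟨k + 1, a, hT.trans fun z hz => ?_, hk1.le, ?_⟩
      · have h1 : r ≤ 64 * ((2 : ℝ) ^ (k + 1))⁻¹ := by
          rw [pow_succ, mul_inv]
          have : 0 < ((2 : ℝ) ^ k)⁻¹ := by positivity
          linarith
        exact ⟨⟨hz.1.1, hz.1.2.trans (by linarith)⟩, ⟨hz.2.1, hz.2.2.trans (by linarith)⟩⟩
      · have h1 := hk1.trans h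
        rw [inv_lt_inv₀ (by positivity) (by positivity)] at h1
        exact ((pow_lt_pow_iff_right₀ (by norm_num)).1 h1).le
  obtain ⟨s, hcard, hs, hcov⟩ := exists_finset_cells hTk
  refine ⟨s, hcard, hcov, fun Q hQ => ?_⟩
  obtain ⟨hQk, z, hzT, hzQ⟩ := hs Q hQ
  have hside : side Q = (2 ^ k)⁻¹ := by rw [side, hQk]
  have h1 := norm_sub_center_le hzQ
  have h2 : side Q ≤ ((2 : ℝ) ^ (n + 6))⁻¹ := by
    rw [hside]
    exact inv_anti₀ (by positivity) (pow_le_pow_right₀ (by norm_num) hkn)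
  obtain ⟨h3, h4⟩ := hTn hzT
  have h5 : ‖z - x₀‖ ≤ ‖z - center Q‖ + ‖center Q - x₀‖ := norm_sub_le_norm_sub_add_norm_sub _ _ _
  have h6 : ‖center Q - x₀‖ ≤ ‖z - center Q‖ + ‖z - x₀‖ := by
    rw [norm_sub_rev z (center Q)]
    exact norm_sub_le_norm_sub_add_norm_sub _ _ _
  set q : ℝ := ((2 : ℝ) ^ (n + 6))⁻¹ with hq
  have e1 : ((2 : ℝ) ^ (n + 1 + 1))⁻¹ = 16 * q := by rw [hq, pow_add, pow_add, pow_add]; field_simp; norm_num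
  have e2 : ((2 : ℝ) ^ (n + 1))⁻¹ = 32 * q := by rw [hq, pow_add, pow_add]; field_simp; norm_num
  have e3 : ((2 : ℝ) ^ (n + 3))⁻¹ = 8 * q := by rw [hq, pow_add, pow_add]; field_simp; norm_num
  have e4 : 64 * q ≤ 1 := by
    have : q ≤ ((2 : ℝ) ^ 6)⁻¹ := inv_anti₀ (by positivity) (pow_le_pow_right₀ (by norm_num) (by omega))
    norm_num at this
    linarith
  rw [e1] at h3
  rw [e2] at h4
  rw [e3]
  refine ⟨hside.trans_le hkr, by linarith, by linarith, by linarith⟩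

/-- The size `|c - x₀|^{-(t+1)}` of the kernel at the centre of a dyadic square. -/
noncomputable def weight (x₀ : ℂ) (t : ℕ) (Q : ℕ × ℤ × ℤ) : ℝ≥0∞ := ‖center Q - x₀‖ₑ⁻¹ ^ (t + 1)

lemma weight_le {x₀ : ℂ} {t : ℕ} {Q : ℕ × ℤ × ℤ} {n : ℕ}
    (h : ((2 : ℝ) ^ (n + 3))⁻¹ ≤ ‖center Q - x₀‖) :
    weight x₀ t Q ≤ 4 ^ (t + 1) * 2 ^ ((t + 1) * (n + 1)) := by
  have h1 : ‖center Q - x₀‖ₑ⁻¹ ≤ 2 ^ (n + 3) := by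
    rw [ENNReal.inv_le_iff_inv_le, ← ofReal_norm]
    refine le_trans (le_of_eq ?_) (ENNReal.ofReal_le_ofReal h)
    rw [ENNReal.ofReal_inv_of_pos (by positivity), ENNReal.ofReal_pow (by norm_num),
      ENNReal.ofReal_ofNat]
  refine (pow_le_pow_left' h1 _).trans (le_of_eq ?_)
  rw [pow_add 2 n 3, mul_comm (t + 1) (n + 1), pow_mul, ← mul_pow, pow_succ 2 n]
  congr 1
  rw [mul_comm 4, mul_assoc]
  norm_num

/-- If the series converges, then for every admissible `h` the complement of `X` near `x₀` has a
covering by dyadic squares `Q` that are small compared with their distance `d(Q)` from `x₀`, and for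
which `∑ h(side Q) / d(Q)^{t+1}` is bounded by a constant that does not depend on `h`. -/
theorem exists_dyadic_cover {X : Set ℂ} {x₀ : ℂ} {t : ℕ}
    (hsum : ∑' n : ℕ, (2 : ℝ≥0∞) ^ ((t + 1) * (n + 1)) * lowerContent (annulus x₀ (n + 1) \ X) < ⊤) :
    ∃ S : ℝ≥0, ∀ h : ℝ≥0 → ℝ≥0, Monotone h → (∀ E, hContent h E ≤ lowerContent E) →
      ∃ V : Set (ℕ × ℤ × ℤ), (∀ Q ∈ V, 8 * side Q ≤ ‖center Q - x₀‖ ∧ ‖center Q - x₀‖ ≤ 1) ∧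
        (Metric.closedBall x₀ (1 / 2) \ {x₀}) \ X ⊆ cover V ∧
        ∑' Q : V, weight x₀ t Q * h (nnside Q) ≤ S := by
  classical
  set A : ℝ≥0∞ := ∑' n : ℕ, (2 : ℝ≥0∞) ^ ((t + 1) * (n + 1)) *
    lowerContent (annulus x₀ (n + 1) \ X) with hA
  obtain ⟨δ, hδ, hδs⟩ := ENNReal.exists_pos_sum_of_countable (ε := 1) (by simp) ℕ
  have hSfin : 4225 * (4 ^ (t + 1) * (A + 1)) ≠ ⊤ := by finiteness
  refine ⟨(4225 * (4 ^ (t + 1) * (A + 1))).toNNReal, fun h hmono hle => ?_⟩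
  rw [ENNReal.coe_toNNReal hSfin]
  have hM : ∀ n, lowerContent (annulus x₀ (n + 1) \ X) ≠ ⊤ := by
    intro n hn
    refine hsum.ne (ENNReal.tsum_eq_top_of_eq_top ⟨n, ?_⟩)
    rw [hn, ENNReal.mul_top (by positivity)]
  have hex : ∀ n : ℕ, ∃ (a : ℕ → ℂ) (r : ℕ → ℝ≥0), (∀ j, 0 < r j) ∧
      annulus x₀ (n + 1) \ X ⊆ ⋃ j, square (a j) (r j) ∧
      ∑' j, (h (r j) : ℝ≥0∞) ≤ lowerContent (annulus x₀ (n + 1) \ X) +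
        δ n * (2 ^ ((t + 1) * (n + 1)))⁻¹ := by
    intro n
    have h1 : hContent h (annulus x₀ (n + 1) \ X) < lowerContent (annulus x₀ (n + 1) \ X) +
        δ n * (2 ^ ((t + 1) * (n + 1)))⁻¹ := by
      refine (hle _).trans_lt (ENNReal.lt_add_right (hM n) ?_)
      refine mul_ne_zero (by exact_mod_cast (hδ n).ne') (ENNReal.inv_ne_zero.2 (by finiteness))
    simp only [hContent, iInf_lt_iff] at h1
    obtain ⟨a, r, hr, hcov, hlt⟩ := h1
    exact ⟨a, r, hr, hcov, hlt.le⟩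
  choose a r hr hcov hlt using hex
  have hfin : ∀ n j : ℕ, ∃ s : Finset (ℕ × ℤ × ℤ), s.card ≤ 4225 ∧
      (annulus x₀ (n + 1) \ X) ∩ square (a n j) (r n j) ⊆ cover s ∧ ∀ Q ∈ s, side Q ≤ r n j ∧
      8 * side Q ≤ ‖center Q - x₀‖ ∧ ‖center Q - x₀‖ ≤ 1 ∧
      ((2 : ℝ) ^ (n + 3))⁻¹ ≤ ‖center Q - x₀‖ := fun n j =>
    exists_finset_cover_annulus (hr n j) inter_subset_right (inter_subset_left.trans sdiff_subset)
  choose s hcard hscov hs using hfin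
  refine ⟨⋃ n, ⋃ j, s n j, ?_, ?_, ?_⟩
  · intro Q hQ
    simp only [mem_iUnion] at hQ
    obtain ⟨n, j, hQ⟩ := hQ
    exact ⟨(hs n j Q hQ).2.1, (hs n j Q hQ).2.2.1⟩
  · intro z hz
    have h1 : ‖z - x₀‖ ≤ ((2 : ℝ) ^ 1)⁻¹ := by
      have := hz.1.1
      rw [Metric.mem_closedBall, dist_eq_norm] at this
      linarith
    obtain ⟨k, hk, hzk⟩ := mem_annulus_of_le_half hz.1.2 h1
    obtain ⟨n, rfl⟩ : ∃ n, k = n + 1 := ⟨k - 1, by omega⟩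
    obtain ⟨j, hj⟩ := mem_iUnion.1 (hcov n ⟨hzk, hz.2⟩)
    obtain ⟨Q, hQ, hzQ⟩ := mem_cover.1 (hscov n j ⟨⟨hzk, hz.2⟩, hj⟩)
    exact mem_cover.2 ⟨Q, mem_iUnion.2 ⟨n, mem_iUnion.2 ⟨j, hQ⟩⟩, hzQ⟩
  · calc ∑' Q : (⋃ n, ⋃ j, (s n j : Set (ℕ × ℤ × ℤ)) : Set (ℕ × ℤ × ℤ)),
          weight x₀ t Q * h (nnside Q)
        ≤ ∑' n, ∑' Q : (⋃ j, (s n j : Set (ℕ × ℤ × ℤ)) : Set (ℕ × ℤ × ℤ)),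
          weight x₀ t Q * h (nnside Q) :=
          ENNReal.tsum_iUnion_le_tsum (fun Q => weight x₀ t Q * h (nnside Q)) _
      _ ≤ ∑' n, ∑' j, ∑' Q : (s n j : Set (ℕ × ℤ × ℤ)), weight x₀ t Q * h (nnside Q) := by
          gcongr with n
          exact ENNReal.tsum_iUnion_le_tsum (fun Q => weight x₀ t Q * h (nnside Q)) _
      _ ≤ ∑' n, ∑' j, 4225 * (4 ^ (t + 1) * 2 ^ ((t + 1) * (n + 1)) * (h (r n j) : ℝ≥0∞)) := by
          refine ENNReal.tsum_le_tsum fun n => ENNReal.tsum_le_tsum fun j => ?_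
          rw [Finset.tsum_subtype' (s n j) (fun Q => weight x₀ t Q * (h (nnside Q) : ℝ≥0∞))]
          refine (Finset.sum_le_card_nsmul _ _
            (4 ^ (t + 1) * 2 ^ ((t + 1) * (n + 1)) * (h (r n j) : ℝ≥0∞)) fun Q hQ => ?_).trans ?_
          · refine mul_le_mul' (weight_le (hs n j Q hQ).2.2.2) ?_
            have : nnside Q ≤ r n j := by
              rw [← NNReal.coe_le_coe, coe_nnside]
              exact (hs n j Q hQ).1
            exact_mod_cast hmono this
          · rw [nsmul_eq_mul]
            gcongr
            exact_mod_cast hcard n j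
      _ ≤ ∑' n, 4225 * (4 ^ (t + 1) * (2 ^ ((t + 1) * (n + 1)) *
            lowerContent (annulus x₀ (n + 1) \ X) + δ n)) := by
          gcongr with n
          rw [ENNReal.tsum_mul_left, ENNReal.tsum_mul_left, mul_assoc (4 ^ (t + 1))]
          gcongr
          refine (mul_le_mul_right (hlt n) _).trans (le_of_eq ?_)
          rw [mul_add, mul_left_comm, ENNReal.mul_inv_cancel (by positivity) (by finiteness), mul_one]
      _ = 4225 * (4 ^ (t + 1) * (A + ∑' n, (δ n : ℝ≥0∞))) := by
          rw [ENNReal.tsum_mul_left, ENNReal.tsum_mul_left, ENNReal.tsum_add]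
      _ ≤ _ := by gcongr

/-- The measure function adapted to the moduli of oscillation `Ω` of a VMO function: it equals `t`
for `t ≥ δ`, and dominates both `t² / δ` and `t Ω(4t) / m` for smaller `t`. -/
lemma exists_gauge {Ω : ℝ → ℝ≥0∞} (hΩ : Monotone Ω) (hlim : Tendsto Ω (𝓝[>] 0) (𝓝 0)) {m δ : ℝ≥0}
    (hm : 0 < m) (hδ : 0 < δ) (hΩδ : Ω (4 * δ) ≤ m) :
    ∃ h : ℝ≥0 → ℝ≥0, Monotone h ∧ (∀ E, hContent h E ≤ lowerContent E) ∧
      (∀ t, δ ≤ t → h t = t) ∧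
      ∀ t, t ≤ δ → t * t ≤ δ * h t ∧ (t : ℝ≥0∞) * Ω (4 * t) ≤ m * h t := by
  set φ : ℝ≥0 → ℝ≥0 := fun t => (min 1 ((t : ℝ≥0∞) / δ + Ω (4 * t) / m)).toNNReal with hφ
  have hm0 : (m : ℝ≥0∞) ≠ 0 := by exact_mod_cast hm.ne'
  have hδ0 : (δ : ℝ≥0∞) ≠ 0 := by exact_mod_cast hδ.ne'
  have hcoe : ∀ t, (φ t : ℝ≥0∞) = min 1 ((t : ℝ≥0∞) / δ + Ω (4 * t) / m) := fun t =>
    ENNReal.coe_toNNReal (ne_top_of_le_ne_top ENNReal.one_ne_top (min_le_left _ _))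
  have hφm : Monotone φ := by
    intro s t hst
    rw [← ENNReal.coe_le_coe, hcoe, hcoe]
    have h1 : Ω (4 * s) ≤ Ω (4 * t) := hΩ (by gcongr)
    gcongr
  have hφ1 : ∀ t, φ t ≤ 1 := fun t => by
    rw [← ENNReal.coe_le_coe, hcoe]
    exact min_le_left _ _
  have hφlim : Tendsto φ (𝓝[>] 0) (𝓝 0) := by
    have h4 : Tendsto (fun t : ℝ≥0 => 4 * (t : ℝ)) (𝓝[>] 0) (𝓝[>] 0) := by
      refine tendsto_nhdsWithin_iff.2 ⟨?_, ?_⟩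
      · have : Tendsto (fun t : ℝ≥0 => 4 * (t : ℝ)) (𝓝 0) (𝓝 (4 * ((0 : ℝ≥0) : ℝ))) :=
          (NNReal.continuous_coe.tendsto 0).const_mul 4
        rw [NNReal.coe_zero, mul_zero] at this
        exact this.mono_left nhdsWithin_le_nhds
      · filter_upwards [self_mem_nhdsWithin] with t ht
        have : (0 : ℝ) < t := ht
        exact mul_pos (by norm_num) this
    have h5 : Tendsto (fun t : ℝ≥0 => (t : ℝ≥0∞) / δ + Ω (4 * t) / m) (𝓝[>] 0) (𝓝 (0 / δ + 0 / m)) := by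
      refine Tendsto.add (ENNReal.Tendsto.div_const ?_ (Or.inr hδ0))
        (ENNReal.Tendsto.div_const (hlim.comp h4) (Or.inr hm0))
      exact (ENNReal.tendsto_coe.2 tendsto_id).mono_left nhdsWithin_le_nhds
    have h6 := (tendsto_const_nhds (x := (1 : ℝ≥0∞))).min h5
    rw [ENNReal.zero_div, ENNReal.zero_div, add_zero, min_eq_right zero_le] at h6
    rw [← ENNReal.tendsto_coe]
    simpa only [hcoe, ENNReal.coe_zero] using h6
  refine ⟨fun t => t * φ t, fun s t hst => mul_le_mul' hst (hφm hst),
    hContent_mul_le_lowerContent hφm hφ1 hφlim, fun t ht => ?_, fun t ht => ⟨?_, ?_⟩⟩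
  · have : φ t = 1 := by
      rw [← ENNReal.coe_inj, hcoe, ENNReal.coe_one]
      refine min_eq_left (le_add_right ?_)
      rw [ENNReal.le_div_iff_mul_le (Or.inl hδ0) (Or.inl ENNReal.coe_ne_top), one_mul]
      exact_mod_cast ht
    simp only [this, mul_one]
  · have h1 : t / δ ≤ φ t := by
      rw [← ENNReal.coe_le_coe, hcoe, ENNReal.coe_div hδ.ne']
      refine le_min ?_ le_self_add
      rw [← ENNReal.coe_div hδ.ne']
      exact_mod_cast div_le_one_of_le₀ ht zero_le
    calc t * t = δ * (t * (t / δ)) := by field_simp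
      _ ≤ δ * (t * φ t) := by gcongr
  · have h1 : Ω (4 * t) / m ≤ φ t := by
      rw [hcoe]
      refine le_min ?_ le_add_self
      rw [ENNReal.div_le_iff hm0 ENNReal.coe_ne_top, one_mul]
      exact (hΩ (by gcongr)).trans hΩδ
    rw [ENNReal.div_le_iff hm0 ENNReal.coe_ne_top] at h1
    calc (t : ℝ≥0∞) * Ω (4 * t) ≤ t * (φ t * m) := by gcongr
      _ = m * ((t * φ t : ℝ≥0) : ℝ≥0∞) := by push_cast; ring

/-! ### Products of cutoffs attached to dyadic squares -/

/-- The smooth cutoff attached to a dyadic square: it equals `1` near the square and is supported in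
a disc about its centre with radius twice its side. -/
noncomputable def cubeBump (Q : ℕ × ℤ × ℤ) : ℂ → ℂ := bump (center Q) (2 * side Q)

lemma two_side_pos (Q : ℕ × ℤ × ℤ) : 0 < 2 * side Q := mul_pos two_pos (side_pos Q)

lemma cubeBump_eq_one {Q : ℕ × ℤ × ℤ} {z : ℂ} (hz : ‖z - center Q‖ < 5 / 4 * side Q) :
    cubeBump Q z = 1 := by
  refine bump_eq_one (two_side_pos Q) ?_
  nlinarith [norm_nonneg (z - center Q), side_pos Q]

/-- A function that equals `1` near `x₀`, is supported in the disc of radius `1/4` about `x₀`, and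
vanishes near each of the squares of the family `J`. -/
noncomputable def cutoff (x₀ : ℂ) (J : Finset (ℕ × ℤ × ℤ)) (z : ℂ) : ℂ :=
  bump x₀ (1 / 4) z * ∏ Q ∈ J, (1 - cubeBump Q z)

lemma contDiff_prod_one_sub_cubeBump (J : Finset (ℕ × ℤ × ℤ)) :
    ContDiff ℝ 1 fun z => ∏ Q ∈ J, (1 - cubeBump Q z) :=
  contDiff_prod fun _ _ => contDiff_const.sub (contDiff_bump _ _)

lemma contDiff_cutoff (x₀ : ℂ) (J : Finset (ℕ × ℤ × ℤ)) : ContDiff ℝ 1 (cutoff x₀ J) :=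
  (contDiff_bump _ _).mul (contDiff_prod_one_sub_cubeBump J)

lemma tsupport_cutoff_subset (x₀ : ℂ) (J : Finset (ℕ × ℤ × ℤ)) :
    tsupport (cutoff x₀ J) ⊆ Metric.closedBall x₀ (1 / 4) :=
  (closure_mono (Function.support_mul_subset_left _ _)).trans (tsupport_bump_subset (by norm_num))

lemma hasCompactSupport_cutoff (x₀ : ℂ) (J : Finset (ℕ × ℤ × ℤ)) :
    HasCompactSupport (cutoff x₀ J) :=
  (isCompact_closedBall x₀ (1 / 4)).of_isClosed_subset (isClosed_tsupport _)
    (tsupport_cutoff_subset x₀ J)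

lemma cutoff_insert {x₀ : ℂ} {J : Finset (ℕ × ℤ × ℤ)} {Q : ℕ × ℤ × ℤ} (hQ : Q ∉ J) (z : ℂ) :
    cutoff x₀ (insert Q J) z = cutoff x₀ J z - cutoff x₀ J z * cubeBump Q z := by
  rw [cutoff, cutoff, Finset.prod_insert hQ]
  ring

lemma cutoff_eventuallyEq_zero {x₀ : ℂ} {J : Finset (ℕ × ℤ × ℤ)} {Q : ℕ × ℤ × ℤ} (hQ : Q ∈ J) {z : ℂ}
    (hz : ‖z - center Q‖ < 5 / 4 * side Q) : cutoff x₀ J =ᶠ[𝓝 z] fun _ => 0 := by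
  have ho : IsOpen {w : ℂ | ‖w - center Q‖ < 5 / 4 * side Q} :=
    isOpen_lt (continuous_id.sub continuous_const).norm continuous_const
  filter_upwards [ho.mem_nhds hz] with w hw
  rw [cutoff, Finset.prod_eq_zero hQ, mul_zero]
  rw [cubeBump_eq_one hw, sub_self]

lemma cutoff_eventuallyEq_one {x₀ : ℂ} {J : Finset (ℕ × ℤ × ℤ)}
    (hJ : ∀ Q ∈ J, 8 * side Q ≤ ‖center Q - x₀‖) : cutoff x₀ J =ᶠ[𝓝 x₀] fun _ => 1 := by
  have h1 : ∀ᶠ z in 𝓝 x₀, ∀ Q ∈ J, cubeBump Q z = 0 := by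
    rw [Filter.eventually_all_finset]
    intro Q hQ
    have ho : IsOpen {w : ℂ | 2 * side Q < ‖w - center Q‖} :=
      isOpen_lt continuous_const (continuous_id.sub continuous_const).norm
    have hx : x₀ ∈ {w : ℂ | 2 * side Q < ‖w - center Q‖} := by
      rw [Set.mem_ofPred_eq, norm_sub_rev]
      linarith [hJ Q hQ, side_pos Q]
    filter_upwards [ho.mem_nhds hx] with z hz
    exact bump_eq_zero (two_side_pos Q) (le_of_lt hz)
  filter_upwards [h1, bump_eventuallyEq_one (c := x₀) (R := 1 / 4) (by norm_num)] with z hz hz'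
  rw [cutoff, hz', Finset.prod_congr rfl fun Q hQ => by rw [hz Q hQ, sub_zero], Finset.prod_const_one,
    mul_one]

lemma norm_prod_one_sub_cubeBump_le (J : Finset (ℕ × ℤ × ℤ)) (z : ℂ) :
    ‖∏ Q ∈ J, (1 - cubeBump Q z)‖ ≤ 1 := by
  rw [norm_prod]
  exact Finset.prod_le_one (fun _ _ => norm_nonneg _) fun Q _ => norm_one_sub_bump_le_one _ _ _

lemma norm_dbar_mul_le {φ ψ : ℂ → ℂ} {z : ℂ} (hφ : ContDiff ℝ 1 φ) (hψ : ContDiff ℝ 1 ψ)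
    (h1 : ‖φ z‖ ≤ 1) (h2 : ‖ψ z‖ ≤ 1) :
    ‖dbar (fun w => φ w * ψ w) z‖ ≤ ‖dbar φ z‖ + ‖dbar ψ z‖ := by
  rw [dbar_mul (hφ.differentiable (by norm_num) z) (hψ.differentiable (by norm_num) z)]
  refine (norm_add_le _ _).trans ?_
  rw [norm_mul, norm_mul, add_comm]
  exact add_le_add (mul_le_of_le_one_left (norm_nonneg _) h2)
    (mul_le_of_le_one_left (norm_nonneg _) h1)

lemma norm_dbar_prod_le (J : Finset (ℕ × ℤ × ℤ)) (z : ℂ) :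
    ‖dbar (fun w => ∏ Q ∈ J, (1 - cubeBump Q w)) z‖ ≤ ∑ Q ∈ J, ‖dbar (cubeBump Q) z‖ := by
  classical
  induction J using Finset.induction_on with
  | empty =>
    simp only [Finset.prod_empty, Finset.sum_empty]
    rw [dbar_eq_zero_of_differentiableAt (differentiableAt_const _), norm_zero]
  | insert Q J hQ ih =>
    simp only [Finset.prod_insert hQ, Finset.sum_insert hQ]
    refine (norm_dbar_mul_le (contDiff_const.sub (contDiff_bump _ _))
      (contDiff_prod_one_sub_cubeBump J) (norm_one_sub_bump_le_one _ _ _)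
      (norm_prod_one_sub_cubeBump_le J z)).trans (add_le_add ?_ ih)
    rw [dbar_const_sub, norm_neg]
    exact le_rfl

/-- At most `25` squares of each level have a given point in the support of their cutoff. -/
lemma sum_norm_dbar_cubeBump_le {B : ℝ} (hB : ∀ (c : ℂ) (R : ℝ) (z : ℂ), 0 < R →
    ‖dbar (bump c R) z‖ ≤ B / R) (hB0 : 0 ≤ B) {J : Finset (ℕ × ℤ × ℤ)} {L : ℕ}
    (hJ : ∀ Q ∈ J, Q.1 ≤ L) (z : ℂ) : ∑ Q ∈ J, ‖dbar (cubeBump Q) z‖ ≤ 25 * B * 2 ^ L := by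
  classical
  set T : Finset (ℕ × ℤ × ℤ) := Finset.range (L + 1) ×ˢ (Finset.Icc (-2) 2 ×ˢ Finset.Icc (-2) 2)
    with hT
  set g : ℕ × ℤ × ℤ → ℕ × ℤ × ℤ := fun p => (p.1, cell p.1 z + p.2) with hg
  have hginj : Function.Injective g := by
    rintro ⟨k, p⟩ ⟨k', p'⟩ h
    simp only [hg, Prod.mk.injEq] at h
    obtain ⟨rfl, h⟩ := h
    rw [add_left_cancel h]
  have hint : ∀ (x : ℝ) (i : ℤ), |x - (i + 1 / 2)| ≤ 2 → i - ⌊x⌋ ∈ Finset.Icc (-2 : ℤ) 2 := by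
    intro x i h
    rw [abs_le] at h
    have h1 := Int.floor_le x
    have h2 := Int.lt_floor_add_one x
    rw [Finset.mem_Icc]
    constructor
    · have h3 : ((⌊x⌋ : ℤ) : ℝ) - 3 < (i : ℝ) := by linarith
      have h3' : ⌊x⌋ - 3 < i := by exact_mod_cast h3
      omega
    · have h3 : (i : ℝ) < ((⌊x⌋ : ℤ) : ℝ) + 3 := by linarith
      have h3' : i < ⌊x⌋ + 3 := by exact_mod_cast h3
      omega
  have hnear : ∀ Q ∈ J, dbar (cubeBump Q) z ≠ 0 → Q ∈ T.image g := by
    rintro ⟨k, i, j⟩ hQ hne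
    have hz : z ∈ tsupport (cubeBump (k, i, j)) := by
      by_contra h
      exact hne (dbar_eq_zero_of_notMem_tsupport h)
    have hz2 := tsupport_bump_subset (two_side_pos _) hz
    rw [Metric.mem_closedBall, dist_eq_norm] at hz2
    have hk : (0 : ℝ) < 2 ^ k := by positivity
    have h1 := (Complex.abs_re_le_norm _).trans hz2
    have h2 := (Complex.abs_im_le_norm _).trans hz2
    have key : ∀ (x : ℝ) (i : ℤ), |x - (i / 2 ^ k + (2 ^ k)⁻¹ / 2)| ≤ 2 * (2 ^ k)⁻¹ →
        |x * 2 ^ k - (i + 1 / 2)| ≤ 2 := by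
      intro x i h
      have h3 : x * 2 ^ k - (i + 1 / 2) = (x - (i / 2 ^ k + (2 ^ k)⁻¹ / 2)) * 2 ^ k := by
        field_simp
      rw [h3, abs_mul, abs_of_pos hk]
      calc _ ≤ 2 * (2 ^ k)⁻¹ * (2 : ℝ) ^ k := by gcongr
        _ = 2 := by field_simp
    rw [Complex.sub_re, center, Complex.add_re] at h1
    rw [Complex.sub_im, center, Complex.add_im] at h2
    refine Finset.mem_image.2 ⟨(k, (i, j) - cell k z), ?_, ?_⟩
    · simp only [hT, Finset.mem_product, Finset.mem_range]
      exact ⟨Nat.lt_succ_of_le (hJ _ hQ), hint _ _ (key _ _ h1), hint _ _ (key _ _ h2)⟩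
    · simp only [hg, add_sub_cancel]
  calc ∑ Q ∈ J, ‖dbar (cubeBump Q) z‖
      ≤ ∑ Q ∈ T.image g, B * 2 ^ Q.1 / 2 := by
        rw [← Finset.sum_filter_of_ne (p := fun Q => Q ∈ T.image g)
          (fun Q hQ hne => hnear Q hQ (norm_ne_zero_iff.1 hne))]
        refine (Finset.sum_le_sum fun Q _ => ?_).trans (Finset.sum_le_sum_of_subset_of_nonneg
          (f := fun Q : ℕ × ℤ × ℤ => B * 2 ^ Q.1 / 2) (fun Q hQ => (Finset.mem_filter.1 hQ).2)
          fun Q _ _ => by positivity)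
        refine (hB _ _ z (two_side_pos Q)).trans (le_of_eq ?_)
        rw [side]
        field_simp
    _ = ∑ p ∈ T, B * 2 ^ p.1 / 2 := by rw [Finset.sum_image fun _ _ _ _ h => hginj h]
    _ = 25 * (B / 2) * ∑ k ∈ Finset.range (L + 1), (2 : ℝ) ^ k := by
        rw [hT, Finset.sum_product, Finset.mul_sum]
        refine Finset.sum_congr rfl fun k _ => ?_
        simp only [Finset.sum_const, Finset.card_product, Int.card_Icc, nsmul_eq_mul]
        norm_num
        simp only [show Int.toNat 5 = 5 from rfl]
        push_cast
        ring
    _ ≤ 25 * (B / 2) * 2 ^ (L + 1) := by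
        gcongr
        rw [geom_sum_eq (by norm_num)]
        norm_num
    _ = 25 * B * 2 ^ L := by ring

/-- If the squares are added by decreasing size, the derivative of the new term is controlled by the
side of the last square, whatever the number of squares. -/
lemma norm_dbar_cutoff_mul_cubeBump_le {B : ℝ} (hB : ∀ (c : ℂ) (R : ℝ) (z : ℂ), 0 < R →
    ‖dbar (bump c R) z‖ ≤ B / R) (hB0 : 0 ≤ B) {x₀ : ℂ} {J : Finset (ℕ × ℤ × ℤ)} {Q : ℕ × ℤ × ℤ}
    (hJ : ∀ R ∈ J, R.1 ≤ Q.1) (z : ℂ) :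
    ‖dbar (fun w => cutoff x₀ J w * cubeBump Q w) z‖ ≤ 30 * B / side Q := by
  have h1 : ‖cutoff x₀ J z‖ ≤ 1 := by
    rw [cutoff, norm_mul]
    exact mul_le_one₀ (norm_bump_le_one _ _ _) (norm_nonneg _) (norm_prod_one_sub_cubeBump_le J z)
  have h2 := norm_dbar_mul_le (contDiff_cutoff x₀ J) (contDiff_bump (center Q) (2 * side Q)) h1
    (norm_bump_le_one _ _ _)
  have h3 : ‖dbar (cutoff x₀ J) z‖ ≤ _ :=
    norm_dbar_mul_le (contDiff_bump x₀ (1 / 4)) (contDiff_prod_one_sub_cubeBump J)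
      (norm_bump_le_one _ _ _) (norm_prod_one_sub_cubeBump_le J z)
  have h4 := (norm_dbar_prod_le J z).trans (sum_norm_dbar_cubeBump_le hB hB0 hJ z)
  have h5 := hB x₀ (1 / 4) z (by norm_num)
  have h6 := hB (center Q) (2 * side Q) z (two_side_pos Q)
  have h7 : (2 : ℝ) ^ Q.1 = 1 / side Q := by rw [side, one_div, inv_inv]
  have h8 : B / (1 / 4) ≤ 4 * B / side Q := by
    rw [div_div_eq_mul_div, div_one, mul_comm B 4]
    exact le_div_self (by positivity) (side_pos Q) (side_le_one Q)
  have h9 : B / (2 * side Q) ≤ B / side Q := by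
    gcongr
    · exact side_pos Q
    · linarith [side_pos Q]
  rw [h7] at h4
  refine h2.trans ((add_le_add (h3.trans (add_le_add (h5.trans h8) h4)) (h6.trans h9)).trans
    (le_of_eq ?_))
  ring

/-- Telescoping along a finite family ordered by decreasing size. -/
lemma enorm_sub_le_sum_of_step {Φ : Finset (ℕ × ℤ × ℤ) → ℂ} {β : ℕ × ℤ × ℤ → ℝ≥0∞}
    {A J : Finset (ℕ × ℤ × ℤ)} (hdisj : Disjoint A J) (hAJ : ∀ Q ∈ J, ∀ R ∈ A, R.1 ≤ Q.1)
    (hstep : ∀ (A' : Finset (ℕ × ℤ × ℤ)) (Q : ℕ × ℤ × ℤ), A' ⊆ A ∪ J → Q ∈ J → Q ∉ A' →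
      (∀ R ∈ A', R.1 ≤ Q.1) → ‖Φ (insert Q A') - Φ A'‖ₑ ≤ β Q) :
    ‖Φ (A ∪ J) - Φ A‖ₑ ≤ ∑ Q ∈ J, β Q := by
  classical
  induction J using Finset.induction_on_max_value (fun Q : ℕ × ℤ × ℤ => Q.1) with
  | empty => simp
  | insert Q J hQ hmax ih =>
    rw [Finset.sum_insert hQ]
    rw [Finset.disjoint_insert_right] at hdisj
    have hsub : A ∪ J ⊆ A ∪ insert Q J := Finset.union_subset_union_right (Finset.subset_insert Q J)
    have h1 := ih hdisj.2 (fun R hR => hAJ R (Finset.mem_insert_of_mem hR))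
      fun A' R hA' hR => hstep A' R (hA'.trans hsub) (Finset.mem_insert_of_mem hR)
    have h2 := hstep (A ∪ J) Q hsub (Finset.mem_insert_self Q J) (by simp [hdisj.1, hQ]) (by
      intro R hR
      rcases Finset.mem_union.1 hR with h | h
      exacts [hAJ Q (Finset.mem_insert_self Q J) R h, hmax R h])
    rw [Finset.union_insert]
    calc _ = ‖(Φ (insert Q (A ∪ J)) - Φ (A ∪ J)) + (Φ (A ∪ J) - Φ A)‖ₑ := by
          rw [sub_add_sub_cancel]
      _ ≤ _ := (enorm_add_le _ _).trans (add_le_add h2 h1)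

/-! ### The Cauchy pairing -/

/-- The pairing `∫ (∂φ/∂x + i ∂φ/∂y) f(z) (z - x₀)^{-(t+1)} dA`. By Cauchy's formula it is a multiple
of `f^{(t)}(x₀)` if `φ = 1` near `x₀` and `f` is holomorphic near the support of `φ`. -/
noncomputable def cauchyPairing (x₀ : ℂ) (t : ℕ) (f φ : ℂ → ℂ) : ℂ :=
  ∫ z, dbar φ z * (f z * (z - x₀)⁻¹ ^ (t + 1))

lemma continuousOn_inv_pow (x₀ : ℂ) (n : ℕ) : ContinuousOn (fun z : ℂ => (z - x₀)⁻¹ ^ n) {x₀}ᶜ :=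
  ((continuous_id.sub continuous_const).continuousOn.inv₀ fun _ hz => sub_ne_zero.2 hz).pow n

lemma integrable_cauchyPairing {x₀ : ℂ} {t : ℕ} {f φ : ℂ → ℂ} (hf : LocallyIntegrable f volume)
    (hφ : ContDiff ℝ 1 φ) (hc : HasCompactSupport φ) (hx : x₀ ∉ tsupport (dbar φ)) :
    Integrable fun z => dbar φ z * (f z * (z - x₀)⁻¹ ^ (t + 1)) := by
  have hc' : HasCompactSupport (dbar φ) :=
    hc.mono' ((subset_tsupport _).trans (tsupport_dbar_subset φ))
  have h1 : Continuous fun z => dbar φ z * (z - x₀)⁻¹ ^ (t + 1) :=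
    continuous_mul_of_tsupport_subset (continuous_dbar hφ) isOpen_compl_singleton
      (subset_compl_singleton_iff.2 hx) (continuousOn_inv_pow x₀ _)
  refine (hf.integrable_smul_left_of_hasCompactSupport h1 hc'.mul_right).congr
    (Eventually.of_forall fun z => ?_)
  simp only [smul_eq_mul]
  ring

lemma cauchyPairing_sub_left {x₀ : ℂ} {t : ℕ} {f g φ : ℂ → ℂ} (hf : LocallyIntegrable f volume)
    (hg : LocallyIntegrable g volume) (hφ : ContDiff ℝ 1 φ) (hc : HasCompactSupport φ)
    (hx : x₀ ∉ tsupport (dbar φ)) :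
    cauchyPairing x₀ t (fun z => f z - g z) φ = cauchyPairing x₀ t f φ - cauchyPairing x₀ t g φ := by
  rw [cauchyPairing, cauchyPairing, cauchyPairing,
    ← integral_sub (integrable_cauchyPairing hf hφ hc hx) (integrable_cauchyPairing hg hφ hc hx)]
  congr 1
  ext z
  ring

lemma cauchyPairing_sub_right {x₀ : ℂ} {t : ℕ} {f φ ψ : ℂ → ℂ} (hf : LocallyIntegrable f volume)
    (hφ : ContDiff ℝ 1 φ) (hc : HasCompactSupport φ) (hx : x₀ ∉ tsupport (dbar φ))
    (hψ : ContDiff ℝ 1 ψ) (hc' : HasCompactSupport ψ) (hx' : x₀ ∉ tsupport (dbar ψ)) :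
    cauchyPairing x₀ t f (fun z => φ z - ψ z) = cauchyPairing x₀ t f φ - cauchyPairing x₀ t f ψ := by
  rw [cauchyPairing, cauchyPairing, cauchyPairing,
    ← integral_sub (integrable_cauchyPairing hf hφ hc hx) (integrable_cauchyPairing hf hψ hc' hx')]
  congr 1
  ext z
  rw [dbar_sub (hφ.differentiable (by norm_num) z) (hψ.differentiable (by norm_num) z)]
  ring

/-- Test functions supported away from `x₀` do not see constants. -/
lemma cauchyPairing_const_eq_zero {x₀ : ℂ} {t : ℕ} {φ : ℂ → ℂ} (c : ℂ) (hφ : ContDiff ℝ 1 φ)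
    (hc : HasCompactSupport φ) (hx : x₀ ∉ tsupport φ) : cauchyPairing x₀ t (fun _ => c) φ = 0 := by
  refine integral_dbar_mul_eq_zero hφ hc isOpen_compl_singleton (subset_compl_singleton_iff.2 hx) ?_
  refine (differentiableOn_const c).mul (DifferentiableOn.pow (DifferentiableOn.inv
    (differentiableOn_id.sub_const x₀) fun z hz => sub_ne_zero.2 hz) _)

lemma enorm_cauchyPairing_le {x₀ : ℂ} {t : ℕ} {f φ : ℂ → ℂ} {A : Set ℂ} (hA : MeasurableSet A)
    {K W : ℝ≥0∞} (hKt : K ≠ ⊤) (hWt : W ≠ ⊤) (hK : ∀ z ∈ A, ‖dbar φ z‖ₑ ≤ K)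
    (h0 : ∀ z ∉ A, dbar φ z = 0) (hW : ∀ z ∈ A, ‖(z - x₀)⁻¹‖ₑ ^ (t + 1) ≤ W) :
    ‖cauchyPairing x₀ t f φ‖ₑ ≤ K * W * ∫⁻ z in A, ‖f z‖ₑ := by
  rw [← lintegral_const_mul' _ _ (ENNReal.mul_ne_top hKt hWt), ← lintegral_indicator hA]
  refine (enorm_integral_le_lintegral_enorm _).trans (lintegral_mono fun z => ?_)
  by_cases hz : z ∈ A
  · rw [indicator_of_mem hz, enorm_mul, enorm_mul, enorm_pow, mul_comm ‖f z‖ₑ, ← mul_assoc]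
    gcongr
    exacts [hK z hz, hW z hz]
  · rw [h0 z hz, zero_mul, enorm_zero]
    exact zero_le

/-- Near a square that is small compared with its distance from `x₀`, the kernel is comparable with its
size at the centre. -/
lemma enorm_inv_pow_le_weight {x₀ z : ℂ} {t : ℕ} {Q : ℕ × ℤ × ℤ}
    (hQ : 8 * side Q ≤ ‖center Q - x₀‖) (hz : ‖z - center Q‖ ≤ 2 * side Q) :
    ‖(z - x₀)⁻¹‖ₑ ^ (t + 1) ≤ 2 ^ (t + 1) * weight x₀ t Q := by
  rw [weight, ← mul_pow]
  refine pow_le_pow_left' ?_ _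
  have hs := side_pos Q
  have hd : 0 < ‖center Q - x₀‖ := by linarith
  have h1 : ‖center Q - x₀‖ ≤ ‖z - center Q‖ + ‖z - x₀‖ := by
    rw [norm_sub_rev z (center Q)]
    exact norm_sub_le_norm_sub_add_norm_sub _ _ _
  have h2 : ‖center Q - x₀‖ / 2 ≤ ‖z - x₀‖ := by linarith
  rw [← ofReal_norm, ← ofReal_norm (center Q - x₀), ← ENNReal.ofReal_inv_of_pos hd,
    ← ENNReal.ofReal_ofNat 2, ← ENNReal.ofReal_mul (by norm_num)]
  refine ENNReal.ofReal_le_ofReal ?_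
  rw [norm_inv]
  calc ‖z - x₀‖⁻¹ ≤ (‖center Q - x₀‖ / 2)⁻¹ := inv_anti₀ (by positivity) h2
    _ = _ := by rw [inv_div]; rfl

lemma weight_ne_top {x₀ : ℂ} {t : ℕ} {Q : ℕ × ℤ × ℤ} (hQ : 8 * side Q ≤ ‖center Q - x₀‖) :
    weight x₀ t Q ≠ ⊤ := by
  refine ENNReal.pow_ne_top (ENNReal.inv_ne_top.2 ?_)
  rw [enorm_ne_zero, ← norm_ne_zero_iff]
  linarith [side_pos Q]

lemma notMem_tsupport_dbar_of_eventuallyEq_one {φ : ℂ → ℂ} {x₀ : ℂ} (h : φ =ᶠ[𝓝 x₀] fun _ => 1) :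
    x₀ ∉ tsupport (dbar φ) := by
  refine notMem_tsupport_iff_eventuallyEq.2 ?_
  filter_upwards [h.eventually_nhds] with z hz
  exact dbar_eq_zero_of_eventuallyEq_const hz

/-- The change of the pairing when one square is added to the cutoff: it involves only the
oscillation of `f` near that square. -/
lemma enorm_cauchyPairing_insert_sub_le {B : ℝ} (hB : ∀ (c : ℂ) (R : ℝ) (z : ℂ), 0 < R →
    ‖dbar (bump c R) z‖ ≤ B / R) (hB0 : 0 ≤ B) {x₀ : ℂ} {t : ℕ} {f : ℂ → ℂ}
    (hf : LocallyIntegrable f volume) {J : Finset (ℕ × ℤ × ℤ)} {Q : ℕ × ℤ × ℤ} (hQJ : Q ∉ J)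
    (hJ : ∀ R ∈ J, R.1 ≤ Q.1) (hsJ : ∀ R ∈ J, 8 * side R ≤ ‖center R - x₀‖)
    (hsQ : 8 * side Q ≤ ‖center Q - x₀‖) (c : ℂ) :
    ‖cauchyPairing x₀ t f (cutoff x₀ (insert Q J)) - cauchyPairing x₀ t f (cutoff x₀ J)‖ₑ ≤
      ENNReal.ofReal (30 * B / side Q) * (2 ^ (t + 1) * weight x₀ t Q) *
        ∫⁻ z in Metric.closedBall (center Q) (2 * side Q) ∩ Metric.closedBall x₀ (1 / 4),
          ‖f z - c‖ₑ := by
  set φ : ℂ → ℂ := fun z => cutoff x₀ J z * cubeBump Q z with hφ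
  have hφd : ContDiff ℝ 1 φ := (contDiff_cutoff x₀ J).mul (contDiff_bump _ _)
  have hφc : HasCompactSupport φ := (hasCompactSupport_cutoff x₀ J).mul_right
  have hφs : tsupport φ ⊆ Metric.closedBall (center Q) (2 * side Q) ∩ Metric.closedBall x₀ (1 / 4) :=
    subset_inter ((closure_mono (Function.support_mul_subset_right _ _)).trans
        (tsupport_bump_subset (two_side_pos Q)))
      ((closure_mono (Function.support_mul_subset_left _ _)).trans (tsupport_cutoff_subset x₀ J))
  have hx₀ : x₀ ∉ tsupport φ := by
    intro h
    have := (hφs h).1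
    rw [Metric.mem_closedBall, dist_eq_norm, norm_sub_rev] at this
    linarith [side_pos Q]
  have hx₀' : x₀ ∉ tsupport (dbar φ) := fun h => hx₀ (tsupport_dbar_subset φ h)
  have hone := cutoff_eventuallyEq_one hsJ
  have h1 : cauchyPairing x₀ t f (cutoff x₀ (insert Q J)) - cauchyPairing x₀ t f (cutoff x₀ J) =
      -cauchyPairing x₀ t (fun z => f z - c) φ := by
    rw [cauchyPairing_sub_left hf (locallyIntegrable_const c) hφd hφc hx₀',
      cauchyPairing_const_eq_zero c hφd hφc hx₀, sub_zero,
      show cutoff x₀ (insert Q J) = fun z => cutoff x₀ J z - φ z from funext (cutoff_insert hQJ),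
      cauchyPairing_sub_right hf (contDiff_cutoff x₀ J) (hasCompactSupport_cutoff x₀ J)
        (notMem_tsupport_dbar_of_eventuallyEq_one hone) hφd hφc hx₀']
    ring
  rw [h1, enorm_neg]
  refine enorm_cauchyPairing_le (Metric.isClosed_closedBall.measurableSet.inter
    Metric.isClosed_closedBall.measurableSet) ENNReal.ofReal_ne_top
    (ENNReal.mul_ne_top (by finiteness) (weight_ne_top hsQ)) (fun z _ => ?_) (fun z hz => ?_)
    fun z hz => ?_
  · rw [← ofReal_norm]
    exact ENNReal.ofReal_le_ofReal (norm_dbar_cutoff_mul_cubeBump_le hB hB0 hJ z)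
  · exact dbar_eq_zero_of_notMem_tsupport fun h => hz (hφs h)
  · refine enorm_inv_pow_le_weight hsQ ?_
    rw [← dist_eq_norm]
    exact hz.1

/-! ### Comparison of two functions that agree on a large set -/

lemma volume_cube (Q : ℕ × ℤ × ℤ) : volume (cube Q) = ENNReal.ofReal (side Q ^ 2) := by
  have hs := side_pos Q
  have := Complex.volume_preserving_equiv_real_prod.measure_preimage
    (measurableSet_Ico.prod measurableSet_Ico : MeasurableSet
      (Ico (corner Q).re ((corner Q).re + side Q) ×ˢ
        Ico (corner Q).im ((corner Q).im + side Q))).nullMeasurableSet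
  rw [show cube Q = Complex.measurableEquivRealProd ⁻¹'
    (Ico (corner Q).re ((corner Q).re + side Q) ×ˢ Ico (corner Q).im ((corner Q).im + side Q)) from
      Set.ext fun z => mem_cube_iff', this, Measure.volume_eq_prod,
    Measure.prod_prod, Real.volume_Ico, Real.volume_Ico, add_sub_cancel_left, add_sub_cancel_left,
    ← ENNReal.ofReal_mul hs.le, sq]

/-- If `f` and `F` agree on at least half of a square and have small mean oscillation there, then they
are close in the mean on the whole square. -/
lemma setLIntegral_cube_sub_le {f F : ℂ → ℂ} (hf : LocallyIntegrable f volume)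
    (hF : LocallyIntegrable F volume) {X : Set ℂ} (hX : MeasurableSet X) (hfF : EqOn F f X)
    {R : ℕ × ℤ × ℤ} {m : ℝ≥0} (hfm : meanOsc f (square (corner R) (side R)) ≤ m)
    (hFm : meanOsc F (square (corner R) (side R)) ≤ m)
    (hR : 2 * volume (cube R \ X) ≤ volume (cube R)) :
    ∫⁻ z in cube R, ‖f z - F z‖ₑ ≤ 6 * m * volume (cube R) := by
  set D : ℂ → ℂ := fun z => f z - F z with hD
  set c : ℂ := ⨍ w in square (corner R) (side R), D w with hc
  set I : ℝ≥0∞ := ∫⁻ z in cube R, ‖D z - c‖ₑ with hI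
  have hvol : volume (cube R) ≠ ⊤ := by rw [volume_cube]; exact ENNReal.ofReal_ne_top
  have hI1 : I ≤ 2 * m * volume (cube R) := by
    calc I ≤ ∫⁻ z in square (corner R) (side R), ‖D z - c‖ₑ :=
          lintegral_mono_set (cube_subset_square R)
      _ = volume (cube R) * meanOsc D (square (corner R) (side R)) := by
          rw [volume_cube]; exact lintegral_sub_average_eq D (corner R) (side_pos R)
      _ ≤ volume (cube R) * (m + m) := by
          gcongr
          exact (meanOsc_sub_le hf hF _ _).trans (add_le_add hfm hFm)
      _ = _ := by ring
  have hhalf : volume (cube R) ≤ 2 * volume (cube R ∩ X) := by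
    have h1 := measure_inter_add_sdiff (μ := volume) (cube R) hX
    have h2 : volume (cube R \ X) ≠ ⊤ := ne_top_of_le_ne_top hvol (measure_mono sdiff_subset)
    have h3 : volume (cube R \ X) ≤ volume (cube R ∩ X) := by
      rw [← h1, two_mul] at hR
      exact (ENNReal.add_le_add_iff_right h2).1 hR
    rw [← h1, two_mul]
    gcongr
  have hcI : ‖c‖ₑ * volume (cube R) ≤ 2 * I := by
    have hcX : ‖c‖ₑ * volume (cube R ∩ X) ≤ I := by
      rw [← setLIntegral_const]
      refine (setLIntegral_mono' ((measurableSet_cube R).inter hX) fun z hz => ?_).trans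
        (lintegral_mono_set inter_subset_left)
      rw [show D z = 0 by simp only [hD]; rw [hfF hz.2, sub_self], zero_sub, enorm_neg]
    calc ‖c‖ₑ * volume (cube R) ≤ ‖c‖ₑ * (2 * volume (cube R ∩ X)) := by gcongr
      _ = 2 * (‖c‖ₑ * volume (cube R ∩ X)) := by ring
      _ ≤ 2 * I := by gcongr
  calc ∫⁻ z in cube R, ‖D z‖ₑ ≤ ∫⁻ z in cube R, (‖D z - c‖ₑ + ‖c‖ₑ) := by
        refine lintegral_mono fun z => ?_
        refine le_trans (le_of_eq ?_) (enorm_add_le _ _)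
        rw [sub_add_cancel]
    _ = I + ‖c‖ₑ * volume (cube R) := by
        rw [lintegral_add_right _ measurable_const, setLIntegral_const]
    _ ≤ I + 2 * I := by gcongr
    _ = 3 * I := by ring
    _ ≤ 3 * (2 * m * volume (cube R)) := by gcongr
    _ = _ := by ring

/-- Summation of a bound on dyadic squares of level `k` over the squares that meet a given set. -/
lemma setLIntegral_le_of_cube_le {u : ℂ → ℝ≥0∞} {A : Set ℂ} {p : ℂ} {r : ℝ} {k : ℕ} {M : ℝ≥0∞}
    (hAr : A ⊆ Metric.closedBall p r) (hkr : ((2 : ℝ) ^ k)⁻¹ ≤ r)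
    (hM : ∀ R : ℕ × ℤ × ℤ, R.1 = k → (cube R ∩ A).Nonempty → ∫⁻ z in cube R, u z ≤ M * volume (cube R)) :
    ∫⁻ z in A, u z ≤ M * ENNReal.ofReal (36 * r ^ 2) := by
  set T : Set (ℕ × ℤ × ℤ) := {R | R.1 = k ∧ (cube R ∩ A).Nonempty} with hT
  have hr : 0 < r := lt_of_lt_of_le (by positivity) hkr
  have hcov : A ⊆ ⋃ R : T, cube R := fun z hz =>
    mem_iUnion.2 ⟨⟨(k, cell k z), rfl, z, rfl, hz⟩, mem_cube_cell k z⟩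
  have hdisj : Pairwise (Function.onFun Disjoint fun R : T => cube R) := fun R R' hne =>
    disjoint_cube (R.2.1.trans R'.2.1.symm) fun h => hne (Subtype.ext h)
  have hsub : (⋃ R : T, cube R) ⊆ Metric.closedBall p (3 * r) := by
    refine iUnion_subset fun R z hz => ?_
    obtain ⟨hRk, w, hwR, hwA⟩ := R.2
    have h1 := norm_sub_center_le hz
    have h2 := norm_sub_center_le hwR
    have h3 := hAr hwA
    rw [side, hRk] at h1 h2
    rw [Metric.mem_closedBall, dist_eq_norm] at h3 ⊢
    have h4 : z - p = (z - center R) - (w - center R) + (w - p) := by ring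
    rw [h4]
    refine (norm_add_le _ _).trans ?_
    have := norm_sub_le (z - center R) (w - center R)
    linarith
  calc ∫⁻ z in A, u z ≤ ∫⁻ z in ⋃ R : T, cube R, u z := lintegral_mono_set hcov
    _ ≤ ∑' R : T, ∫⁻ z in cube R, u z := lintegral_iUnion_le _ _
    _ ≤ ∑' R : T, M * volume (cube R) := ENNReal.tsum_le_tsum fun R => hM R R.2.1 R.2.2
    _ = M * volume (⋃ R : T, cube R) := by
        rw [ENNReal.tsum_mul_left, measure_iUnion hdisj fun R => measurableSet_cube R]
    _ ≤ M * volume (square (p - ⟨3 * r, 3 * r⟩) (2 * (3 * r))) := by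
        gcongr
        exact hsub.trans (closedBall_subset_square p _)
    _ = _ := by
        rw [volume_square _ (by positivity)]
        congr 2
        ring

/-! ### The large squares of the covering -/

lemma finite_cubes_near (x₀ : ℂ) (k : ℕ) (r : ℝ) :
    {Q : ℕ × ℤ × ℤ | Q.1 ≤ k ∧ ‖center Q - x₀‖ ≤ r}.Finite := by
  obtain ⟨n, hn⟩ := exists_nat_ge ((‖x₀‖ + r + 1) * 2 ^ k)
  refine Set.Finite.subset (s := ((Finset.range (k + 1) ×ˢ (Finset.Icc (-n : ℤ) n ×ˢ
    Finset.Icc (-n : ℤ) n) : Finset (ℕ × ℤ × ℤ)) : Set (ℕ × ℤ × ℤ))) (Finset.finite_toSet _) ?_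
  rintro ⟨j, a, b⟩ ⟨hj, hc⟩
  have h1 := norm_sub_center_le (corner_mem_cube (j, a, b))
  have h2 : ‖corner (j, a, b)‖ ≤ ‖x₀‖ + r + 1 := by
    have h3 : corner (j, a, b) = (corner (j, a, b) - center (j, a, b)) +
      ((center (j, a, b) - x₀) + x₀) := by ring
    rw [h3]
    refine (norm_add_le _ _).trans ?_
    have := norm_add_le (center (j, a, b) - x₀) x₀
    have := side_le_one (j, a, b)
    linarith
  have hpos : (0 : ℝ) < 2 ^ j := by positivity
  have hjk : (2 : ℝ) ^ j ≤ 2 ^ k := pow_le_pow_right₀ (by norm_num) hj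
  have key : ∀ i : ℤ, |(i : ℝ) / 2 ^ j| ≤ ‖corner (j, a, b)‖ → i ∈ Finset.Icc (-n : ℤ) n := by
    intro i hi
    rw [abs_div, abs_of_pos hpos, div_le_iff₀ hpos] at hi
    have h4 : |(i : ℝ)| ≤ n := by
      refine hi.trans ((mul_le_mul h2 hjk hpos.le ?_).trans hn)
      exact (norm_nonneg _).trans h2
    rw [Finset.mem_Icc, ← abs_le]
    exact_mod_cast h4
  simp only [Finset.coe_product, mem_prod, Finset.mem_coe, Finset.mem_range]
  exact ⟨Nat.lt_succ_of_le hj, key a (Complex.abs_re_le_norm (corner (j, a, b))),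
    key b (Complex.abs_im_le_norm (corner (j, a, b)))⟩

lemma sum_le_tsum_subtype {V : Set (ℕ × ℤ × ℤ)} {s : Finset (ℕ × ℤ × ℤ)} (hs : ∀ Q ∈ s, Q ∈ V)
    (u : ℕ × ℤ × ℤ → ℝ≥0∞) : ∑ Q ∈ s, u Q ≤ ∑' Q : V, u Q := by
  rw [← Finset.tsum_subtype' s u]
  exact ENNReal.tsum_mono_subtype u hs

lemma sum_tsum_le_of_disjoint {V : Set (ℕ × ℤ × ℤ)} (s : Finset (ℕ × ℤ × ℤ))
    {W : ℕ × ℤ × ℤ → Set (ℕ × ℤ × ℤ)} (hW : ∀ R ∈ s, W R ⊆ V)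
    (hdisj : ∀ R ∈ s, ∀ R' ∈ s, R ≠ R' → Disjoint (W R) (W R')) (u : ℕ × ℤ × ℤ → ℝ≥0∞) :
    ∑ R ∈ s, ∑' Q : W R, u Q ≤ ∑' Q : V, u Q := by
  simp only [tsum_subtype]
  rw [← Summable.tsum_finsetSum fun _ _ => ENNReal.summable]
  refine ENNReal.tsum_le_tsum fun Q => ?_
  by_cases h : ∃ R ∈ s, Q ∈ W R
  · obtain ⟨R, hR, hQ⟩ := h
    rw [Finset.sum_eq_single_of_mem R hR fun R' hR' hne => indicator_of_notMem
      (fun hQ' => Set.disjoint_left.1 (hdisj R' hR' R hR hne) hQ' hQ) _, indicator_of_mem hQ,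
      indicator_of_mem (hW R hR hQ)]
  · rw [Finset.sum_eq_zero fun R hR => indicator_of_notMem (fun hQ => h ⟨R, hR, hQ⟩) _]
    exact zero_le

lemma weight_le_of_norm_le {x₀ : ℂ} {t : ℕ} {Q R : ℕ × ℤ × ℤ}
    (h : ‖center Q - x₀‖ ≤ 2 * ‖center R - x₀‖) :
    weight x₀ t R ≤ 2 ^ (t + 1) * weight x₀ t Q := by
  rw [weight, weight, ← mul_pow]
  refine pow_le_pow_left' ?_ _
  have h1 : ‖center Q - x₀‖ₑ ≤ 2 * ‖center R - x₀‖ₑ := by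
    rw [← ofReal_norm, ← ofReal_norm, ← ENNReal.ofReal_ofNat 2, ← ENNReal.ofReal_mul (by norm_num)]
    exact ENNReal.ofReal_le_ofReal h
  calc ‖center R - x₀‖ₑ⁻¹ = 2 * (2 * ‖center R - x₀‖ₑ)⁻¹ := by
        rw [ENNReal.mul_inv (Or.inl (by simp)) (Or.inl (by simp)), ← mul_assoc,
          ENNReal.mul_inv_cancel (by simp) (by simp), one_mul]
    _ ≤ 2 * ‖center Q - x₀‖ₑ⁻¹ := by gcongr

/-- From a covering `V` of the complement of `X` near `x₀` we extract a finite family of squares of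
side at least `2⁻ᵏ`. It consists of the large squares of `V` and of those squares `R` of level `k` that
are not half filled by `X`. The latter are charged to the squares of `V` that they contain: by
`h(s) ≥ s² / δ` these have total cost comparable with `δ = 2⁻ᵏ`. -/
lemma exists_large_squares {X : Set ℂ} {x₀ : ℂ} {t k : ℕ} {δ : ℝ} (hδ : δ = (2 ^ k)⁻¹)
    {h : ℝ≥0 → ℝ≥0} {V : Set (ℕ × ℤ × ℤ)} {S : ℝ≥0∞}
    (hV : ∀ Q ∈ V, 8 * side Q ≤ ‖center Q - x₀‖ ∧ ‖center Q - x₀‖ ≤ 1)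
    (hcov : (Metric.closedBall x₀ (1 / 2) \ {x₀}) \ X ⊆ cover V)
    (hS : ∑' Q : V, weight x₀ t Q * h (nnside Q) ≤ S)
    (h1 : ∀ s : ℝ≥0, δ ≤ s → h s = s) (h2 : ∀ s : ℝ≥0, s ≤ δ → (s * s : ℝ) ≤ δ * h s)
    (hdens : ∀ R : ℕ × ℤ × ℤ, R.1 = k → ‖center R - x₀‖ ≤ 1024 * δ →
      2 * volume (cube R \ X) ≤ volume (cube R)) :
    ∃ G : Finset (ℕ × ℤ × ℤ),
      (∀ Q ∈ G, Q.1 ≤ k ∧ 8 * side Q ≤ ‖center Q - x₀‖ ∧ 128 * δ ≤ ‖center Q - x₀‖) ∧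
      (∀ Q ∈ V, Q.1 ≤ k → 128 * δ ≤ ‖center Q - x₀‖ → Q ∈ G) ∧
      ∑ Q ∈ G, weight x₀ t Q * nnside Q ≤ (1 + 2 ^ (t + 2)) * S ∧
      ∀ R : ℕ × ℤ × ℤ, R.1 = k → ‖center R - x₀‖ ≤ 3 / 8 → ¬ cube R ⊆ cover G →
        2 * volume (cube R \ X) ≤ volume (cube R) := by
  classical
  have hδ0 : 0 < δ := by rw [hδ]; positivity
  have hside : ∀ {Q : ℕ × ℤ × ℤ}, Q.1 = k → side Q = δ := fun hQ => by rw [side, hQ, hδ]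
  set G₁ : Set (ℕ × ℤ × ℤ) := {Q | Q ∈ V ∧ Q.1 ≤ k ∧ 128 * δ ≤ ‖center Q - x₀‖} with hG₁
  have hG₁fin : G₁.Finite := (finite_cubes_near x₀ k 1).subset fun Q hQ => ⟨hQ.2.1, (hV Q hQ.1).2⟩
  set G₂ : Set (ℕ × ℤ × ℤ) := {R | R.1 = k ∧ ‖center R - x₀‖ ≤ 3 / 8 ∧
    volume (cube R) < 2 * volume (cube R \ X) ∧ ∀ Q ∈ G₁, ¬ cube R ⊆ cube Q} with hG₂
  have hG₂fin : G₂.Finite := (finite_cubes_near x₀ k (3 / 8)).subset fun R hR => ⟨hR.1.le, hR.2.1⟩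
  have hG₂far : ∀ R ∈ G₂, 1024 * δ < ‖center R - x₀‖ := fun R hR => by
    by_contra! hle
    exact absurd (hdens R hR.1 hle) (not_le.2 hR.2.2.1)
  set W : ℕ × ℤ × ℤ → Set (ℕ × ℤ × ℤ) := fun R => {Q | Q ∈ V ∧ k < Q.1 ∧ cube Q ⊆ cube R} with hW
  have hcovR : ∀ R ∈ G₂, cube R \ X ⊆ ⋃ Q : W R, cube Q := by
    intro R hR z hz
    have hfar := hG₂far R hR
    have hzR := norm_sub_center_le hz.1
    rw [hside hR.1] at hzR
    have hz1 : ‖center R - x₀‖ ≤ ‖z - center R‖ + ‖z - x₀‖ := by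
      rw [norm_sub_rev z (center R)]
      exact norm_sub_le_norm_sub_add_norm_sub _ _ _
    have hz2 : ‖z - x₀‖ ≤ ‖z - center R‖ + ‖center R - x₀‖ := norm_sub_le_norm_sub_add_norm_sub _ _ _
    obtain ⟨Q, hQ, hzQ⟩ := mem_cover.1 (hcov (show z ∈ (Metric.closedBall x₀ (1 / 2) \ {x₀}) \ X from by
      refine ⟨⟨?_, ?_⟩, hz.2⟩
      · rw [Metric.mem_closedBall, dist_eq_norm]
        linarith [hR.2.1]
      · intro h0
        rw [mem_singleton_iff] at h0
        rw [h0, sub_self, norm_zero] at hz1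
        rw [h0] at hzR
        linarith))
    rcases le_or_gt Q.1 k with hQk | hQk
    · -- A square of `V` that contains `R` would be large and far from `x₀`.
      refine absurd (cube_subset_of_mem hz.1 hzQ (hQk.trans hR.1.ge)) (hR.2.2.2 Q ⟨hQ, hQk, ?_⟩)
      have hzQ' := norm_sub_center_le hzQ
      have := (hV Q hQ).1
      have hz3 : ‖z - x₀‖ ≤ ‖z - center Q‖ + ‖center Q - x₀‖ := norm_sub_le_norm_sub_add_norm_sub _ _ _
      linarith
    · exact mem_iUnion.2 ⟨⟨Q, hQ, hQk, cube_subset_of_mem hzQ hz.1 (hR.1.le.trans hQk.le)⟩, hzQ⟩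
  have hcostR : ∀ R ∈ G₂, weight x₀ t R * nnside R ≤
      2 ^ (t + 2) * ∑' Q : W R, weight x₀ t Q * h (nnside Q) := by
    intro R hR
    have hδe : ENNReal.ofReal δ ≠ 0 := by simpa using hδ0
    have hvol : ENNReal.ofReal δ * nnside R ≤
        ENNReal.ofReal δ * (2 * ∑' Q : W R, (h (nnside Q) : ℝ≥0∞)) := by
      calc ENNReal.ofReal δ * nnside R = volume (cube R) := by
            rw [volume_cube, ← ENNReal.ofReal_coe_nnreal, coe_nnside, hside hR.1,
              ← ENNReal.ofReal_mul hδ0.le, sq]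
        _ ≤ 2 * volume (cube R \ X) := hR.2.2.1.le
        _ ≤ 2 * ∑' Q : W R, volume (cube Q) := by
            gcongr
            exact (measure_mono (hcovR R hR)).trans (measure_iUnion_le _)
        _ ≤ 2 * ∑' Q : W R, ENNReal.ofReal δ * h (nnside Q) := by
            gcongr with Q
            have hQδ : side Q ≤ δ := by
              rw [side, hδ]
              exact inv_anti₀ (by positivity) (pow_le_pow_right₀ (by norm_num) Q.2.2.1.le)
            rw [volume_cube, ← ENNReal.ofReal_coe_nnreal, ← ENNReal.ofReal_mul hδ0.le]
            refine ENNReal.ofReal_le_ofReal ?_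
            have := h2 (nnside Q) (by rwa [coe_nnside])
            rwa [coe_nnside, ← sq] at this
        _ = _ := by rw [ENNReal.tsum_mul_left]; ring
    rw [ENNReal.mul_le_mul_iff_right hδe ENNReal.ofReal_ne_top] at hvol
    calc weight x₀ t R * nnside R ≤ weight x₀ t R * (2 * ∑' Q : W R, (h (nnside Q) : ℝ≥0∞)) := by
          gcongr
      _ = 2 * ∑' Q : W R, weight x₀ t R * h (nnside Q) := by rw [ENNReal.tsum_mul_left]; ring
      _ ≤ 2 * ∑' Q : W R, 2 ^ (t + 1) * (weight x₀ t Q * h (nnside Q)) := by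
          refine mul_le_mul_right (ENNReal.tsum_le_tsum fun Q => ?_) 2
          rw [← mul_assoc]
          refine mul_le_mul_left (weight_le_of_norm_le ?_) _
          have h3 := norm_sub_center_le (Q.2.2.2 (corner_mem_cube Q))
          have h4 := norm_sub_center_le (corner_mem_cube Q)
          have h5 : center Q - x₀ = (corner Q - center R) - (corner Q - center Q) + (center R - x₀) := by
            ring
          have hQδ : side Q ≤ δ := by
            rw [side, hδ]
            exact inv_anti₀ (by positivity) (pow_le_pow_right₀ (by norm_num) Q.2.2.1.le)
          rw [hside hR.1] at h3
          rw [h5]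
          refine (norm_add_le _ _).trans ?_
          have := norm_sub_le (corner Q - center R) (corner Q - center Q)
          linarith [hG₂far R hR]
      _ = _ := by rw [ENNReal.tsum_mul_left]; ring
  refine ⟨hG₁fin.toFinset ∪ hG₂fin.toFinset, ?_, ?_, ?_, ?_⟩
  · intro Q hQ
    rcases Finset.mem_union.1 hQ with hQ | hQ
    · have hQ' := hG₁fin.mem_toFinset.1 hQ
      exact ⟨hQ'.2.1, (hV Q hQ'.1).1, hQ'.2.2⟩
    · have hQ' := hG₂fin.mem_toFinset.1 hQ
      have := hG₂far Q hQ'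
      refine ⟨hQ'.1.le, ?_, by linarith⟩
      rw [hside hQ'.1]
      linarith
  · intro Q hQV hQk hQ
    exact Finset.mem_union_left _ (hG₁fin.mem_toFinset.2 ⟨hQV, hQk, hQ⟩)
  · refine (le_self_add.trans_eq Finset.sum_union_inter).trans ?_
    rw [add_mul, one_mul]
    refine add_le_add ?_ ?_
    · calc ∑ Q ∈ hG₁fin.toFinset, weight x₀ t Q * nnside Q
          = ∑ Q ∈ hG₁fin.toFinset, weight x₀ t Q * h (nnside Q) := by
            refine Finset.sum_congr rfl fun Q hQ => ?_
            rw [h1 (nnside Q)]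
            rw [coe_nnside, side, hδ]
            exact inv_anti₀ (by positivity)
              (pow_le_pow_right₀ (by norm_num) (hG₁fin.mem_toFinset.1 hQ).2.1)
        _ ≤ ∑' Q : V, weight x₀ t Q * h (nnside Q) :=
            sum_le_tsum_subtype (fun Q hQ => (hG₁fin.mem_toFinset.1 hQ).1)
              fun Q => weight x₀ t Q * h (nnside Q)
        _ ≤ S := hS
    · calc ∑ R ∈ hG₂fin.toFinset, weight x₀ t R * nnside R
          ≤ ∑ R ∈ hG₂fin.toFinset, 2 ^ (t + 2) * ∑' Q : W R, weight x₀ t Q * h (nnside Q) :=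
            Finset.sum_le_sum fun R hR => hcostR R (hG₂fin.mem_toFinset.1 hR)
        _ ≤ 2 ^ (t + 2) * S := by
            rw [← Finset.mul_sum]
            gcongr
            refine (sum_tsum_le_of_disjoint hG₂fin.toFinset (fun R _ Q hQ => hQ.1) ?_
              fun Q => weight x₀ t Q * h (nnside Q)).trans hS
            intro R hR R' hR' hne
            refine Set.disjoint_left.2 fun Q hQ hQ' => hne ?_
            exact eq_of_mem_cube (hQ.2.2 (corner_mem_cube Q)) (hQ'.2.2 (corner_mem_cube Q))
              ((hG₂fin.mem_toFinset.1 hR).1.trans (hG₂fin.mem_toFinset.1 hR').1.symm)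
  · intro R hRk hR hRG
    by_contra! hlt
    refine hRG ?_
    by_cases hex : ∃ Q ∈ G₁, cube R ⊆ cube Q
    · obtain ⟨Q, hQ, hRQ⟩ := hex
      refine fun z hz => mem_cover.2 ⟨Q, ?_, hRQ hz⟩
      exact Finset.mem_coe.2 (Finset.mem_union_left _ (hG₁fin.mem_toFinset.2 hQ))
    · push Not at hex
      refine fun z hz => mem_cover.2 ⟨R, ?_, hz⟩
      exact Finset.mem_coe.2 (Finset.mem_union_right _ (hG₂fin.mem_toFinset.2 ⟨hRk, hR, hlt, hex⟩))

/-! ### Convergence of the series gives a bounded point derivation -/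

/-- Adding the squares of `J` to the cutoff by decreasing size changes the pairing by a sum over `J`. -/
lemma enorm_cauchyPairing_union_sub_le {B : ℝ} (hB : ∀ (c : ℂ) (R : ℝ) (z : ℂ), 0 < R →
    ‖dbar (bump c R) z‖ ≤ B / R) (hB0 : 0 ≤ B) {x₀ : ℂ} {t : ℕ} {g : ℂ → ℂ}
    (hg : LocallyIntegrable g volume) {A J : Finset (ℕ × ℤ × ℤ)} (hdisj : Disjoint A J)
    (hAJ : ∀ Q ∈ J, ∀ R ∈ A, R.1 ≤ Q.1) (hs : ∀ Q ∈ A ∪ J, 8 * side Q ≤ ‖center Q - x₀‖)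
    {β : ℕ × ℤ × ℤ → ℝ≥0∞} (hβ : ∀ Q ∈ J, ∃ c : ℂ,
      ∫⁻ z in Metric.closedBall (center Q) (2 * side Q) ∩ Metric.closedBall x₀ (1 / 4),
        ‖g z - c‖ₑ ≤ nnside Q * β Q) :
    ‖cauchyPairing x₀ t g (cutoff x₀ (A ∪ J)) - cauchyPairing x₀ t g (cutoff x₀ A)‖ₑ ≤
      ENNReal.ofReal (30 * B) * 2 ^ (t + 1) * ∑ Q ∈ J, weight x₀ t Q * β Q := by
  refine (enorm_sub_le_sum_of_step (Φ := fun J => cauchyPairing x₀ t g (cutoff x₀ J))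
    (β := fun Q => ENNReal.ofReal (30 * B) * 2 ^ (t + 1) * (weight x₀ t Q * β Q)) hdisj hAJ
    fun A' Q hA' hQ hQA' hlev => ?_).trans_eq (Finset.mul_sum _ _ _).symm
  obtain ⟨c, hc⟩ := hβ Q hQ
  refine (enorm_cauchyPairing_insert_sub_le hB hB0 hg hQA' hlev (fun R hR => hs R (hA' hR))
    (hs Q (Finset.mem_union_right _ hQ)) c).trans ((mul_le_mul_right hc _).trans (le_of_eq ?_))
  have hside := side_pos Q
  have h1 : ENNReal.ofReal (30 * B / side Q) * nnside Q = ENNReal.ofReal (30 * B) := by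
    rw [← ENNReal.ofReal_coe_nnreal, coe_nnside, ← ENNReal.ofReal_mul (by positivity),
      div_mul_cancel₀ _ hside.ne']
  rw [← h1]
  ring

lemma enorm_cauchyPairing_empty_le {B : ℝ} (hB : ∀ (c : ℂ) (R : ℝ) (z : ℂ), 0 < R →
    ‖dbar (bump c R) z‖ ≤ B / R) (x₀ : ℂ) (t : ℕ) (g : ℂ → ℂ) :
    ‖cauchyPairing x₀ t g (cutoff x₀ ∅)‖ₑ ≤ ENNReal.ofReal (4 * B) * 8 ^ (t + 1) *
      ∫⁻ z in {z : ℂ | 1 / 8 ≤ ‖z - x₀‖ ∧ ‖z - x₀‖ ≤ 1 / 4}, ‖g z‖ₑ := by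
  have hcut : cutoff x₀ ∅ = bump x₀ (1 / 4) := by
    ext z
    rw [cutoff, Finset.prod_empty, mul_one]
  have hn : Measurable fun z : ℂ => ‖z - x₀‖ := (measurable_id.sub_const x₀).norm
  have hmeas : MeasurableSet {z : ℂ | 1 / 8 ≤ ‖z - x₀‖ ∧ ‖z - x₀‖ ≤ 1 / 4} :=
    (measurableSet_le measurable_const hn).inter (measurableSet_le hn measurable_const)
  rw [hcut]
  refine enorm_cauchyPairing_le hmeas ENNReal.ofReal_ne_top (by finiteness) (fun z _ => ?_)
    (fun z hz => ?_) fun z hz => ?_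
  · rw [← ofReal_norm]
    refine ENNReal.ofReal_le_ofReal ((hB x₀ (1 / 4) z (by norm_num)).trans (le_of_eq ?_))
    ring
  · rcases not_and_or.1 hz with h | h
    · refine dbar_eq_zero_of_eventuallyEq_const (c := 1) ?_
      have ho : IsOpen {w : ℂ | ‖w - x₀‖ < 1 / 8} :=
        isOpen_lt (continuous_id.sub continuous_const).norm continuous_const
      filter_upwards [ho.mem_nhds (not_le.1 h)] with w hw
      refine bump_eq_one (by norm_num) ?_
      have hw' : ‖w - x₀‖ < 1 / 8 := hw
      nlinarith [norm_nonneg (w - x₀)]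
    · refine dbar_eq_zero_of_notMem_tsupport fun h' => h ?_
      have := tsupport_bump_subset (by norm_num) h'
      rwa [Metric.mem_closedBall, dist_eq_norm] at this
  · refine pow_le_pow_left' ?_ _
    rw [← ofReal_norm, ← ENNReal.ofReal_ofNat 8, norm_inv]
    refine ENNReal.ofReal_le_ofReal ?_
    rw [inv_le_comm₀ (by linarith [hz.1]) (by norm_num)]
    linarith [hz.1]

/-- The scale below which `f` is controlled by its modulus of oscillation, and near which `X` fills
half of all squares. -/
lemma exists_scale {X : Set ℂ} {x₀ : ℂ} {f : ℂ → ℂ} {m : ℝ≥0} (hm : 0 < m)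
    (hf : Tendsto (oscModulus f) (𝓝[>] 0) (𝓝 0)) (hfa : AnalyticAt ℂ f x₀)
    (hdens : ∀ ε : ℝ≥0, 0 < ε → ∀ᶠ N : ℕ in atTop,
      volume (Metric.closedBall x₀ (2 ^ N)⁻¹ \ X) ≤ ε * (4 ^ N)⁻¹) :
    ∃ (k : ℕ) (δ : ℝ), δ = (2 ^ k)⁻¹ ∧ 2048 * δ ≤ 1 ∧ oscModulus f (4 * δ) ≤ m ∧
      (∀ z, ‖z - x₀‖ < 256 * δ → AnalyticAt ℂ f z) ∧
      ∀ R : ℕ × ℤ × ℤ, R.1 = k → ‖center R - x₀‖ ≤ 1024 * δ →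
        2 * volume (cube R \ X) ≤ volume (cube R) := by
  have hpow : Tendsto (fun N : ℕ => ((2 : ℝ) ^ (N + 11))⁻¹) atTop (𝓝[>] 0) := by
    refine tendsto_nhdsWithin_iff.2 ⟨?_, Eventually.of_forall fun N => ?_⟩
    · have h1 := tendsto_pow_atTop_nhds_zero_of_lt_one (r := (1 / 2 : ℝ)) (by norm_num) (by norm_num)
      have h2 := h1.comp (tendsto_add_atTop_nat 11)
      refine h2.congr fun N => ?_
      simp
    · exact Set.mem_Ioi.2 (by positivity)
  have hmul : ∀ a : ℝ, 0 < a → Tendsto (fun N : ℕ => a * ((2 : ℝ) ^ (N + 11))⁻¹) atTop (𝓝[>] 0) := by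
    intro a ha
    rw [tendsto_nhdsWithin_iff] at hpow ⊢
    refine ⟨by simpa using hpow.1.const_mul a, ?_⟩
    filter_upwards [hpow.2] with N hN
    exact mul_pos ha hN
  have e1 : ∀ᶠ N : ℕ in atTop, oscModulus f (4 * ((2 : ℝ) ^ (N + 11))⁻¹) < m :=
    (tendsto_order.1 (hf.comp (hmul 4 (by norm_num)))).2 m (by exact_mod_cast hm)
  obtain ⟨r, hr, hrf⟩ := Metric.eventually_nhds_iff.1 hfa.eventually_analyticAt
  have e2 : ∀ᶠ N : ℕ in atTop, 256 * ((2 : ℝ) ^ (N + 11))⁻¹ < r :=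
    (tendsto_order.1 ((hmul 256 (by norm_num)).mono_right nhdsWithin_le_nhds)).2 r hr
  obtain ⟨N, h1, h2, h3⟩ := (e1.and (e2.and (hdens (2 * 4 ^ 11)⁻¹ (by positivity)))).exists
  -- With `δ = 2^{-(N+11)}`, the squares in question lie in the disc of radius `2048 δ = 2^{-N}`.
  have hδ : 2048 * ((2 : ℝ) ^ (N + 11))⁻¹ = (2 ^ N)⁻¹ := by
    rw [pow_add, mul_inv]
    norm_num
    ring
  refine ⟨N + 11, _, rfl, ?_, h1.le, fun z hz => hrf ?_, fun R hR hRx => ?_⟩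
  · rw [hδ]
    exact inv_le_one_of_one_le₀ (one_le_pow₀ (by norm_num))
  · rw [dist_eq_norm]
    exact hz.trans h2
  · have hsub : cube R \ X ⊆ Metric.closedBall x₀ (2 ^ N)⁻¹ \ X := by
      refine sdiff_subset_sdiff_left fun z hz => ?_
      rw [Metric.mem_closedBall, dist_eq_norm, ← hδ]
      have h4 := norm_sub_center_le hz
      rw [side, hR] at h4
      have h5 : ‖z - x₀‖ ≤ ‖z - center R‖ + ‖center R - x₀‖ := norm_sub_le_norm_sub_add_norm_sub _ _ _
      have : (0 : ℝ) < ((2 : ℝ) ^ (N + 11))⁻¹ := by positivity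
      linarith
    calc 2 * volume (cube R \ X) ≤ 2 * (((2 * 4 ^ 11)⁻¹ : ℝ≥0) * (4 ^ N)⁻¹) := by
          gcongr
          exact (measure_mono hsub).trans h3
      _ = volume (cube R) := by
          have h6 : ((4 : ℝ≥0∞) ^ N)⁻¹ = ((((4 : ℝ≥0) ^ N)⁻¹ : ℝ≥0) : ℝ≥0∞) := by
            rw [ENNReal.coe_inv (by positivity)]
            norm_num
          rw [volume_cube, side, hR, h6, ← ENNReal.coe_mul, ← ENNReal.coe_ofNat, ← ENNReal.coe_mul,
            ENNReal.ofReal, ENNReal.coe_inj]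
          rw [← NNReal.coe_inj, Real.coe_toNNReal _ (by positivity)]
          push_cast
          rw [inv_pow, ← pow_mul, mul_comm (N + 11) 2, pow_mul, pow_add]
          norm_num
          ring

lemma oscModulus_mono (f : ℂ → ℂ) : Monotone (oscModulus f) := fun _ _ h =>
  iSup₂_mono fun _ _ => iSup_mono fun _ => iSup_mono' fun hl => ⟨hl.trans h, le_rfl⟩

lemma measurableSet_cover (V : Set (ℕ × ℤ × ℤ)) : MeasurableSet (cover V) :=
  MeasurableSet.biUnion (to_countable V) fun Q _ => measurableSet_cube Q

lemma setLIntegral_sub_average_le (f : ℂ → ℂ) (w : ℂ) {r : ℝ} (hr : 0 < r) {A : Set ℂ}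
    (hA : A ⊆ Metric.closedBall w r) :
    ∫⁻ z in A, ‖f z - ⨍ v in square (w - ⟨r, r⟩) (2 * r), f v‖ₑ ≤
      ENNReal.ofReal (4 * r ^ 2) * meanOsc f (square (w - ⟨r, r⟩) (2 * r)) := by
  refine (lintegral_mono_set (hA.trans (closedBall_subset_square w r))).trans (le_of_eq ?_)
  rw [lintegral_sub_average_eq f _ (by positivity)]
  congr 2
  ring

/-- Outside the large squares, `f` and its extension `F` from `X` are close in the mean. -/
lemma setLIntegral_sub_le_of_half_filled {X : Set ℂ} (hX : MeasurableSet X) {f F : ℂ → ℂ}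
    (hf : LocallyIntegrable f volume) (hF : LocallyIntegrable F volume) (hfF : EqOn F f X)
    {x₀ : ℂ} {k : ℕ} {δ : ℝ} (hδ : δ = (2 ^ k)⁻¹) (hδ1 : 2048 * δ ≤ 1) {m : ℝ≥0}
    (hfm : oscModulus f (4 * δ) ≤ m) (hFm : bmoSeminorm F ≤ m) {G : Finset (ℕ × ℤ × ℤ)}
    (hG : ∀ R : ℕ × ℤ × ℤ, R.1 = k → ‖center R - x₀‖ ≤ 3 / 8 → ¬ cube R ⊆ cover G →
      2 * volume (cube R \ X) ≤ volume (cube R))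
    {A : Set ℂ} (hA : A ⊆ Metric.closedBall x₀ (1 / 4)) {p : ℂ} {r : ℝ}
    (hAr : A ⊆ Metric.closedBall p r) (hr : δ ≤ r) :
    ∫⁻ z in A \ cover G, ‖f z - F z‖ₑ ≤ 6 * m * ENNReal.ofReal (36 * r ^ 2) := by
  have hδ0 : 0 < δ := by rw [hδ]; positivity
  refine setLIntegral_le_of_cube_le (k := k) (sdiff_subset.trans hAr) (hδ ▸ hr) fun R hR hne => ?_
  obtain ⟨z, hzR, hzA, hzG⟩ := hne
  have hside : side R = δ := by rw [side, hR, hδ]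
  refine setLIntegral_cube_sub_le hf hF hX hfF ?_ ?_ (hG R hR ?_ fun hsub => hzG (hsub hzR))
  · exact (meanOsc_le_oscModulus f _ (side_pos R) (by rw [hside]; linarith)).trans hfm
  · exact (meanOsc_le_bmoSeminorm F _ (side_pos R)).trans hFm
  · have h1 := norm_sub_center_le hzR
    have h2 := hA hzA
    rw [Metric.mem_closedBall, dist_eq_norm] at h2
    have h3 : ‖center R - x₀‖ ≤ ‖z - center R‖ + ‖z - x₀‖ := by
      rw [norm_sub_rev z (center R)]
      exact norm_sub_le_norm_sub_add_norm_sub _ _ _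
    rw [hside] at h1
    linarith

/-- The main estimate. Cauchy's formula expresses the derivative through a cutoff that vanishes near
all the squares of a finite covering of the singularities of `f`. The squares are removed one by one:
the small ones are paid for by the oscillation of `f`, the large ones by the oscillation of a function
that agrees with the extension `F` on the large squares and with `f` elsewhere. -/
theorem enorm_iteratedDeriv_le {X : Set ℂ} (hX : MeasurableSet X) {x₀ : ℂ} {t : ℕ} {B : ℝ}
    (hB : ∀ (c : ℂ) (R : ℝ) (z : ℂ), 0 < R → ‖dbar (bump c R) z‖ ≤ B / R) (hB0 : 0 ≤ B) {S : ℝ≥0}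
    (hcover : ∀ h : ℝ≥0 → ℝ≥0, Monotone h → (∀ E, hContent h E ≤ lowerContent E) →
      ∃ V : Set (ℕ × ℤ × ℤ), (∀ Q ∈ V, 8 * side Q ≤ ‖center Q - x₀‖ ∧ ‖center Q - x₀‖ ≤ 1) ∧
        (Metric.closedBall x₀ (1 / 2) \ {x₀}) \ X ⊆ cover V ∧
        ∑' Q : V, weight x₀ t Q * h (nnside Q) ≤ S)
    (hdens : ∀ ε : ℝ≥0, 0 < ε → ∀ᶠ N : ℕ in atTop,
      volume (Metric.closedBall x₀ (2 ^ N)⁻¹ \ X) ≤ ε * (4 ^ N)⁻¹)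
    {f F : ℂ → ℂ} (hf : MemVMO f) (hfa : AnalyticOnNhd ℂ f (X ∪ {x₀}))
    (hF : LocallyIntegrable F volume) (hfF : EqOn F f X) {m : ℝ≥0} (hm : 0 < m)
    (hFm : bmoSeminorm F ≤ m) (c : ℂ) {M : ℝ≥0∞}
    (hM : ∫⁻ z in Metric.closedBall x₀ (1 / 4), ‖F z - c‖ₑ ≤ M) :
    ‖(2 * Real.pi / t.factorial * iteratedDeriv t f x₀ : ℂ)‖ₑ ≤
      ENNReal.ofReal (30 * B) * 2 ^ (t + 1) * (16 * m * S) +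
      ENNReal.ofReal (30 * B) * 2 ^ (t + 1) * (880 * m * ((1 + 2 ^ (t + 2)) * S)) +
      ENNReal.ofReal (4 * B) * 8 ^ (t + 1) * (M + 14 * m) +
      ‖cauchyPairing x₀ t (fun _ => c) (cutoff x₀ ∅)‖ₑ := by
  classical
  obtain ⟨k, δ, hδ, hδ1, hfm, hanal, hhalf⟩ := exists_scale hm hf.2 (hfa x₀ (Or.inr rfl)) hdens
  have hδ0 : 0 < δ := by rw [hδ]; positivity
  have hfl : LocallyIntegrable f volume := hf.1.1
  -- The covering adapted to the oscillation of `f`.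
  obtain ⟨h, hmono, hle, h1, h2⟩ := exists_gauge (oscModulus_mono f) hf.2 hm
    (show (0 : ℝ≥0) < ⟨δ, hδ0.le⟩ from hδ0) hfm
  obtain ⟨V, hV, hcov, hVS⟩ := hcover h hmono hle
  obtain ⟨G, hGk, hGV, hGS, hG⟩ := exists_large_squares hδ hV hcov hVS
    (fun s hs => h1 s hs) (fun s hs => by exact_mod_cast (h2 s hs).1) hhalf
  -- Finitely many squares suffice for the singularities of `f`.
  have hUo : IsOpen {z : ℂ | AnalyticAt ℂ f z} := isOpen_analyticAt ℂ f
  set V' : Set (ℕ × ℤ × ℤ) := {Q | Q ∈ V ∧ 128 * δ ≤ ‖center Q - x₀‖} with hV'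
  have hK : IsCompact (Metric.closedBall x₀ (1 / 4) \ {z : ℂ | AnalyticAt ℂ f z}) :=
    (isCompact_closedBall x₀ (1 / 4)).diff hUo
  obtain ⟨s, hsV', hsfin, hsK⟩ := hK.elim_finite_subcover_image (b := V')
    (c := fun Q => Metric.ball (center Q) (5 / 4 * side Q)) (fun _ _ => Metric.isOpen_ball) (by
      intro z hz
      have hzfar : 256 * δ ≤ ‖z - x₀‖ := by
        by_contra! hlt
        exact hz.2 (hanal z hlt)
      have hz14 := hz.1
      rw [Metric.mem_closedBall, dist_eq_norm] at hz14
      obtain ⟨Q, hQ, hzQ⟩ := mem_cover.1 (hcov (show z ∈ (Metric.closedBall x₀ (1 / 2) \ {x₀}) \ X by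
        refine ⟨⟨?_, fun h0 => ?_⟩, fun hzX => hz.2 (hfa z (Or.inl hzX))⟩
        · rw [Metric.mem_closedBall, dist_eq_norm]
          linarith
        · rw [mem_singleton_iff] at h0
          rw [h0, sub_self, norm_zero] at hzfar
          linarith))
      have hzc := norm_sub_center_le hzQ
      refine mem_iUnion₂.2 ⟨Q, ⟨hQ, ?_⟩, ?_⟩
      · have h3 : ‖z - x₀‖ ≤ ‖z - center Q‖ + ‖center Q - x₀‖ :=
          norm_sub_le_norm_sub_add_norm_sub _ _ _
        linarith [(hV Q hQ).1]
      · rw [Metric.mem_ball, dist_eq_norm]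
        linarith [side_pos Q])
  set J : Finset (ℕ × ℤ × ℤ) := hsfin.toFinset \ G with hJ
  have hJV : ∀ Q ∈ J, Q ∈ V ∧ k < Q.1 := by
    intro Q hQ
    obtain ⟨hQs, hQG⟩ := Finset.mem_sdiff.1 hQ
    have hQV := hsV' (hsfin.mem_toFinset.1 hQs)
    exact ⟨hQV.1, not_le.1 fun hle => hQG (hGV Q hQV.1 hle hQV.2)⟩
  have hsmall : ∀ Q ∈ G ∪ J, 8 * side Q ≤ ‖center Q - x₀‖ := by
    intro Q hQ
    rcases Finset.mem_union.1 hQ with hQ | hQ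
    exacts [(hGk Q hQ).2.1, (hV Q (hJV Q hQ).1).1]
  have hcauchy : cauchyPairing x₀ t f (cutoff x₀ (G ∪ J)) =
      -(2 * Real.pi / t.factorial * iteratedDeriv t f x₀) := by
    refine integral_dbar_mul_cauchyKernel t (contDiff_cutoff x₀ _) (hasCompactSupport_cutoff x₀ _)
      (cutoff_eventuallyEq_one hsmall) hUo (fun z hz => ?_)
      fun z hz => (AnalyticAt.differentiableAt hz).differentiableWithinAt
    by_contra hzU
    obtain ⟨Q, hQs, hzQ⟩ := mem_iUnion₂.1 (hsK ⟨tsupport_cutoff_subset x₀ _ hz, hzU⟩)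
    have hQ : Q ∈ G ∪ J := by
      by_cases hQG : Q ∈ G
      · exact Finset.mem_union_left _ hQG
      · exact Finset.mem_union_right _ (Finset.mem_sdiff.2 ⟨hsfin.mem_toFinset.2 hQs, hQG⟩)
    rw [Metric.mem_ball, dist_eq_norm] at hzQ
    exact notMem_tsupport_iff_eventuallyEq.2 (cutoff_eventuallyEq_zero hQ hzQ) hz
  -- The small squares.
  have hsmallsq : ‖cauchyPairing x₀ t f (cutoff x₀ (G ∪ J)) - cauchyPairing x₀ t f (cutoff x₀ G)‖ₑ ≤
      ENNReal.ofReal (30 * B) * 2 ^ (t + 1) * (16 * m * S) := by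
    refine (enorm_cauchyPairing_union_sub_le hB hB0 hfl Finset.disjoint_sdiff
      (fun Q hQ R hR => (hGk R hR).1.trans (hJV Q hQ).2.le) hsmall
      (β := fun Q => 16 * (m * h (nnside Q))) fun Q hQ => ?_).trans ?_
    · refine ⟨_, (setLIntegral_sub_average_le f (center Q) (two_side_pos Q) inter_subset_left).trans ?_⟩
      have hQδ : (nnside Q : ℝ) ≤ δ := by
        rw [coe_nnside, side, hδ]
        exact inv_anti₀ (by positivity) (pow_le_pow_right₀ (by norm_num) (hJV Q hQ).2.le)
      calc ENNReal.ofReal (4 * (2 * side Q) ^ 2) * meanOsc f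
            (square (center Q - ⟨2 * side Q, 2 * side Q⟩) (2 * (2 * side Q)))
          ≤ ENNReal.ofReal (4 * (2 * side Q) ^ 2) * oscModulus f (4 * nnside Q) := by
            gcongr
            refine meanOsc_le_oscModulus f _ (mul_pos two_pos (two_side_pos Q)) ?_
            rw [coe_nnside]
            linarith
        _ = nnside Q * (16 * (nnside Q * oscModulus f (4 * nnside Q))) := by
            have : ENNReal.ofReal (4 * (2 * side Q) ^ 2) = 16 * (nnside Q * nnside Q) := by
              rw [← ENNReal.ofReal_coe_nnreal, coe_nnside, ← ENNReal.ofReal_mul (side_pos Q).le,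
                ← ENNReal.ofReal_ofNat 16, ← ENNReal.ofReal_mul (by norm_num)]
              congr 1
              ring
            rw [this]
            ring
        _ ≤ nnside Q * (16 * (m * h (nnside Q))) := by
            exact mul_le_mul_right (mul_le_mul_right (h2 (nnside Q) hQδ).2 _) _
    · gcongr
      calc ∑ Q ∈ J, weight x₀ t Q * (16 * (m * (h (nnside Q) : ℝ≥0∞)))
          = 16 * m * ∑ Q ∈ J, weight x₀ t Q * h (nnside Q) := by
            rw [Finset.mul_sum]
            exact Finset.sum_congr rfl fun Q _ => by ring
        _ ≤ 16 * m * S := by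
            gcongr
            exact (sum_le_tsum_subtype (fun Q hQ => (hJV Q hQ).1)
              fun Q => weight x₀ t Q * (h (nnside Q) : ℝ≥0∞)).trans hVS
  -- On the large squares the cutoff vanishes, so `f` may be replaced by `F` there.
  set g : ℂ → ℂ := fun z => (cover G).indicator F z + (cover G)ᶜ.indicator f z with hg
  have hgl : LocallyIntegrable g volume :=
    (hF.indicator (measurableSet_cover _)).add (hfl.indicator (measurableSet_cover _).compl)
  have hgF : ∀ z ∈ cover G, g z = F z := fun z hz => by
    simp only [hg]
    rw [indicator_of_mem hz, indicator_of_notMem (Set.notMem_compl_iff.2 hz), add_zero]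
  have hgf : ∀ z ∉ cover G, g z = f z := fun z hz => by
    simp only [hg]
    rw [indicator_of_notMem hz, indicator_of_mem hz, zero_add]
  have hreplace : cauchyPairing x₀ t f (cutoff x₀ G) = cauchyPairing x₀ t g (cutoff x₀ G) := by
    rw [cauchyPairing, cauchyPairing]
    congr 1
    ext z
    by_cases hz : z ∈ cover G
    · obtain ⟨Q, hQ, hzQ⟩ := mem_cover.1 hz
      have hzc : ‖z - center Q‖ < 5 / 4 * side Q := by
        linarith [norm_sub_center_le hzQ, side_pos Q]
      rw [dbar_eq_zero_of_eventuallyEq_const (cutoff_eventuallyEq_zero (Finset.mem_coe.1 hQ) hzc),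
        zero_mul, zero_mul]
    · rw [hgf z hz]
  have hgsub : ∀ (a : ℂ) {A : Set ℂ} {p : ℂ} {r : ℝ}, MeasurableSet A →
      A ⊆ Metric.closedBall x₀ (1 / 4) → A ⊆ Metric.closedBall p r → δ ≤ r →
      ∫⁻ z in A, ‖g z - a‖ₑ ≤ (∫⁻ z in A, ‖F z - a‖ₑ) + 6 * m * ENNReal.ofReal (36 * r ^ 2) := by
    intro a A p r hAm hA hAr hr
    have hD := setLIntegral_sub_le_of_half_filled hX hfl hF hfF hδ hδ1 hfm hFm hG hA hAr hr
    calc ∫⁻ z in A, ‖g z - a‖ₑ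
        ≤ ∫⁻ z in A, (‖F z - a‖ₑ + (cover G)ᶜ.indicator (fun z => ‖f z - F z‖ₑ) z) := by
          refine lintegral_mono fun z => ?_
          by_cases hz : z ∈ cover G
          · simp only [hgF z hz]
            exact le_self_add
          · simp only [hgf z hz]
            rw [indicator_of_mem hz, add_comm]
            refine le_trans (le_of_eq ?_) (enorm_add_le _ _)
            congr 1
            ring
      _ = (∫⁻ z in A, ‖F z - a‖ₑ) + ∫⁻ z in A \ cover G, ‖f z - F z‖ₑ := by
          have hmeas : AEMeasurable (fun z => ‖F z - a‖ₑ) (volume.restrict A) :=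
            (hF.aestronglyMeasurable.sub aestronglyMeasurable_const).enorm.restrict
          rw [lintegral_add_left' hmeas, setLIntegral_indicator (measurableSet_cover _).compl, inter_comm, sdiff_eq]
      _ ≤ _ := by gcongr
  have hlarge : ‖cauchyPairing x₀ t g (cutoff x₀ G) - cauchyPairing x₀ t g (cutoff x₀ ∅)‖ₑ ≤
      ENNReal.ofReal (30 * B) * 2 ^ (t + 1) * (880 * m * ((1 + 2 ^ (t + 2)) * S)) := by
    have := enorm_cauchyPairing_union_sub_le hB hB0 (x₀ := x₀) (t := t) hgl (A := ∅) (J := G)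
      (Finset.disjoint_empty_left G) (fun _ _ _ h => absurd h (Finset.notMem_empty _))
      (fun Q hQ => hsmall Q (Finset.mem_union_left _ (by simpa using hQ)))
      (β := fun Q => 880 * m * nnside Q) fun Q hQ => ?_
    · rw [Finset.empty_union] at this
      refine this.trans ?_
      gcongr
      calc ∑ Q ∈ G, weight x₀ t Q * (880 * m * (nnside Q : ℝ≥0∞))
          = 880 * m * ∑ Q ∈ G, weight x₀ t Q * nnside Q := by
            rw [Finset.mul_sum]
            exact Finset.sum_congr rfl fun Q _ => by ring
        _ ≤ _ := by gcongr
    · have hQδ : δ ≤ 2 * side Q := by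
        have : δ ≤ side Q := by
          rw [side, hδ]
          exact inv_anti₀ (by positivity) (pow_le_pow_right₀ (by norm_num) (hGk Q hQ).1)
        linarith [side_pos Q]
      refine ⟨⨍ v in square (center Q - ⟨2 * side Q, 2 * side Q⟩) (2 * (2 * side Q)), F v,
        (hgsub _ (Metric.isClosed_closedBall.measurableSet.inter
        Metric.isClosed_closedBall.measurableSet) inter_subset_right inter_subset_left hQδ).trans ?_⟩
      have e1 : ENNReal.ofReal (4 * (2 * side Q) ^ 2) = 16 * (nnside Q * nnside Q) := by
        rw [← ENNReal.ofReal_coe_nnreal, coe_nnside, ← ENNReal.ofReal_mul (side_pos Q).le,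
          ← ENNReal.ofReal_ofNat 16, ← ENNReal.ofReal_mul (by norm_num)]
        congr 1
        ring
      have e2 : ENNReal.ofReal (36 * (2 * side Q) ^ 2) = 144 * (nnside Q * nnside Q) := by
        rw [← ENNReal.ofReal_coe_nnreal, coe_nnside, ← ENNReal.ofReal_mul (side_pos Q).le,
          ← ENNReal.ofReal_ofNat 144, ← ENNReal.ofReal_mul (by norm_num)]
        congr 1
        ring
      refine (add_le_add ((setLIntegral_sub_average_le F (center Q) (two_side_pos Q)
        inter_subset_left).trans (mul_le_mul_right ((meanOsc_le_bmoSeminorm F _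
          (mul_pos two_pos (two_side_pos Q))).trans hFm) _)) le_rfl).trans (le_of_eq ?_)
      rw [e1, e2]
      ring
  -- What is left is the pairing with the fixed cutoff.
  have hzero : ‖cauchyPairing x₀ t g (cutoff x₀ ∅)‖ₑ ≤
      ENNReal.ofReal (4 * B) * 8 ^ (t + 1) * (M + 14 * m) +
        ‖cauchyPairing x₀ t (fun _ => c) (cutoff x₀ ∅)‖ₑ := by
    have hone : cutoff x₀ ∅ =ᶠ[𝓝 x₀] fun _ => 1 :=
      cutoff_eventuallyEq_one fun _ h => absurd h (Finset.notMem_empty _)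
    have e1 : cauchyPairing x₀ t g (cutoff x₀ ∅) =
        cauchyPairing x₀ t (fun z => g z - c) (cutoff x₀ ∅) +
          cauchyPairing x₀ t (fun _ => c) (cutoff x₀ ∅) := by
      rw [cauchyPairing_sub_left hgl (locallyIntegrable_const c) (contDiff_cutoff x₀ ∅)
        (hasCompactSupport_cutoff x₀ ∅) (notMem_tsupport_dbar_of_eventuallyEq_one hone),
        sub_add_cancel]
    rw [e1]
    refine (enorm_add_le _ _).trans (add_le_add ?_ le_rfl)
    refine (enorm_cauchyPairing_empty_le hB x₀ t _).trans ?_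
    gcongr
    have hsub : {z : ℂ | 1 / 8 ≤ ‖z - x₀‖ ∧ ‖z - x₀‖ ≤ 1 / 4} ⊆ Metric.closedBall x₀ (1 / 4) :=
      fun z hz => by
        rw [Metric.mem_closedBall, dist_eq_norm]
        exact hz.2
    refine (lintegral_mono_set hsub).trans ((hgsub c Metric.isClosed_closedBall.measurableSet
      Subset.rfl Subset.rfl (by linarith)).trans (add_le_add hM ?_))
    rw [← ENNReal.ofReal_ofNat 6, mul_right_comm, ← ENNReal.ofReal_mul (by norm_num),
      ← ENNReal.ofReal_ofNat 14]
    gcongr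
    norm_num
  calc ‖(2 * Real.pi / t.factorial * iteratedDeriv t f x₀ : ℂ)‖ₑ
      = ‖(cauchyPairing x₀ t f (cutoff x₀ (G ∪ J)) - cauchyPairing x₀ t f (cutoff x₀ G)) +
          (cauchyPairing x₀ t g (cutoff x₀ G) - cauchyPairing x₀ t g (cutoff x₀ ∅)) +
          cauchyPairing x₀ t g (cutoff x₀ ∅)‖ₑ := by
        rw [← hreplace, sub_add_sub_cancel, sub_add_cancel, hcauchy, enorm_neg]
    _ ≤ _ := by
        refine (enorm_add_le _ _).trans ((add_le_add ((enorm_add_le _ _).trans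
          (add_le_add hsmallsq hlarge)) hzero).trans (le_of_eq ?_))
        ring

lemma cauchyPairing_const_cutoff_empty (x₀ : ℂ) (t : ℕ) (c : ℂ) :
    cauchyPairing x₀ t (fun _ => c) (cutoff x₀ ∅) =
      -(2 * Real.pi / t.factorial * iteratedDeriv t (fun _ => c) x₀) :=
  integral_dbar_mul_cauchyKernel t (contDiff_cutoff x₀ _) (hasCompactSupport_cutoff x₀ _)
    (cutoff_eventuallyEq_one fun _ h => absurd h (Finset.notMem_empty _)) isOpen_univ
    (subset_univ _) (differentiableOn_const c)

lemma volume_pos_of_density {X : Set ℂ} {x₀ : ℂ} (hdens : ∀ ε : ℝ≥0, 0 < ε → ∀ᶠ N : ℕ in atTop,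
      volume (Metric.closedBall x₀ (2 ^ N)⁻¹ \ X) ≤ ε * (4 ^ N)⁻¹) : volume X ≠ 0 := by
  intro h0
  obtain ⟨N, hN⟩ := (hdens 1 one_pos).exists
  have h1 : volume (Metric.closedBall x₀ ((2 : ℝ) ^ N)⁻¹) ≤ (4 ^ N)⁻¹ := by
    rw [ENNReal.coe_one, one_mul] at hN
    have hsub : Metric.closedBall x₀ ((2 : ℝ) ^ N)⁻¹ ⊆
        X ∪ (Metric.closedBall x₀ ((2 : ℝ) ^ N)⁻¹ \ X) := by
      rw [union_sdiff_self]
      exact subset_union_right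
    refine (measure_mono hsub).trans ((measure_union_le _ _).trans ?_)
    rwa [h0, zero_add]
  rw [Complex.volume_closedBall, ← ENNReal.ofReal_pow (by positivity), ← ENNReal.ofReal_coe_nnreal,
    ← ENNReal.ofReal_mul (by positivity)] at h1
  have h2 : ((4 : ℝ≥0∞) ^ N)⁻¹ = ENNReal.ofReal (((2 : ℝ) ^ N)⁻¹ ^ 2) := by
    rw [inv_pow, ← pow_mul, mul_comm N 2, pow_mul, ENNReal.ofReal_inv_of_pos (by positivity),
      ENNReal.ofReal_pow (by norm_num)]
    norm_num
  rw [h2, ENNReal.ofReal_le_ofReal_iff (by positivity)] at h1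
  have h3 : (0 : ℝ) < ((2 : ℝ) ^ N)⁻¹ ^ 2 := by positivity
  rw [NNReal.coe_real_pi] at h1
  nlinarith [Real.pi_gt_three]

/-- The contribution of the constants. It vanishes for `t ≥ 1`; for `t = 0` the mean value of `F` is
controlled by the integral of `F` over the bounded set `X`, which has positive area. -/
lemma exists_constant {X : Set ℂ} {x₀ : ℂ} {t : ℕ}
    (hbdd : t = 0 → Bornology.IsBounded X) (hdens : ∀ ε : ℝ≥0, 0 < ε → ∀ᶠ N : ℕ in atTop,
      volume (Metric.closedBall x₀ (2 ^ N)⁻¹ \ X) ≤ ε * (4 ^ N)⁻¹) :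
    ∃ K : ℝ≥0, ∀ (F : ℂ → ℂ) (m : ℝ≥0), LocallyIntegrable F volume → bmoSeminorm F ≤ m →
      ∃ c : ℂ, ∫⁻ z in Metric.closedBall x₀ (1 / 4), ‖F z - c‖ₑ ≤ K * m ∧
        ‖cauchyPairing x₀ t (fun _ => c) (cutoff x₀ ∅)‖ₑ ≤ K * (m + ‖∫ z in X, F z‖ₑ) := by
  have hmean : ∀ (F : ℂ → ℂ) (m : ℝ≥0) (L : ℝ), 0 < L → bmoSeminorm F ≤ m →
      ∀ A ⊆ Metric.closedBall x₀ L,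
      ∫⁻ z in A, ‖F z - ⨍ v in square (x₀ - ⟨L, L⟩) (2 * L), F v‖ₑ ≤ ENNReal.ofReal (4 * L ^ 2) * m :=
    fun F m L hL hFm A hA => (setLIntegral_sub_average_le F x₀ hL hA).trans
      (mul_le_mul_right ((meanOsc_le_bmoSeminorm F _ (by positivity)).trans hFm) _)
  rcases Nat.eq_zero_or_pos t with rfl | ht
  · obtain ⟨L', hL'⟩ := (hbdd rfl).subset_closedBall x₀
    set L := max L' 1 with hL
    have hL0 : 0 < L := lt_max_of_lt_right one_pos
    have hXL : X ⊆ Metric.closedBall x₀ L :=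
      hL'.trans (Metric.closedBall_subset_closedBall (le_max_left _ _))
    have hv0 := volume_pos_of_density hdens
    have hvt : volume X ≠ ⊤ :=
      ne_top_of_le_ne_top (isCompact_closedBall x₀ L).measure_lt_top.ne (measure_mono hXL)
    set P : ℝ≥0 := ENNReal.toNNReal (‖(2 * Real.pi : ℂ)‖ₑ * (volume X)⁻¹) with hP
    have hPc : (P : ℝ≥0∞) = ‖(2 * Real.pi : ℂ)‖ₑ * (volume X)⁻¹ :=
      ENNReal.coe_toNNReal (ENNReal.mul_ne_top enorm_ne_top (ENNReal.inv_ne_top.2 hv0))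
    set A : ℝ≥0 := Real.toNNReal (4 * L ^ 2) with hA
    refine ⟨A + P * (A + 1), fun F m hF hFm => ⟨⨍ v in square (x₀ - ⟨L, L⟩) (2 * L), F v, ?_, ?_⟩⟩
    · refine (hmean F m L hL0 hFm _ (Metric.closedBall_subset_closedBall ?_)).trans ?_
      · linarith [le_max_right L' 1]
      · rw [ENNReal.ofReal]
        gcongr
        exact le_self_add
    · set c : ℂ := ⨍ v in square (x₀ - ⟨L, L⟩) (2 * L), F v with hc
      have hFX : IntegrableOn F X := (hF.integrableOn_isCompact (isCompact_closedBall x₀ L)).mono_set hXL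
      have hcX : IntegrableOn (fun _ => c) X := integrableOn_const hvt
      have h1 : ‖c‖ₑ * volume X ≤ ‖∫ z in X, F z‖ₑ + A * m := by
        have h2 : ∫ z in X, c = (∫ z in X, F z) - ∫ z in X, (F z - c) := by
          rw [integral_sub hFX hcX, sub_sub_cancel]
        have h3 : ‖∫ _ in X, c‖ₑ = ‖c‖ₑ * volume X := by
          rw [setIntegral_const, enorm_smul, mul_comm, measureReal_def,
            Real.enorm_of_nonneg ENNReal.toReal_nonneg, ENNReal.ofReal_toReal hvt]
        rw [← h3, h2]
        refine (enorm_sub_le).trans (add_le_add le_rfl ?_)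
        exact (enorm_integral_le_lintegral_enorm _).trans (hmean F m L hL0 hFm X hXL)
      rw [cauchyPairing_const_cutoff_empty, enorm_neg, iteratedDeriv_zero, Nat.factorial_zero,
        Nat.cast_one, div_one, enorm_mul]
      calc ‖(2 * Real.pi : ℂ)‖ₑ * ‖c‖ₑ = P * (‖c‖ₑ * volume X) := by
            rw [hPc, mul_assoc, mul_comm ‖c‖ₑ, ENNReal.inv_mul_cancel_left hv0 hvt]
        _ ≤ P * (‖∫ z in X, F z‖ₑ + A * m) := by gcongr
        _ ≤ P * ((A + 1) * (m + ‖∫ z in X, F z‖ₑ)) := by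
            gcongr
            rw [add_mul, one_mul, mul_add, add_comm]
            exact add_le_add le_self_add le_add_self
        _ ≤ _ := by
            push_cast
            rw [← mul_assoc]
            gcongr
            exact le_add_self
  · refine ⟨1, fun F m hF hFm => ⟨⨍ v in square (x₀ - ⟨1 / 4, 1 / 4⟩) (2 * (1 / 4)), F v, ?_, ?_⟩⟩
    · refine (hmean F m (1 / 4) (by norm_num) hFm _ Subset.rfl).trans ?_
      gcongr
      rw [ENNReal.coe_one, ENNReal.ofReal_le_one]
      norm_num
    · rw [cauchyPairing_const_cutoff_empty, iteratedDeriv_const, if_neg ht.ne', mul_zero, neg_zero,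
        enorm_zero]
      exact zero_le

/-- If the series converges, then `A₀(X)` admits a bounded point derivation. The estimate for a single
extension `F` passes to the infimum over all extensions because its constant does not depend on `F`. -/
theorem admitsBoundedPointDerivation_of_tsum_lt_top {X : Set ℂ} (hX : MeasurableSet X) {x₀ : ℂ} {t : ℕ}
    (hbdd : t = 0 → Bornology.IsBounded X)
    (hsum : ∑' n : ℕ, (2 : ℝ≥0∞) ^ ((t + 1) * (n + 1)) * lowerContent (annulus x₀ (n + 1) \ X) < ⊤) :
    AdmitsBoundedPointDerivation X x₀ t := by
  obtain ⟨B, hB1, hB⟩ := exists_norm_dbar_bump_le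
  obtain ⟨S, hcover⟩ := exists_dyadic_cover hsum
  have hdens : ∀ ε : ℝ≥0, 0 < ε → ∀ᶠ N : ℕ in atTop,
      volume (Metric.closedBall x₀ (2 ^ N)⁻¹ \ X) ≤ ε * (4 ^ N)⁻¹ := fun ε hε =>
    eventually_volume_closedBall_diff_le hsum hε
  obtain ⟨K, hK⟩ := exists_constant hbdd hdens
  set a : ℂ := 2 * Real.pi / t.factorial with ha
  have ha0 : ‖a‖ₑ ≠ 0 := by
    rw [enorm_ne_zero]
    exact div_ne_zero (mul_ne_zero two_ne_zero (Complex.ofReal_ne_zero.2 Real.pi_ne_zero))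
      (Nat.cast_ne_zero.2 (Nat.factorial_ne_zero t))
  set K' : ℝ≥0∞ := ENNReal.ofReal (30 * B) * 2 ^ (t + 1) * (16 * S) +
      ENNReal.ofReal (30 * B) * 2 ^ (t + 1) * (880 * ((1 + 2 ^ (t + 2)) * S)) +
      ENNReal.ofReal (4 * B) * 8 ^ (t + 1) * (K + 14) + K with hK'
  have hKt : K' ≠ ⊤ := by
    rw [hK']
    finiteness
  have hCt : ‖a‖ₑ⁻¹ * K' + 1 ≠ ⊤ :=
    ENNReal.add_ne_top.2 ⟨ENNReal.mul_ne_top (ENNReal.inv_ne_top.2 ha0) hKt, ENNReal.one_ne_top⟩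
  refine ⟨(‖a‖ₑ⁻¹ * K' + 1).toNNReal, fun f hf hfa => ?_⟩
  rw [ENNReal.coe_toNNReal hCt, bmoNormOn]
  split_ifs with hint
  swap
  · rw [add_top, ENNReal.mul_top (by simp)]
    exact le_top
  have key : ∀ m : ℝ≥0, bmoSeminormOn X f < m →
      ‖iteratedDeriv t f x₀‖ₑ ≤ (‖a‖ₑ⁻¹ * K' + 1) * (m + ‖∫ z in X, f z‖ₑ) := by
    intro m hm
    have hm' := hm
    simp only [bmoSeminormOn, iInf_lt_iff] at hm'
    obtain ⟨F, hF, hFf, hFm⟩ := hm'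
    obtain ⟨c, hc1, hc2⟩ := hK F m hF.1 hFm.le
    have hm0 : 0 < m := ENNReal.coe_pos.1 (lt_of_le_of_lt zero_le hm)
    have h1 := enorm_iteratedDeriv_le hX hB (zero_le_one.trans hB1) hcover hdens hf hfa hF.1 hFf hm0
      hFm.le c hc1
    rw [setIntegral_congr_fun hX hFf] at hc2
    rw [enorm_mul] at h1
    have h2 : ‖a‖ₑ * ‖iteratedDeriv t f x₀‖ₑ ≤ K' * (m + ‖∫ z in X, f z‖ₑ) := by
      refine h1.trans ((add_le_add le_rfl hc2).trans ?_)
      rw [hK', add_mul _ (K : ℝ≥0∞)]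
      gcongr
      refine le_trans (le_of_eq ?_) (mul_le_mul_right le_self_add _)
      ring
    calc ‖iteratedDeriv t f x₀‖ₑ = ‖a‖ₑ⁻¹ * (‖a‖ₑ * ‖iteratedDeriv t f x₀‖ₑ) := by
          rw [ENNReal.inv_mul_cancel_left ha0 enorm_ne_top]
      _ ≤ ‖a‖ₑ⁻¹ * (K' * (m + ‖∫ z in X, f z‖ₑ)) := by gcongr
      _ ≤ _ := by
          rw [← mul_assoc]
          gcongr
          exact le_self_add
  have hN : bmoSeminormOn X f ≠ ⊤ := ne_top_of_le_ne_top hf.1.2.ne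
    (iInf_le_of_le f (iInf₂_le_of_le hf.1 (fun _ _ => rfl) le_rfl))
  lift bmoSeminormOn X f to ℝ≥0 using hN with N
  have hlim : Tendsto (fun m : ℝ≥0 => (‖a‖ₑ⁻¹ * K' + 1) * ((m : ℝ≥0∞) + ‖∫ z in X, f z‖ₑ)) (𝓝[>] N)
      (𝓝 ((‖a‖ₑ⁻¹ * K' + 1) * ((N : ℝ≥0∞) + ‖∫ z in X, f z‖ₑ))) := by
    refine ENNReal.Tendsto.const_mul (Tendsto.add ?_ tendsto_const_nhds) (Or.inr hCt)
    exact (ENNReal.tendsto_coe.2 tendsto_id).mono_left nhdsWithin_le_nhds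
  refine ge_of_tendsto hlim ?_
  filter_upwards [self_mem_nhdsWithin] with m hm
  exact key m (by exact_mod_cast hm)

end VMODerivation

theorem theorem1 (X : Set ℂ) (hX : MeasurableSet X) (x₀ : ℂ) (hx₀ : x₀ ∈ frontier X) (t : ℕ)
    (hbdd : t = 0 → Bornology.IsBounded X) :
    VMODerivation.AdmitsBoundedPointDerivation X x₀ t ↔
      ∑' n : ℕ, (2 : ENNReal) ^ ((t + 1) * (n + 1)) *
        VMODerivation.lowerContent (VMODerivation.annulus x₀ (n + 1) \ X) < ⊤ := by
  exact ⟨VMODerivation.tsum_lt_top_of_admitsBoundedPointDerivation hX,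
    VMODerivation.admitsBoundedPointDerivation_of_tsum_lt_top hX hbdd⟩
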